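/- Let $F:\mathbf{Set}\to\mathbf{Set}$ be an endofunctor that is nontrivial ($FX=\emptyset$ implies $X=\emptyset$), sends pullback squares to weak pullback squares (squares with the existence part of the universal property of a pullback), and is bounded or accessible. (Bounded: for some cardinal $\kappa$, every element of every $F$-coalgebra $A$ lies in a subcoalgebra of $A$ of cardinality at most $\kappa$. Accessible: $F$ preserves $\kappa$-filtered colimits for some regular cardinal $\kappa$.) Let $\mathbf{Set}_F$ be the category of $F$-coalgebras, and let $\mathbf{Pfn}_F$ be the category with the same objects whose morphisms $X\to Y$ are the classes $\{m,\varphi\}$ of pairs $m:U\rightarrowtail X$, $\varphi:U\to Y$ of morphisms of $\mathbf{Set}_F$ with $m$ a monomorphism, modulo isomorphism of $U$, composed by pullback. The morphism $\varphi:A\to B$ of $\mathbf{Set}_F$ is identified with $\{1_A,\varphi\}$. **Proposition.** $\mathbf{Pfn}_F$ is an iteration category. More precisely, $\mathbf{Pfn}_F$ carries an iteration category structure, in the sense defined below, whose near product $\boxtimes$ extends the product of $\mathbf{Set}_F$ ($X\boxtimes Y=X\times Y$ with its projections, and $\{m,\varphi\}\boxtimes\{m',\varphi'\}=\{m\times m',\varphi\times\varphi'\}$),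 whose binary coproduct is that of $\mathbf{Set}_F$, and whose total morphisms are exactly the morphisms of $\mathbf{Set}_F$. **Definitions.** Composites are written right to left. *$P$-category.* A category $\mathbf C$ with a functor $\boxtimes:\mathbf C\times\mathbf C\to\mathbf C$, a natural transformation $\Delta_X:X\to X\boxtimes X$, and families of morphisms $p_0:X\boxtimes Y\to X$, $p_1:X\boxtimes Y\to Y$ (not assumed natural) such that, with $\langle f,g\rangle=(f\boxtimes g)\Delta$: (i) $p_i\Delta_X=1_X$ and $(p_0\boxtimes p_1)\Delta_{X\boxtimes Y}=1_{X\boxtimes Y}$; (ii) if $\mathbf P$ is the smallest subcategory that contains all objects and all components of $p_0,p_1$ and is closed under $\boxtimes$, then $p_0(f\boxtimes g)=f p_0$ whenever $g\in\mathbf P$, and $p_1(f\boxtimes g)=g p_1$ whenever $f\in\mathbf P$; (iii) the morphisms $\mathrm{ass}=\langle p_0p_0,\langle p_1p_0,p_1\rangle\rangle:(X\boxtimes Y)\boxtimes Z\to X\boxtimes(Y\boxtimes Z)$ are natural isomorphisms satisfying the pentagon identity; (iv) the morphisms $\mathrm{tr}=\langle p_1,p_0\rangle:X\boxtimes Y\to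 Y\boxtimes X$ are natural, $\mathrm{tr}\,\mathrm{tr}=1$, and the hexagon identity holds. A *$B$-category* is defined in the same way with (ii) replaced by naturality of $p_0,p_1$; its product is written $\times$. A *binary coproduct* is a functor $\coprod$ with natural $i_0,i_1,\nabla$ satisfying the duals of (i), (iii), (iv); one writes $[f,g]=\nabla(f\coprod g)$. A *$P^+$-category* (*$B^+$-category*) is a $P$-category ($B$-category) with a binary coproduct such that $[1\boxtimes i_0,1\boxtimes i_1]:(X\boxtimes Y)\coprod(X\boxtimes Z)\to X\boxtimes(Y\coprod Z)$ (with $\times$ for $\boxtimes$ in a $B^+$-category) is always invertible. *Notions in a $P$-category.* It is *prodominical* if there are morphisms $0_{X,Y}:X\to Y$ with $g\,0_{X,Y}f=0_{W,Z}$ for all $f:W\to X$, $g:Y\to Z$, and $\varphi\boxtimes 0=0$ for all $\varphi$. The *domain* of $\varphi:X\to Y$ is $\mathrm{dom}\,\varphi=p_0\langle1_X,\varphi\rangle:X\to X$; $\mathrm{dom}(X)$ is the set of domains of morphisms out of $X$; $\varphi$ is *total* if $\mathrm{dom}\,\varphi=1_X$. The total morphisms form a subcategory $\mathbf C_T$;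 if $\mathbf C$ is a prodominical $P^+$-category, its structure restricts to a $B^+$-category structure on $\mathbf C_T$. A *range* of $\varphi:X\to Y$ is an $\varepsilon\in\mathrm{dom}(Y)$ with $\varepsilon\varphi=\varphi$ such that $\psi\varphi=\psi'\varphi$ implies $\psi\varepsilon=\psi'\varepsilon$; it is unique if it exists. The category *has ranges* if every morphism has one. A *section* of $\varphi:X\to Y$ is $\sigma:Y\to X$ with $\varphi\sigma=\mathrm{dom}\,\sigma$ and $\varphi\sigma\varphi=\varphi$; $\varphi$ is a *partial monomorphism* if $\varphi\theta=\varphi\theta'$ implies $(\mathrm{dom}\,\varphi)\theta=(\mathrm{dom}\,\varphi)\theta'$; the *weak axiom of choice* says that every partial monomorphism has a section. A *union* of $\varepsilon_n\in\mathrm{dom}(X)$, $n\ge1$, is a $\delta\in\mathrm{dom}(X)$ with $\delta\varepsilon_n=\varepsilon_n$ for all $n$ such that, if $\varphi\varepsilon_n=\varphi'\varepsilon_n$ for all $n$, then $\varphi\delta=\varphi'\delta$; it is *stable* if $1_Y\boxtimes\delta$ is a union of $\{1_Y\boxtimes\varepsilon_n\}$ for every $Y$. *$B^\#$-category.* A $B^+$-category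 with a functor $\#$ and natural transformations $m:X^\#\times X^\#\to X^\#$, $j:X\to X^\#$, $e:X^{\#\#}\to X^\#$, $l:X^\#\to X\coprod(X\times X^\#)$, $r:X^\#\to(X^\#\times X)\coprod X$, $\mathrm{par}:X\times Y^\#\to(X\times Y)^\#$ and $$\mathrm{wd}:(X\amalg Y)^\#\to X^\#\amalg Y^\#\amalg(X^\#\times Y^\#)^\#\amalg(Y^\#\times X^\#)^\#\amalg(Y^\#\times(X^\#\times Y^\#)^\#)\amalg(X^\#\times(Y^\#\times X^\#)^\#)$$ such that, with $f\cdot g=m(f\times g)$: $m$ is associative; $(\#,j,e)$ is a monad and each component of $e$ is a semigroup homomorphism; $l$ and $r$ are inverse to $[j,j\cdot 1_{X^\#}]$ and $[1_{X^\#}\cdot j,j]$; $p_1^\#\,\mathrm{par}=p_1$; and $\mathrm{wd}$ is inverse to $[i_0^\#,\,i_1^\#,\,e(i_0^\#\cdot i_1^\#)^\#,\,e(i_1^\#\cdot i_0^\#)^\#,\,i_1^\#\cdot e(i_0^\#\cdot i_1^\#)^\#,\,i_0^\#\cdot e(i_1^\#\cdot i_0^\#)^\#]$. Put $X^1=X$,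 $X^{n+1}=X\times X^n$, $j_1=j$, $j_{n+1}=j\cdot j_n:X^{n+1}\to X^\#$. *Iteration category.* A prodominical $P^+$-category $\mathbf C$ with ranges that satisfies the weak axiom of choice, together with an extension of the $B^+$-structure of $\mathbf C_T$ to a $B^\#$-category structure such that for each object $X$ the identity of $X^\#$ is, in $\mathbf C$, the stable union of the ranges of the $j_n$, $n\ge1$. -/

import Mathlib

open CategoryTheory CategoryTheory.Limits

universe v v' u u'

noncomputable section

/-! ### Categories of partial maps -/

namespace IterCat

/-- A dominion: a class of monomorphisms containing the identities, closed under composition, and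
closed under pullback along arbitrary morphisms (these pullbacks being required to exist). -/
class IsDominion {C : Type u} [Category.{v} C] (M : MorphismProperty C) : Prop
    extends M.IsMultiplicative, M.IsStableUnderBaseChange, M.HasPullbacks where
  mono : ∀ {X Y : C} (f : X ⟶ Y), M f → Mono f

/-- A partial map from `X` to `Y` defined in `M`: a pair `(m, φ)` with `m : U ⟶ X` in `M` and
`φ : U ⟶ Y`. -/
structure PartialMap {C : Type u} [Category.{v} C] (M : MorphismProperty C) (X Y : C) where
  dom : C
  incl : dom ⟶ X
  incl_mem : M incl
  map : dom ⟶ Y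

namespace PartialMap

variable {C : Type u} [Category.{v} C] {M : MorphismProperty C}

/-- `(m, φ)` and `(m', φ')` are equivalent if there is an isomorphism `θ` with `m' θ = m` and
`φ' θ = φ`. -/
def Equivalent {X Y : C} (f g : PartialMap M X Y) : Prop :=
  ∃ θ : f.dom ≅ g.dom, θ.hom ≫ g.incl = f.incl ∧ θ.hom ≫ g.map = f.map

instance setoid (M : MorphismProperty C) (X Y : C) : Setoid (PartialMap M X Y) where
  r := Equivalent
  iseqv :=
    { refl := fun f => ⟨Iso.refl _, by simp, by simp⟩
      symm := by
        rintro f g ⟨θ, h₁, h₂⟩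
        exact ⟨θ.symm, by simp [← h₁], by simp [← h₂]⟩
      trans := by
        rintro f g h ⟨θ, h₁, h₂⟩ ⟨η, k₁, k₂⟩
        exact ⟨θ ≪≫ η, by simp [k₁, h₁], by simp [k₂, h₂]⟩ }

end PartialMap

/-- The category `P(C, M)` of partial maps: its objects are those of `C`. -/
structure PartialMaps {C : Type u} [Category.{v} C] (M : MorphismProperty C) where
  of ::
  obj : C

namespace PartialMaps

variable {C : Type u} [Category.{v} C] {M : MorphismProperty C}

/-- Partial morphisms `{m, φ}`: equivalence classes of partial maps. -/
def Hom (X Y : PartialMaps M) : Type (max u v) := _root_.Quotient (PartialMap.setoid M X.obj Y.obj)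

/-- The equivalence class `{m, φ}`. -/
def Hom.mk {X Y : PartialMaps M} {U : C} (m : U ⟶ X.obj) (hm : M m) (φ : U ⟶ Y.obj) : Hom X Y :=
  _root_.Quotient.mk _ ⟨U, m, hm, φ⟩

lemma Hom.mk_eq_mk {X Y : PartialMaps M} {U V : C} {m : U ⟶ X.obj} {hm : M m} {φ : U ⟶ Y.obj}
    {n : V ⟶ X.obj} {hn : M n} {ψ : V ⟶ Y.obj} (θ : U ≅ V) (h₁ : θ.hom ≫ n = m)
    (h₂ : θ.hom ≫ ψ = φ) : Hom.mk m hm φ = Hom.mk n hn ψ :=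
  _root_.Quotient.sound ⟨θ, h₁, h₂⟩

lemma Hom.exists_rep {X Y : PartialMaps M} (f : Hom X Y) :
    ∃ (U : C) (m : U ⟶ X.obj) (hm : M m) (φ : U ⟶ Y.obj), f = Hom.mk m hm φ := by
  induction f using _root_.Quotient.ind with
  | _ f => exact ⟨f.dom, f.incl, f.incl_mem, f.map, rfl⟩

variable [IsDominion M]

/-- The composite of `{m, φ} : X ⇀ Y` and `{n, ψ} : Y ⇀ Z` is represented by a pullback `W` of
`n` along `φ`, with the evident morphisms `W ⟶ X` and `W ⟶ Z`. -/
def compRep {X Y Z : C} (f : PartialMap M X Y) (g : PartialMap M Y Z) : PartialMap M X Z :=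
  haveI := M.hasPullback f.map g.incl_mem
  { dom := pullback g.incl f.map
    incl := pullback.snd g.incl f.map ≫ f.incl
    incl_mem := M.comp_mem _ _
      (M.of_isPullback (IsPullback.of_hasPullback g.incl f.map) g.incl_mem) f.incl_mem
    map := pullback.fst g.incl f.map ≫ g.map }

lemma compRep_equivalent {X Y Z : C} (f : PartialMap M X Y) (g : PartialMap M Y Z)
    {W : C} {a : W ⟶ g.dom} {b : W ⟶ f.dom} (sq : IsPullback a b g.incl f.map)
    (h : PartialMap M X Z) (e : W ≅ h.dom) (h₁ : e.hom ≫ h.incl = b ≫ f.incl)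
    (h₂ : e.hom ≫ h.map = a ≫ g.map) :
    (compRep f g).Equivalent h := by
  have := M.hasPullback f.map g.incl_mem
  refine ⟨sq.isoPullback.symm ≪≫ e, ?_, ?_⟩
  · simp [h₁, compRep]
  · simp [h₂, compRep]

/-- Composition of partial morphisms. -/
def Hom.comp {X Y Z : PartialMaps M} (f : Hom X Y) (g : Hom Y Z) : Hom X Z :=
  _root_.Quotient.map₂ compRep (by
    rintro f f' ⟨θ, h₁, h₂⟩ g g' ⟨η, k₁, k₂⟩
    have := M.hasPullback f'.map g'.incl_mem
    have sq := IsPullback.of_hasPullback g'.incl f'.map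
    refine compRep_equivalent f g (W := pullback g'.incl f'.map)
      (a := pullback.fst g'.incl f'.map ≫ η.inv) (b := pullback.snd g'.incl f'.map ≫ θ.inv)
      (sq.of_iso (Iso.refl _) η.symm θ.symm (Iso.refl _) (by simp) (by simp)
        (by simp [← k₁]) (by simp [← h₂])) _ (Iso.refl _) ?_ ?_
    · simp [compRep, ← h₁]
    · simp [compRep, ← k₂]) f g

/-- Any pullback of `n` along `φ` computes the composite of `{m, φ}` and `{n, ψ}`. -/
lemma Hom.mk_comp_mk {X Y Z : PartialMaps M} {U V W : C} (m : U ⟶ X.obj) (hm : M m)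
    (φ : U ⟶ Y.obj) (n : V ⟶ Y.obj) (hn : M n) (ψ : V ⟶ Z.obj) {a : W ⟶ V} {b : W ⟶ U}
    (sq : IsPullback a b n φ) :
    (Hom.mk m hm φ).comp (Hom.mk n hn ψ) =
      Hom.mk (b ≫ m) (M.comp_mem _ _ (M.of_isPullback sq hn) hm) (a ≫ ψ) :=
  _root_.Quotient.sound (compRep_equivalent ⟨U, m, hm, φ⟩ ⟨V, n, hn, ψ⟩ sq ⟨W, b ≫ m, _, a ≫ ψ⟩
    (Iso.refl _) (by simp) (by simp))

instance category (M : MorphismProperty C) [IsDominion M] : Category (PartialMaps M) where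
  Hom := Hom
  id X := Hom.mk (𝟙 X.obj) (M.id_mem _) (𝟙 X.obj)
  comp := Hom.comp
  id_comp f := by
    obtain ⟨U, m, hm, φ, rfl⟩ := f.exists_rep
    rw [Hom.mk_comp_mk _ _ _ _ _ _ (IsPullback.of_horiz_isIso (fst := 𝟙 U) (snd := m) ⟨by simp⟩)]
    exact Hom.mk_eq_mk (Iso.refl _) (by simp) (by simp)
  comp_id f := by
    obtain ⟨U, m, hm, φ, rfl⟩ := f.exists_rep
    rw [Hom.mk_comp_mk _ _ _ _ _ _ (IsPullback.of_vert_isIso (fst := φ) (snd := 𝟙 U) ⟨by simp⟩)]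
    exact Hom.mk_eq_mk (Iso.refl _) (by simp) (by simp)
  assoc f g h := by
    obtain ⟨U, m, hm, φ, rfl⟩ := f.exists_rep
    obtain ⟨V, n, hn, ψ, rfl⟩ := g.exists_rep
    obtain ⟨W, k, hk, χ, rfl⟩ := h.exists_rep
    have := M.hasPullback φ hn
    have := M.hasPullback ψ hk
    have s₁ := IsPullback.of_hasPullback n φ
    have s₂ := IsPullback.of_hasPullback k ψ
    have := M.hasPullback (pullback.fst n φ) (M.of_isPullback s₂ hk)
    have s₃ := IsPullback.of_hasPullback (pullback.snd k ψ) (pullback.fst n φ)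
    have t₁ := s₃.paste_horiz s₂
    rw [Hom.mk_comp_mk m hm φ n hn ψ s₁, Hom.mk_comp_mk n hn ψ k hk χ s₂,
      Hom.mk_comp_mk _ _ _ k hk χ (s₃.flip.paste_vert s₂.flip).flip,
      Hom.mk_comp_mk m hm φ _ _ _ (s₃.paste_vert s₁)]
    exact Hom.mk_eq_mk (Iso.refl _) (by simp) (by simp)

/-- The embedding of `C` into `P(C, M)`, which sends `φ : A ⟶ B` to `{1_A, φ}`. -/
def embedding (M : MorphismProperty C) [IsDominion M] : C ⥤ PartialMaps M where
  obj X := of X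
  map {X _} φ := Hom.mk (𝟙 X) (M.id_mem _) φ
  map_id _ := rfl
  map_comp {X Y Z} f g := by
    refine Eq.trans ?_ (Hom.mk_comp_mk (X := of X) (Y := of Y) (Z := of Z) _ _ _ _ _ _
      (IsPullback.of_vert_isIso (fst := f) (snd := 𝟙 X) ⟨by simp⟩)).symm
    exact Hom.mk_eq_mk (Iso.refl _) (by simp) (by simp)

end PartialMaps

/-! ### Coalgebras and their partial morphisms -/

/-- The category `Set_F` of `F`-coalgebras. -/
abbrev SetF (F : Type u ⥤ Type u) : Type (u + 1) := Endofunctor.Coalgebra F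

/-- A weak pullback square: a commutative square with the existence part of the universal property
of a pullback. -/
def IsWeakPullback {C : Type u} [Category.{v} C] {P X Y Z : C} (fst : P ⟶ X) (snd : P ⟶ Y)
    (f : X ⟶ Z) (g : Y ⟶ Z) : Prop :=
  fst ≫ f = snd ≫ g ∧ ∀ (W : C) (h : W ⟶ X) (k : W ⟶ Y), h ≫ f = k ≫ g →
    ∃ l : W ⟶ P, l ≫ fst = h ∧ l ≫ snd = k

/-- A set endofunctor weakly preserves pullbacks if it sends pullbacks to weak pullbacks. -/
class WeaklyPreservesPullbacks (F : Type u ⥤ Type u) : Prop where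
  isWeakPullback : ∀ {P X Y Z : Type u} {fst : P ⟶ X} {snd : P ⟶ Y} {f : X ⟶ Z} {g : Y ⟶ Z},
    IsPullback fst snd f g → IsWeakPullback (F.map fst) (F.map snd) (F.map f) (F.map g)

/-- A set endofunctor is nontrivial if `F X = ∅` implies `X = ∅`. -/
def IsNontrivialEndofunctor (F : Type u ⥤ Type u) : Prop :=
  ∀ X : Type u, IsEmpty (F.obj X) → IsEmpty X

/-- A set endofunctor is bounded by `κ` if every element of every `F`-coalgebra `A` lies in a
subcoalgebra of `A` of cardinality at most `κ`. -/
def IsBoundedBy (F : Type u ⥤ Type u) (κ : Cardinal.{u}) : Prop :=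
  ∀ (A : SetF F) (a : A.V), ∃ (B : SetF F) (i : B ⟶ A),
    Function.Injective i.f ∧ a ∈ Set.range i.f ∧ Cardinal.mk B.V ≤ κ

/-- A set endofunctor is bounded if it is bounded by some cardinal. -/
def IsBoundedEndofunctor (F : Type u ⥤ Type u) : Prop :=
  ∃ κ : Cardinal.{u}, IsBoundedBy F κ

section PartialMorphisms

open Endofunctor

variable {F : Type u ⥤ Type u} [WeaklyPreservesPullbacks F]

lemma WeaklyPreservesPullbacks.map_mono {X Y : Type u} (m : X ⟶ Y) [Mono m] : Mono (F.map m) := by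
  refine ⟨fun {W} h k hk => ?_⟩
  obtain ⟨l, h₁, h₂⟩ := (WeaklyPreservesPullbacks.isWeakPullback (F := F)
    (IsPullback.of_isLimit (PullbackCone.isLimitMkIdId m))).2 W h k hk
  simp only [PullbackCone.mk_fst, PullbackCone.mk_snd] at h₁ h₂
  rw [← h₁, ← h₂]

lemma SetF.mono_f {A B : SetF F} (f : A ⟶ B) [Mono f] : Mono f.f := by
  have sq := IsPullback.of_hasPullback f.f f.f
  obtain ⟨κ, h₁, h₂⟩ := (WeaklyPreservesPullbacks.isWeakPullback (F := F) sq).2 _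
    (pullback.fst f.f f.f ≫ A.str) (pullback.snd f.f f.f ≫ A.str) (by
      simp only [Category.assoc, Coalgebra.Hom.h]
      rw [← Category.assoc, pullback.condition, Category.assoc])
  let K : SetF F := ⟨_, κ⟩
  let p : K ⟶ A := ⟨pullback.fst f.f f.f, h₁⟩
  let q : K ⟶ A := ⟨pullback.snd f.f f.f, h₂⟩
  have hpq : p = q := by
    rw [← cancel_mono f]
    exact Coalgebra.ext pullback.condition
  have hpq' : pullback.fst f.f f.f = pullback.snd f.f f.f := congrArg Coalgebra.Hom.f hpq
  refine ⟨fun h k hk => ?_⟩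
  rw [← pullback.lift_fst h k hk, hpq', pullback.lift_snd]

lemma SetF.hasPullback_of_mono {A B D : SetF F} (f : A ⟶ D) (g : B ⟶ D) [Mono f] :
    HasPullback f g := by
  have := SetF.mono_f f
  have sq := IsPullback.of_hasPullback f.f g.f
  obtain ⟨κ, h₁, h₂⟩ := (WeaklyPreservesPullbacks.isWeakPullback (F := F) sq).2 _
    (pullback.fst f.f g.f ≫ A.str) (pullback.snd f.f g.f ≫ B.str) (by
      simp only [Category.assoc, Coalgebra.Hom.h]
      rw [← Category.assoc, pullback.condition, Category.assoc])
  let K : SetF F := ⟨_, κ⟩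
  let p : K ⟶ A := ⟨pullback.fst f.f g.f, h₁⟩
  let q : K ⟶ B := ⟨pullback.snd f.f g.f, h₂⟩
  have : Mono (F.map (pullback.snd f.f g.f)) := WeaklyPreservesPullbacks.map_mono _
  have w : p ≫ f = q ≫ g := Coalgebra.ext pullback.condition
  have hs (s : PullbackCone f g) : s.fst.f ≫ f.f = s.snd.f ≫ g.f :=
    congrArg Coalgebra.Hom.f s.condition
  refine HasLimit.mk ⟨PullbackCone.mk p q w, PullbackCone.IsLimit.mk w
    (fun s => ⟨pullback.lift s.fst.f s.snd.f (hs s), ?_⟩)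
    (fun s => Coalgebra.ext (pullback.lift_fst _ _ _))
    (fun s => Coalgebra.ext (pullback.lift_snd _ _ _))
    (fun s m hm₁ hm₂ => Coalgebra.ext (pullback.hom_ext ?_ ?_))⟩
  · rw [← cancel_mono (F.map (pullback.snd f.f g.f))]
    change _ = (_ ≫ κ) ≫ _
    rw [Category.assoc, Category.assoc, ← F.map_comp, h₂, ← Category.assoc, pullback.lift_snd,
      Coalgebra.Hom.h]
  · exact (congrArg Coalgebra.Hom.f hm₁).trans (pullback.lift_fst _ _ _).symm
  · exact (congrArg Coalgebra.Hom.f hm₂).trans (pullback.lift_snd _ _ _).symm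

variable (F)

/-- The monomorphisms of `Set_F` form a dominion. -/
instance SetF.isDominion_monomorphisms :
    IsDominion (MorphismProperty.monomorphisms (SetF F)) where
  hasPullback {_ _ _ f} g hf := by
    have : Mono f := hf
    exact SetF.hasPullback_of_mono f g
  mono _ hf := hf

/-- The category `Pfn_F = P(Set_F, Mono)` of `F`-coalgebras and partial morphisms. -/
abbrev Pfn : Type (u + 1) := PartialMaps (MorphismProperty.monomorphisms (SetF F))

end PartialMorphisms


/-! ### Near products, `P`-categories and `B`-categories -/

/-- An infranatural transformation `F ⟶ G`: a family of components, without naturality. -/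
abbrev InfraNatTrans {C : Type u} [Category.{v} C] {D : Type u'} [Category.{v'} D] (F G : C ⥤ D) :=
  ∀ X : C, F.obj X ⟶ G.obj X

/-- The naturalizer of an infranatural transformation `φ`: the morphisms at which `φ` is natural.
They form a subcategory, the largest one on which `φ` is natural. -/
def naturalizer {C : Type u} [Category.{v} C] {D : Type u'} [Category.{v'} D] {F G : C ⥤ D}
    (φ : InfraNatTrans F G) : MorphismProperty C :=
  fun X Y f => F.map f ≫ φ Y = φ X ≫ G.map f

/-- The data of a near product: a functor `⊠ : C × C ⥤ C`, a natural transformation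
`Δ : 1 ⟶ ⊠ ∘ δ_C`, and infranatural transformations `p₀, p₁` from `⊠` to the projections. -/
structure BoxData (C : Type u) [Category.{v} C] where
  box : C × C ⥤ C
  diag : 𝟭 C ⟶ Functor.diag C ⋙ box
  proj₀ : InfraNatTrans box (CategoryTheory.Prod.fst C C)
  proj₁ : InfraNatTrans box (CategoryTheory.Prod.snd C C)

namespace BoxData

variable {C : Type u} [Category.{v} C] (P : BoxData C)

/-- `X ⊠ Y` -/
abbrev ob (X Y : C) : C := P.box.obj (X, Y)

/-- `f ⊠ g` -/
abbrev mp {X X' Y Y' : C} (f : X ⟶ X') (g : Y ⟶ Y') : P.ob X Y ⟶ P.ob X' Y' :=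
  P.box.map ((f, g) : (X, Y) ⟶ (X', Y'))

/-- `Δ_X : X ⟶ X ⊠ X` -/
abbrev Δ (X : C) : X ⟶ P.ob X X := P.diag.app X

/-- `p₀ : X ⊠ Y ⟶ X` -/
abbrev p₀ (X Y : C) : P.ob X Y ⟶ X := P.proj₀ (X, Y)

/-- `p₁ : X ⊠ Y ⟶ Y` -/
abbrev p₁ (X Y : C) : P.ob X Y ⟶ Y := P.proj₁ (X, Y)

/-- `⟨f, g⟩ = (f ⊠ g) Δ_X` -/
def lift {X Y Z : C} (f : X ⟶ Y) (g : X ⟶ Z) : X ⟶ P.ob Y Z := P.Δ X ≫ P.mp f g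

/-- The associator `⟨p₀ p₀, ⟨p₁ p₀, p₁⟩⟩ : (X ⊠ Y) ⊠ Z ⟶ X ⊠ (Y ⊠ Z)`. -/
def ass (X Y Z : C) : P.ob (P.ob X Y) Z ⟶ P.ob X (P.ob Y Z) :=
  P.lift (P.p₀ (P.ob X Y) Z ≫ P.p₀ X Y)
    (P.lift (P.p₀ (P.ob X Y) Z ≫ P.p₁ X Y) (P.p₁ (P.ob X Y) Z))

/-- The symmetry `⟨p₁, p₀⟩ : X ⊠ Y ⟶ Y ⊠ X`. -/
def tr (X Y : C) : P.ob X Y ⟶ P.ob Y X := P.lift (P.p₁ X Y) (P.p₀ X Y)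

/-- The conditions on the data common to `P`- and `B`-categories: the identities relating `Δ` and
the projections, and the existence of coherent natural isomorphisms `ass` and `tr`. -/
structure IsCoherent : Prop where
  diag_p₀ (X : C) : P.Δ X ≫ P.p₀ X X = 𝟙 X
  diag_p₁ (X : C) : P.Δ X ≫ P.p₁ X X = 𝟙 X
  diag_mp (X Y : C) : P.Δ (P.ob X Y) ≫ P.mp (P.p₀ X Y) (P.p₁ X Y) = 𝟙 (P.ob X Y)
  ass_natural {X X' Y Y' Z Z' : C} (f : X ⟶ X') (g : Y ⟶ Y') (h : Z ⟶ Z') :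
    P.mp (P.mp f g) h ≫ P.ass X' Y' Z' = P.ass X Y Z ≫ P.mp f (P.mp g h)
  ass_isIso (X Y Z : C) : IsIso (P.ass X Y Z)
  tr_natural {X X' Y Y' : C} (f : X ⟶ X') (g : Y ⟶ Y') :
    P.mp f g ≫ P.tr X' Y' = P.tr X Y ≫ P.mp g f
  tr_tr (X Y : C) : P.tr X Y ≫ P.tr Y X = 𝟙 (P.ob X Y)
  pentagon (W X Y Z : C) :
    P.ass (P.ob W X) Y Z ≫ P.ass W X (P.ob Y Z) =
      P.mp (P.ass W X Y) (𝟙 Z) ≫ P.ass W (P.ob X Y) Z ≫ P.mp (𝟙 W) (P.ass X Y Z)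
  hexagon (X Y Z : C) :
    P.ass X Y Z ≫ P.tr X (P.ob Y Z) ≫ P.ass Y Z X =
      P.mp (P.tr X Y) (𝟙 Z) ≫ P.ass Y X Z ≫ P.mp (𝟙 Y) (P.tr X Z)

/-- The smallest subcategory that is closed under `⊠` and contains all components of `p₀, p₁`. -/
inductive projections : MorphismProperty C
  | id (X : C) : projections (𝟙 X)
  | p₀ (X Y : C) : projections (P.p₀ X Y)
  | p₁ (X Y : C) : projections (P.p₁ X Y)
  | comp {X Y Z : C} (f : X ⟶ Y) (g : Y ⟶ Z) : projections f → projections g →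
      projections (f ≫ g)
  | box {X X' Y Y' : C} (f : X ⟶ X') (g : Y ⟶ Y') : projections f → projections g →
      projections (P.mp f g)

end BoxData

/-- A `P`-category structure on `C`. -/
structure PCategory (C : Type u) [Category.{v} C] extends BoxData C where
  isCoherent : toBoxData.IsCoherent
  naturalizer_proj₀ {X X' Y Y' : C} (f : X ⟶ X') (g : Y ⟶ Y') : toBoxData.projections g →
    naturalizer toBoxData.proj₀ ((f, g) : (X, Y) ⟶ (X', Y'))
  naturalizer_proj₁ {X X' Y Y' : C} (f : X ⟶ X') (g : Y ⟶ Y') : toBoxData.projections f →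
    naturalizer toBoxData.proj₁ ((f, g) : (X, Y) ⟶ (X', Y'))

/-- A `B`-category structure on `C`: here the projections are natural. -/
structure BCategory (C : Type u) [Category.{v} C] extends BoxData C where
  isCoherent : toBoxData.IsCoherent
  p₀_natural {X X' Y Y' : C} (f : X ⟶ X') (g : Y ⟶ Y') :
    toBoxData.mp f g ≫ toBoxData.p₀ X' Y' = toBoxData.p₀ X Y ≫ f
  p₁_natural {X X' Y Y' : C} (f : X ⟶ X') (g : Y ⟶ Y') :
    toBoxData.mp f g ≫ toBoxData.p₁ X' Y' = toBoxData.p₁ X Y ≫ g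

/-! ### Binary coproducts -/

/-- The data of a binary coproduct: a functor `∐ : C × C ⥤ C` with natural injections `i₀, i₁` and
a natural codiagonal `∇`. -/
structure CoprodData (C : Type u) [Category.{v} C] where
  cop : C × C ⥤ C
  codiag : Functor.diag C ⋙ cop ⟶ 𝟭 C
  inj₀ : CategoryTheory.Prod.fst C C ⟶ cop
  inj₁ : CategoryTheory.Prod.snd C C ⟶ cop

namespace CoprodData

variable {C : Type u} [Category.{v} C] (S : CoprodData C)

/-- `X ∐ Y` -/
abbrev cob (X Y : C) : C := S.cop.obj (X, Y)

/-- `f ∐ g` -/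
abbrev cmp {X X' Y Y' : C} (f : X ⟶ X') (g : Y ⟶ Y') : S.cob X Y ⟶ S.cob X' Y' :=
  S.cop.map ((f, g) : (X, Y) ⟶ (X', Y'))

/-- `∇_X : X ∐ X ⟶ X` -/
abbrev nabla (X : C) : S.cob X X ⟶ X := S.codiag.app X

/-- `i₀ : X ⟶ X ∐ Y` -/
abbrev i₀ (X Y : C) : X ⟶ S.cob X Y := S.inj₀.app (X, Y)

/-- `i₁ : Y ⟶ X ∐ Y` -/
abbrev i₁ (X Y : C) : Y ⟶ S.cob X Y := S.inj₁.app (X, Y)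

/-- `[f, g] = ∇_Z (f ∐ g)` -/
def desc {X Y Z : C} (f : X ⟶ Z) (g : Y ⟶ Z) : S.cob X Y ⟶ Z := S.cmp f g ≫ S.nabla Z

/-- The associator `[i₀ i₀, [i₀ i₁, i₁]] : X ∐ (Y ∐ Z) ⟶ (X ∐ Y) ∐ Z`. -/
def cass (X Y Z : C) : S.cob X (S.cob Y Z) ⟶ S.cob (S.cob X Y) Z :=
  S.desc (S.i₀ X Y ≫ S.i₀ (S.cob X Y) Z)
    (S.desc (S.i₁ X Y ≫ S.i₀ (S.cob X Y) Z) (S.i₁ (S.cob X Y) Z))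

/-- The symmetry `[i₁, i₀] : X ∐ Y ⟶ Y ∐ X`. -/
def ctr (X Y : C) : S.cob X Y ⟶ S.cob Y X := S.desc (S.i₁ Y X) (S.i₀ Y X)

/-- The duals of the conditions on the product of a `B`-category. -/
structure IsCoherent : Prop where
  i₀_nabla (X : C) : S.i₀ X X ≫ S.nabla X = 𝟙 X
  i₁_nabla (X : C) : S.i₁ X X ≫ S.nabla X = 𝟙 X
  cmp_nabla (X Y : C) : S.cmp (S.i₀ X Y) (S.i₁ X Y) ≫ S.nabla (S.cob X Y) = 𝟙 (S.cob X Y)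
  cass_natural {X X' Y Y' Z Z' : C} (f : X ⟶ X') (g : Y ⟶ Y') (h : Z ⟶ Z') :
    S.cmp f (S.cmp g h) ≫ S.cass X' Y' Z' = S.cass X Y Z ≫ S.cmp (S.cmp f g) h
  cass_isIso (X Y Z : C) : IsIso (S.cass X Y Z)
  ctr_natural {X X' Y Y' : C} (f : X ⟶ X') (g : Y ⟶ Y') :
    S.cmp f g ≫ S.ctr X' Y' = S.ctr X Y ≫ S.cmp g f
  ctr_ctr (X Y : C) : S.ctr X Y ≫ S.ctr Y X = 𝟙 (S.cob X Y)
  pentagon (W X Y Z : C) :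
    S.cass W X (S.cob Y Z) ≫ S.cass (S.cob W X) Y Z =
      S.cmp (𝟙 W) (S.cass X Y Z) ≫ S.cass W (S.cob X Y) Z ≫ S.cmp (S.cass W X Y) (𝟙 Z)
  hexagon (X Y Z : C) :
    S.cass Y Z X ≫ S.ctr (S.cob Y Z) X ≫ S.cass X Y Z =
      S.cmp (𝟙 Y) (S.ctr Z X) ≫ S.cass Y X Z ≫ S.cmp (S.ctr Y X) (𝟙 Z)

end CoprodData

/-- The canonical morphism `[X ⊠ i₀, X ⊠ i₁] : (X ⊠ Y) ∐ (X ⊠ Z) ⟶ X ⊠ (Y ∐ Z)`. -/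
def undist {C : Type u} [Category.{v} C] (P : BoxData C) (S : CoprodData C) (X Y Z : C) :
    S.cob (P.ob X Y) (P.ob X Z) ⟶ P.ob X (S.cob Y Z) :=
  S.desc (P.mp (𝟙 X) (S.i₀ Y Z)) (P.mp (𝟙 X) (S.i₁ Y Z))

/-- A `P⁺`-category structure: a `P`-category with a binary coproduct over which `⊠` distributes,
i.e. the natural transformation `undist` has an inverse `dist`. -/
structure PPlusCategory (C : Type u) [Category.{v} C] extends PCategory C, CoprodData C where
  isCoherentCoprod : toCoprodData.IsCoherent
  dist_isIso (X Y Z : C) : IsIso (undist toBoxData toCoprodData X Y Z)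

/-- A `B⁺`-category structure: a `B`-category with a binary coproduct over which `×` distributes,
i.e. the natural transformation `undist` has an inverse `dist`. -/
structure BPlusCategory (C : Type u) [Category.{v} C] extends BCategory C, CoprodData C where
  isCoherentCoprod : toCoprodData.IsCoherent
  dist_isIso (X Y Z : C) : IsIso (undist toBoxData toCoprodData X Y Z)

/-! ### Domains, total morphisms, ranges -/

namespace PCategory

variable {C : Type u} [Category.{v} C] (P : PCategory C)

/-- `dom φ = p₀ ⟨1_X, φ⟩ : X ⟶ X` -/
def dom {X Y : C} (φ : X ⟶ Y) : X ⟶ X := P.lift (𝟙 X) φ ≫ P.p₀ X Y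

/-- `dom(X)`: the set of domains of morphisms out of `X`. -/
def Dom (X : C) : Set (X ⟶ X) := {ε | ∃ (Y : C) (φ : X ⟶ Y), ε = P.dom φ}

/-- A morphism `φ : X ⟶ Y` is total if `dom φ = 1_X`. -/
def total : MorphismProperty C := fun X _ φ => P.dom φ = 𝟙 X

/-- `ε` is the range of `φ : X ⟶ Y`: it is a domain in `dom(Y)` which receives `φ`, and
`ψ φ = ψ' φ` implies `ψ ε = ψ' ε`. -/
def IsRange {X Y : C} (φ : X ⟶ Y) (ε : Y ⟶ Y) : Prop :=
  ε ∈ P.Dom Y ∧ φ ≫ ε = φ ∧ ∀ ⦃Z : C⦄ (ψ ψ' : Y ⟶ Z), φ ≫ ψ = φ ≫ ψ' → ε ≫ ψ = ε ≫ ψ'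

/-- A `P`-category has ranges if every morphism has a range. -/
def HasRanges : Prop := ∀ ⦃X Y : C⦄ (φ : X ⟶ Y), ∃ ε, P.IsRange φ ε

/-- `δ` is a union of the countable family `ε` of domains in `dom(X)`. -/
def IsUnion {X : C} (ε : ℕ → (X ⟶ X)) (δ : X ⟶ X) : Prop :=
  δ ∈ P.Dom X ∧ (∀ n, ε n ∈ P.Dom X) ∧ (∀ n, ε n ≫ δ = ε n) ∧
    ∀ ⦃Z : C⦄ (φ φ' : X ⟶ Z), (∀ n, ε n ≫ φ = ε n ≫ φ') → δ ≫ φ = δ ≫ φ'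

/-- `δ` is a stable union of `ε`: moreover `Y ⊠ δ` is the union of the `Y ⊠ εₙ` for every `Y`. -/
def IsStableUnion {X : C} (ε : ℕ → (X ⟶ X)) (δ : X ⟶ X) : Prop :=
  P.IsUnion ε δ ∧ ∀ Y : C, P.IsUnion (fun n => P.mp (𝟙 Y) (ε n)) (P.mp (𝟙 Y) δ)

/-- A section of `φ : X ⟶ Y` is a morphism `σ : Y ⟶ X` with `φ σ = dom σ` and `φ σ φ = φ`. -/
def IsSection {X Y : C} (φ : X ⟶ Y) (σ : Y ⟶ X) : Prop :=
  σ ≫ φ = P.dom σ ∧ φ ≫ σ ≫ φ = φ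

/-- `φ` is a partial monomorphism if `φ θ = φ θ'` implies `(dom φ) θ = (dom φ) θ'`. -/
def IsPartialMono {X Y : C} (φ : X ⟶ Y) : Prop :=
  ∀ ⦃W : C⦄ (θ θ' : W ⟶ X), θ ≫ φ = θ' ≫ φ → θ ≫ P.dom φ = θ' ≫ P.dom φ

/-- The weak axiom of choice: every partial monomorphism has a section. -/
def WeakChoice : Prop := ∀ ⦃X Y : C⦄ (φ : X ⟶ Y), P.IsPartialMono φ → ∃ σ, P.IsSection φ σ

/-- A `P`-category is prodominical if it is pointed: it has a system of zero morphisms `0_{X,Y}`,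
and `φ ⊠ 0 = 0` for every morphism `φ`. -/
def IsProdominical : Prop :=
  ∃ zero : ∀ X Y : C, X ⟶ Y,
    (∀ {W X Y Z : C} (f : W ⟶ X) (g : Y ⟶ Z), f ≫ zero X Y ≫ g = zero W Z) ∧
    ∀ {A B : C} (φ : A ⟶ B) (D E : C), P.mp φ (zero D E) = zero (P.ob A D) (P.ob B E)

end PCategory

/-! ### The subcategory of total morphisms

The total morphisms form a subcategory `C_T`. The structure of a prodominical `P⁺`-category `C`
restricts to `C_T`, on which it is a `B⁺`-category structure. -/

namespace BoxData

variable {C : Type u} [Category.{v} C] (P : BoxData C)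

lemma mp_comp {X X' X'' Y Y' Y'' : C} (f : X ⟶ X') (f' : X' ⟶ X'') (g : Y ⟶ Y') (g' : Y' ⟶ Y'') :
    P.mp (f ≫ f') (g ≫ g') = P.mp f g ≫ P.mp f' g' :=
  P.box.map_comp ((f, g) : (X, Y) ⟶ (X', Y')) ((f', g') : (X', Y') ⟶ (X'', Y''))

lemma mp_id (X Y : C) : P.mp (𝟙 X) (𝟙 Y) = 𝟙 (P.ob X Y) := P.box.map_id (X, Y)

lemma Δ_natural {X Y : C} (f : X ⟶ Y) : f ≫ P.Δ Y = P.Δ X ≫ P.mp f f := P.diag.naturality f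

end BoxData

namespace CoprodData

variable {C : Type u} [Category.{v} C] (S : CoprodData C)

lemma cmp_comp {X X' X'' Y Y' Y'' : C} (f : X ⟶ X') (f' : X' ⟶ X'') (g : Y ⟶ Y')
    (g' : Y' ⟶ Y'') : S.cmp (f ≫ f') (g ≫ g') = S.cmp f g ≫ S.cmp f' g' :=
  S.cop.map_comp ((f, g) : (X, Y) ⟶ (X', Y')) ((f', g') : (X', Y') ⟶ (X'', Y''))

lemma cmp_id (X Y : C) : S.cmp (𝟙 X) (𝟙 Y) = 𝟙 (S.cob X Y) := S.cop.map_id (X, Y)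

lemma nabla_natural {X Y : C} (f : X ⟶ Y) : S.cmp f f ≫ S.nabla Y = S.nabla X ≫ f :=
  S.codiag.naturality f

lemma i₀_natural {X X' Y Y' : C} (f : X ⟶ X') (g : Y ⟶ Y') :
    f ≫ S.i₀ X' Y' = S.i₀ X Y ≫ S.cmp f g :=
  S.inj₀.naturality ((f, g) : (X, Y) ⟶ (X', Y'))

lemma i₁_natural {X X' Y Y' : C} (f : X ⟶ X') (g : Y ⟶ Y') :
    g ≫ S.i₁ X' Y' = S.i₁ X Y ≫ S.cmp f g :=
  S.inj₁.naturality ((f, g) : (X, Y) ⟶ (X', Y'))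

variable {S}

lemma i₀_desc (hS : S.IsCoherent) {X Y Z : C} (f : X ⟶ Z) (g : Y ⟶ Z) :
    S.i₀ X Y ≫ S.desc f g = f := by
  rw [desc, ← Category.assoc, ← S.i₀_natural, Category.assoc, hS.i₀_nabla, Category.comp_id]

lemma i₁_desc (hS : S.IsCoherent) {X Y Z : C} (f : X ⟶ Z) (g : Y ⟶ Z) :
    S.i₁ X Y ≫ S.desc f g = g := by
  rw [desc, ← Category.assoc, ← S.i₁_natural, Category.assoc, hS.i₁_nabla, Category.comp_id]

lemma eq_desc (hS : S.IsCoherent) {X Y Z : C} (f : S.cob X Y ⟶ Z) :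
    f = S.desc (S.i₀ X Y ≫ f) (S.i₁ X Y ≫ f) := by
  rw [desc, S.cmp_comp, Category.assoc, S.nabla_natural, ← Category.assoc, hS.cmp_nabla,
    Category.id_comp]

lemma cob_ext (hS : S.IsCoherent) {X Y Z : C} {f g : S.cob X Y ⟶ Z}
    (h₀ : S.i₀ X Y ≫ f = S.i₀ X Y ≫ g) (h₁ : S.i₁ X Y ≫ f = S.i₁ X Y ≫ g) : f = g := by
  rw [eq_desc hS f, eq_desc hS g, h₀, h₁]

end CoprodData

namespace PCategory

variable {C : Type u} [Category.{v} C] (P : PCategory C)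

lemma mp_p₀ {X X' Y Y' : C} (f : X ⟶ X') {g : Y ⟶ Y'} (hg : P.projections g) :
    P.mp f g ≫ P.p₀ X' Y' = P.p₀ X Y ≫ f :=
  P.naturalizer_proj₀ f g hg

lemma mp_p₁ {X X' Y Y' : C} {f : X ⟶ X'} (hf : P.projections f) (g : Y ⟶ Y') :
    P.mp f g ≫ P.p₁ X' Y' = P.p₁ X Y ≫ g :=
  P.naturalizer_proj₁ f g hf

lemma mp_dom_p₀ (X : C) {Y Z : C} (ψ : Y ⟶ Z) :
    P.mp (𝟙 X) (P.dom ψ) ≫ P.p₀ X Y = P.mp (𝟙 X) ψ ≫ P.p₀ X Z := by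
  have e (W W' W'' : C) (f : W ⟶ W') (g : W' ⟶ W'') :
      P.mp (𝟙 X) (f ≫ g) = P.mp (𝟙 X) f ≫ P.mp (𝟙 X) g := by
    rw [← P.mp_comp, Category.comp_id]
  have h₀ := P.mp_p₀ (𝟙 X) (BoxData.projections.p₀ (P := P.toBoxData) Y Z)
  have h₁ := P.mp_p₀ (𝟙 X) (BoxData.projections.p₁ (P := P.toBoxData) Y Z)
  have h₂ : P.lift (𝟙 Y) ψ ≫ P.p₁ Y Z = ψ := by
    rw [BoxData.lift, Category.assoc, P.mp_p₁ (.id _), ← Category.assoc, P.isCoherent.diag_p₁,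
      Category.id_comp]
  rw [dom, e, Category.assoc, h₀, ← h₁, ← Category.assoc, ← e, h₂]

lemma total_iff {Y Z : C} (ψ : Y ⟶ Z) :
    P.total ψ ↔ ∀ X, P.mp (𝟙 X) ψ ≫ P.p₀ X Z = P.p₀ X Y := by
  constructor
  · intro h X
    rw [← P.mp_dom_p₀, show P.dom ψ = 𝟙 Y from h, P.mp_id, Category.id_comp]
  · intro h
    change (P.Δ Y ≫ P.mp (𝟙 Y) ψ) ≫ P.p₀ Y Z = 𝟙 Y
    rw [Category.assoc, h, P.isCoherent.diag_p₀]

lemma total_of_projections {X Y : C} {f : X ⟶ Y} (hf : P.projections f) : P.total f :=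
  (P.total_iff f).2 fun W => by rw [P.mp_p₀ _ hf, Category.comp_id]

lemma mp_p₀_of_total {X X' Y Y' : C} (f : X ⟶ X') {g : Y ⟶ Y'} (hg : P.total g) :
    P.mp f g ≫ P.p₀ X' Y' = P.p₀ X Y ≫ f := by
  have : P.mp f g = P.mp (𝟙 X) g ≫ P.mp f (𝟙 Y') := by
    rw [← P.mp_comp, Category.id_comp, Category.comp_id]
  rw [this, Category.assoc, P.mp_p₀ f (.id _), ← Category.assoc, (P.total_iff g).1 hg]

instance : P.total.IsMultiplicative where
  id_mem X := P.total_of_projections (.id X)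
  comp_mem f g hf hg := (P.total_iff _).2 fun X => by
    rw [← Category.comp_id (𝟙 X), P.mp_comp, Category.assoc, (P.total_iff g).1 hg,
      (P.total_iff f).1 hf]

lemma dom_comp {X Y : C} (φ : X ⟶ Y) : P.dom φ ≫ φ = φ := by
  have : P.mp (𝟙 X) φ ≫ P.p₀ X Y ≫ φ = P.mp φ φ ≫ P.p₀ Y Y := by
    rw [← P.mp_p₀ φ (.id _), ← Category.assoc, ← P.mp_comp, Category.id_comp, Category.comp_id]
  rw [dom, BoxData.lift, Category.assoc, Category.assoc, this, ← Category.assoc, ← P.Δ_natural,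
    Category.assoc, P.isCoherent.diag_p₀, Category.comp_id]

lemma total_of_comp {X Y Z : C} (f : X ⟶ Y) (g : Y ⟶ Z) (h : P.total (f ≫ g)) : P.total f := by
  refine (P.total_iff f).2 fun W => ?_
  have key : P.mp (𝟙 W) (f ≫ g) = P.mp (𝟙 W) (P.dom f) ≫ P.mp (𝟙 W) (f ≫ g) := by
    rw [← P.mp_comp, Category.comp_id, ← Category.assoc, P.dom_comp]
  have h₁ := (P.total_iff _).1 h W
  rw [← P.mp_dom_p₀]
  conv_lhs => rw [← h₁]
  rw [← Category.assoc, ← key, h₁]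

lemma total_of_isIso {X Y : C} (f : X ⟶ Y) [IsIso f] : P.total f :=
  P.total_of_comp f (inv f) (by rw [IsIso.hom_inv_id]; exact P.total.id_mem X)

lemma total_Δ (X : C) : P.total (P.Δ X) :=
  P.total_of_comp _ (P.p₀ X X) (by rw [P.isCoherent.diag_p₀]; exact P.total.id_mem X)

lemma lift_p₀ {X Y Z : C} (f : X ⟶ Y) {g : X ⟶ Z} (hg : P.total g) :
    P.lift f g ≫ P.p₀ Y Z = f := by
  rw [BoxData.lift, Category.assoc, P.mp_p₀_of_total f hg, ← Category.assoc,
    P.isCoherent.diag_p₀, Category.id_comp]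

lemma tr_p₀ (X Y : C) : P.tr X Y ≫ P.p₀ Y X = P.p₁ X Y :=
  P.lift_p₀ _ (P.total_of_projections (.p₀ X Y))

lemma tr_p₁ (X Y : C) : P.tr X Y ≫ P.p₁ Y X = P.p₀ X Y := by
  rw [← P.tr_p₀ Y X, ← Category.assoc, P.isCoherent.tr_tr, Category.id_comp]

lemma mp_p₁_of_total {X X' Y Y' : C} {f : X ⟶ X'} (hf : P.total f) (g : Y ⟶ Y') :
    P.mp f g ≫ P.p₁ X' Y' = P.p₁ X Y ≫ g := by
  rw [← P.tr_p₀, ← Category.assoc, P.isCoherent.tr_natural, Category.assoc,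
    P.mp_p₀_of_total g hf, ← Category.assoc, P.tr_p₀]

lemma ass_p₀ (X Y Z : C) :
    P.ass X Y Z ≫ P.p₀ X (P.ob Y Z) = P.p₀ (P.ob X Y) Z ≫ P.p₀ X Y :=
  P.lift_p₀ _ (P.total.comp_mem _ _ (P.total_Δ _) (P.total_of_projections
    (.box _ _ (.comp _ _ (.p₀ _ _) (.p₁ _ _)) (.p₁ _ _))))

lemma total_mp {X X' Y Y' : C} {f : X ⟶ X'} {g : Y ⟶ Y'} (hf : P.total f) (hg : P.total g) :
    P.total (P.mp f g) := by
  refine (P.total_iff _).2 fun W => ?_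
  have := P.isCoherent.ass_isIso W X Y
  rw [← cancel_epi (P.ass W X Y), ← Category.assoc, ← P.isCoherent.ass_natural, Category.assoc,
    P.ass_p₀, P.ass_p₀, ← Category.assoc, P.mp_p₀_of_total _ hg, Category.assoc,
    (P.total_iff f).1 hf]

lemma total_lift {X Y Z : C} {f : X ⟶ Y} {g : X ⟶ Z} (hf : P.total f) (hg : P.total g) :
    P.total (P.lift f g) :=
  P.total.comp_mem _ _ (P.total_Δ X) (P.total_mp hf hg)

/-- The subcategory `C_T` of total morphisms. -/
abbrev Total : Type u := WideSubcategory P.total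

/-- The near product of `P` restricted to `C_T`. -/
def totalBoxData : BoxData P.Total where
  box :=
    { obj := fun p => ⟨P.ob p.1.obj p.2.obj⟩
      map := fun f => ⟨P.mp f.1.hom f.2.hom, P.total_mp f.1.property f.2.property⟩
      map_id := fun _ => WideSubcategory.hom_ext _ (P.mp_id _ _)
      map_comp := fun _ _ => WideSubcategory.hom_ext _ (P.mp_comp _ _ _ _) }
  diag :=
    { app := fun X => ⟨P.Δ X.obj, P.total_Δ X.obj⟩
      naturality := fun _ _ f => WideSubcategory.hom_ext _ (P.Δ_natural f.hom) }
  proj₀ := fun p => ⟨P.p₀ p.1.obj p.2.obj, P.total_of_projections (.p₀ _ _)⟩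
  proj₁ := fun p => ⟨P.p₁ p.1.obj p.2.obj, P.total_of_projections (.p₁ _ _)⟩

lemma isIso_total {X Y : P.Total} (f : X ⟶ Y) (hf : IsIso f.hom) : IsIso f :=
  ⟨⟨inv f.hom, P.total_of_isIso _⟩, WideSubcategory.hom_ext _ (IsIso.hom_inv_id f.hom),
    WideSubcategory.hom_ext _ (IsIso.inv_hom_id f.hom)⟩

/-- The near product of `P` is a product on `C_T`. -/
def totalBCategory : BCategory P.Total where
  toBoxData := P.totalBoxData
  isCoherent :=
    { diag_p₀ := fun X => WideSubcategory.hom_ext _ (P.isCoherent.diag_p₀ X.obj)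
      diag_p₁ := fun X => WideSubcategory.hom_ext _ (P.isCoherent.diag_p₁ X.obj)
      diag_mp := fun X Y => WideSubcategory.hom_ext _ (P.isCoherent.diag_mp X.obj Y.obj)
      ass_natural := fun f g h =>
        WideSubcategory.hom_ext _ (P.isCoherent.ass_natural f.hom g.hom h.hom)
      ass_isIso := fun X Y Z => P.isIso_total _ (P.isCoherent.ass_isIso X.obj Y.obj Z.obj)
      tr_natural := fun f g => WideSubcategory.hom_ext _ (P.isCoherent.tr_natural f.hom g.hom)
      tr_tr := fun X Y => WideSubcategory.hom_ext _ (P.isCoherent.tr_tr X.obj Y.obj)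
      pentagon := fun W X Y Z =>
        WideSubcategory.hom_ext _ (P.isCoherent.pentagon W.obj X.obj Y.obj Z.obj)
      hexagon := fun X Y Z =>
        WideSubcategory.hom_ext _ (P.isCoherent.hexagon X.obj Y.obj Z.obj) }
  p₀_natural f g := WideSubcategory.hom_ext _ (P.mp_p₀_of_total f.hom g.property)
  p₁_natural f g := WideSubcategory.hom_ext _ (P.mp_p₁_of_total f.property g.hom)

end PCategory

namespace PPlusCategory

variable {C : Type u} [Category.{v} C] (P : PPlusCategory C)

lemma total_i₀ (hP : P.IsProdominical) (X Y : C) : P.total (P.i₀ X Y) := by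
  obtain ⟨zero, -, -⟩ := hP
  refine P.total_of_comp _ (P.desc (𝟙 X) (zero Y X)) ?_
  rw [CoprodData.i₀_desc P.isCoherentCoprod]
  exact P.total.id_mem X

lemma total_i₁ (hP : P.IsProdominical) (X Y : C) : P.total (P.i₁ X Y) := by
  obtain ⟨zero, -, -⟩ := hP
  refine P.total_of_comp _ (P.desc (zero X Y) (𝟙 Y)) ?_
  rw [CoprodData.i₁_desc P.isCoherentCoprod]
  exact P.total.id_mem Y

lemma total_of_inj (hP : P.IsProdominical) {X Y Z : C} (f : P.cob X Y ⟶ Z)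
    (h₀ : P.total (P.i₀ X Y ≫ f)) (h₁ : P.total (P.i₁ X Y ≫ f)) : P.total f := by
  refine (P.total_iff f).2 fun W => ?_
  have := P.dist_isIso W X Y
  rw [← cancel_epi (undist P.toBoxData P.toCoprodData W X Y)]
  have e (V : C) (g : V ⟶ P.cob X Y) :
      P.mp (𝟙 W) g ≫ P.mp (𝟙 W) f = P.mp (𝟙 W) (g ≫ f) := by
    rw [← P.mp_comp, Category.comp_id]
  apply CoprodData.cob_ext P.isCoherentCoprod
  · rw [← Category.assoc, ← Category.assoc, undist, CoprodData.i₀_desc P.isCoherentCoprod,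
      ← Category.assoc, e, (P.total_iff _).1 h₀,
      CoprodData.i₀_desc P.isCoherentCoprod, (P.total_iff _).1 (P.total_i₀ hP X Y)]
  · rw [← Category.assoc, ← Category.assoc, undist, CoprodData.i₁_desc P.isCoherentCoprod,
      ← Category.assoc, e, (P.total_iff _).1 h₁,
      CoprodData.i₁_desc P.isCoherentCoprod, (P.total_iff _).1 (P.total_i₁ hP X Y)]

lemma total_cmp (hP : P.IsProdominical) {X X' Y Y' : C} {f : X ⟶ X'} {g : Y ⟶ Y'}
    (hf : P.total f) (hg : P.total g) : P.total (P.cmp f g) := by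
  apply P.total_of_inj hP
  · rw [← P.i₀_natural]
    exact P.total.comp_mem _ _ hf (P.total_i₀ hP _ _)
  · rw [← P.i₁_natural]
    exact P.total.comp_mem _ _ hg (P.total_i₁ hP _ _)

lemma total_nabla (hP : P.IsProdominical) (X : C) : P.total (P.nabla X) := by
  apply P.total_of_inj hP
  · rw [P.isCoherentCoprod.i₀_nabla]
    exact P.total.id_mem X
  · rw [P.isCoherentCoprod.i₁_nabla]
    exact P.total.id_mem X

/-- The coproduct of `C` restricted to `C_T`. -/
def totalCoprodData (hP : P.IsProdominical) : CoprodData P.Total where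
  cop :=
    { obj := fun p => ⟨P.cob p.1.obj p.2.obj⟩
      map := fun f => ⟨P.cmp f.1.hom f.2.hom, P.total_cmp hP f.1.property f.2.property⟩
      map_id := fun _ => WideSubcategory.hom_ext _ (P.cmp_id _ _)
      map_comp := fun _ _ => WideSubcategory.hom_ext _ (P.cmp_comp _ _ _ _) }
  codiag :=
    { app := fun X => ⟨P.nabla X.obj, P.total_nabla hP X.obj⟩
      naturality := fun _ _ f => WideSubcategory.hom_ext _ (P.nabla_natural f.hom) }
  inj₀ :=
    { app := fun p => ⟨P.i₀ p.1.obj p.2.obj, P.total_i₀ hP _ _⟩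
      naturality := fun _ _ f => WideSubcategory.hom_ext _ (P.i₀_natural f.1.hom f.2.hom) }
  inj₁ :=
    { app := fun p => ⟨P.i₁ p.1.obj p.2.obj, P.total_i₁ hP _ _⟩
      naturality := fun _ _ f => WideSubcategory.hom_ext _ (P.i₁_natural f.1.hom f.2.hom) }

/-- The `B⁺`-category structure of `C_T`, the restriction of the `P⁺`-structure of `C`. -/
def totalBPlus (hP : P.IsProdominical) : BPlusCategory P.Total where
  toBCategory := P.totalBCategory
  toCoprodData := P.totalCoprodData hP
  isCoherentCoprod :=
    { i₀_nabla := fun X => WideSubcategory.hom_ext _ (P.isCoherentCoprod.i₀_nabla X.obj)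
      i₁_nabla := fun X => WideSubcategory.hom_ext _ (P.isCoherentCoprod.i₁_nabla X.obj)
      cmp_nabla := fun X Y =>
        WideSubcategory.hom_ext _ (P.isCoherentCoprod.cmp_nabla X.obj Y.obj)
      cass_natural := fun f g h =>
        WideSubcategory.hom_ext _ (P.isCoherentCoprod.cass_natural f.hom g.hom h.hom)
      cass_isIso := fun X Y Z =>
        P.isIso_total _ (P.isCoherentCoprod.cass_isIso X.obj Y.obj Z.obj)
      ctr_natural := fun f g =>
        WideSubcategory.hom_ext _ (P.isCoherentCoprod.ctr_natural f.hom g.hom)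
      ctr_ctr := fun X Y => WideSubcategory.hom_ext _ (P.isCoherentCoprod.ctr_ctr X.obj Y.obj)
      pentagon := fun W X Y Z =>
        WideSubcategory.hom_ext _ (P.isCoherentCoprod.pentagon W.obj X.obj Y.obj Z.obj)
      hexagon := fun X Y Z =>
        WideSubcategory.hom_ext _ (P.isCoherentCoprod.hexagon X.obj Y.obj Z.obj) }
  dist_isIso X Y Z := P.isIso_total _ (P.dist_isIso X.obj Y.obj Z.obj)

end PPlusCategory

/-! ### `B^#`-categories and iteration categories -/

/-- `pow X n` is the power `X^{n+1}`, where `X^1 = X` and `X^{n+1} = X × X^n`. -/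
def BPlusCategory.pow {D : Type u} [Category.{v} D] (B : BPlusCategory D) (X : D) : ℕ → D
  | 0 => X
  | n + 1 => B.ob X (B.pow X n)

/-- The monad and the multiplication of a formally free semigroup: a monad `#` with
unit `j : X ⟶ X^#` and multiplication `e : X^{##} ⟶ X^#`, together with morphisms
`m : X^# × X^# ⟶ X^#`. -/
structure SharpData {D : Type u} [Category.{v} D] (B : BPlusCategory D) where
  sharp : CategoryTheory.Monad D
  m (X : D) : B.ob (sharp.obj X) (sharp.obj X) ⟶ sharp.obj X

namespace SharpData

variable {D : Type u} [Category.{v} D] {B : BPlusCategory D} (S : SharpData B)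

/-- `X^#` -/
abbrev sh (X : D) : D := S.sharp.obj X

/-- `f^#` -/
abbrev shMap {X Y : D} (f : X ⟶ Y) : S.sh X ⟶ S.sh Y := S.sharp.map f

/-- `j : X ⟶ X^#` -/
abbrev j (X : D) : X ⟶ S.sh X := S.sharp.η.app X

/-- `e : X^{##} ⟶ X^#` -/
abbrev e (X : D) : S.sh (S.sh X) ⟶ S.sh X := S.sharp.μ.app X

/-- `f · g = m (f × g)` -/
def dot {A A' X : D} (f : A ⟶ S.sh X) (g : A' ⟶ S.sh X) : B.ob A A' ⟶ S.sh X :=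
  B.mp f g ≫ S.m X

/-- `jn X n` is the morphism `j_{n+1} : X^{n+1} ⟶ X^#`, where `j_1 = j` and
`j_{n+1} = j · j_n`. -/
def jn (X : D) : (n : ℕ) → (B.pow X n ⟶ S.sh X)
  | 0 => S.j X
  | n + 1 => S.dot (S.j X) (jn X n)

/-- `[j, j · X^#] : X ∐ (X × X^#) ⟶ X^#` -/
def consMap (X : D) : B.cob X (B.ob X (S.sh X)) ⟶ S.sh X :=
  B.desc (S.j X) (S.dot (S.j X) (𝟙 (S.sh X)))

/-- `[X^# · j, j] : (X^# × X) ∐ X ⟶ X^#` -/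
def snocMap (X : D) : B.cob (B.ob (S.sh X) X) X ⟶ S.sh X :=
  B.desc (S.dot (𝟙 (S.sh X)) (S.j X)) (S.j X)

/-- `i₀^# : X^# ⟶ (X ∐ Y)^#` -/
def a₀ (X Y : D) : S.sh X ⟶ S.sh (B.cob X Y) := S.shMap (B.i₀ X Y)

/-- `i₁^# : Y^# ⟶ (X ∐ Y)^#` -/
def a₁ (X Y : D) : S.sh Y ⟶ S.sh (B.cob X Y) := S.shMap (B.i₁ X Y)

/-- `e (i₀^# · i₁^#)^# : (X^# × Y^#)^# ⟶ (X ∐ Y)^#` -/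
def a₀₁ (X Y : D) : S.sh (B.ob (S.sh X) (S.sh Y)) ⟶ S.sh (B.cob X Y) :=
  S.shMap (S.dot (S.a₀ X Y) (S.a₁ X Y)) ≫ S.e (B.cob X Y)

/-- `e (i₁^# · i₀^#)^# : (Y^# × X^#)^# ⟶ (X ∐ Y)^#` -/
def a₁₀ (X Y : D) : S.sh (B.ob (S.sh Y) (S.sh X)) ⟶ S.sh (B.cob X Y) :=
  S.shMap (S.dot (S.a₁ X Y) (S.a₀ X Y)) ≫ S.e (B.cob X Y)

/-- The object `X^# ∐ Y^# ∐ (X^# × Y^#)^# ∐ (Y^# × X^#)^# ∐ (Y^# × (X^# × Y^#)^#) ∐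
(X^# × (Y^# × X^#)^#)`, associated to the left. -/
abbrev wdOb (X Y : D) : D :=
  B.cob (B.cob (B.cob (B.cob (B.cob (S.sh X) (S.sh Y)) (S.sh (B.ob (S.sh X) (S.sh Y))))
    (S.sh (B.ob (S.sh Y) (S.sh X)))) (B.ob (S.sh Y) (S.sh (B.ob (S.sh X) (S.sh Y)))))
    (B.ob (S.sh X) (S.sh (B.ob (S.sh Y) (S.sh X))))

/-- The action of `wdOb` on morphisms. -/
abbrev wdObMap {X X' Y Y' : D} (f : X ⟶ X') (g : Y ⟶ Y') : S.wdOb X Y ⟶ S.wdOb X' Y' :=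
  B.cmp (B.cmp (B.cmp (B.cmp (B.cmp (S.shMap f) (S.shMap g))
    (S.shMap (B.mp (S.shMap f) (S.shMap g)))) (S.shMap (B.mp (S.shMap g) (S.shMap f))))
    (B.mp (S.shMap g) (S.shMap (B.mp (S.shMap f) (S.shMap g)))))
    (B.mp (S.shMap f) (S.shMap (B.mp (S.shMap g) (S.shMap f))))

/-- The morphism `[i₀^#, i₁^#, e(i₀^#·i₁^#)^#, e(i₁^#·i₀^#)^#, i₁^#·e(i₀^#·i₁^#)^#,
i₀^#·e(i₁^#·i₀^#)^#]` into `(X ∐ Y)^#`. -/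
def unwd (X Y : D) : S.wdOb X Y ⟶ S.sh (B.cob X Y) :=
  B.desc (B.desc (B.desc (B.desc (B.desc (S.a₀ X Y) (S.a₁ X Y)) (S.a₀₁ X Y)) (S.a₁₀ X Y))
    (S.dot (S.a₁ X Y) (S.a₀₁ X Y))) (S.dot (S.a₀ X Y) (S.a₁₀ X Y))

end SharpData

/-- An extension of a `B⁺`-category structure to a `B^#`-category structure: a formally free
semigroup monad `#` with the natural transformations `m, j, e, l, r, par, wd`. -/
structure BSharp {D : Type u} [Category.{v} D] (B : BPlusCategory D) extends SharpData B where
  m_natural {X Y : D} (f : X ⟶ Y) :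
    B.mp (toSharpData.shMap f) (toSharpData.shMap f) ≫ m Y = m X ≫ toSharpData.shMap f
  m_assoc (X : D) :
    B.mp (m X) (𝟙 (toSharpData.sh X)) ≫ m X =
      B.ass (toSharpData.sh X) (toSharpData.sh X) (toSharpData.sh X) ≫
        B.mp (𝟙 (toSharpData.sh X)) (m X) ≫ m X
  e_hom (X : D) :
    B.mp (toSharpData.e X) (toSharpData.e X) ≫ m X = m (toSharpData.sh X) ≫ toSharpData.e X
  l (X : D) : toSharpData.sh X ⟶ B.cob X (B.ob X (toSharpData.sh X))
  l_natural {X Y : D} (f : X ⟶ Y) :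
    toSharpData.shMap f ≫ l Y = l X ≫ B.cmp f (B.mp f (toSharpData.shMap f))
  l_consMap (X : D) : l X ≫ toSharpData.consMap X = 𝟙 _
  consMap_l (X : D) : toSharpData.consMap X ≫ l X = 𝟙 _
  r (X : D) : toSharpData.sh X ⟶ B.cob (B.ob (toSharpData.sh X) X) X
  r_natural {X Y : D} (f : X ⟶ Y) :
    toSharpData.shMap f ≫ r Y = r X ≫ B.cmp (B.mp (toSharpData.shMap f) f) f
  r_snocMap (X : D) : r X ≫ toSharpData.snocMap X = 𝟙 _
  snocMap_r (X : D) : toSharpData.snocMap X ≫ r X = 𝟙 _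
  par (X Y : D) : B.ob X (toSharpData.sh Y) ⟶ toSharpData.sh (B.ob X Y)
  par_natural {X X' Y Y' : D} (f : X ⟶ X') (g : Y ⟶ Y') :
    B.mp f (toSharpData.shMap g) ≫ par X' Y' = par X Y ≫ toSharpData.shMap (B.mp f g)
  par_p₁ (X Y : D) :
    par X Y ≫ toSharpData.shMap (B.p₁ X Y) = B.p₁ X (toSharpData.sh Y)
  wd (X Y : D) : toSharpData.sh (B.cob X Y) ⟶ toSharpData.wdOb X Y
  wd_natural {X X' Y Y' : D} (f : X ⟶ X') (g : Y ⟶ Y') :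
    toSharpData.shMap (B.cmp f g) ≫ wd X' Y' = wd X Y ≫ toSharpData.wdObMap f g
  wd_unwd (X Y : D) : wd X Y ≫ toSharpData.unwd X Y = 𝟙 _
  unwd_wd (X Y : D) : toSharpData.unwd X Y ≫ wd X Y = 𝟙 _

/-- An iteration category structure on `C`: a prodominical `P⁺`-category with ranges that satisfies
the weak axiom of choice, with an extension of the `B⁺`-category structure of `C_T` to a
`B^#`-category structure such that for each object `X` the formally free semigroup `X^#` (that is,
the domain `1_{X^#}`) is the stable union of the ranges of `j_n : X^n ⟶ X^#`, `n ≥ 1`. -/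
structure IterationCategory (C : Type u) [Category.{v} C] extends PPlusCategory C where
  isProdominical : toPCategory.IsProdominical
  hasRanges : toPCategory.HasRanges
  weakChoice : toPCategory.WeakChoice
  bSharp : BSharp (toPPlusCategory.totalBPlus isProdominical)
  stable_union (X : toPCategory.Total) :
    ∃ ε : ℕ → ((bSharp.sh X).obj ⟶ (bSharp.sh X).obj),
      (∀ n, toPCategory.IsRange (bSharp.jn X n).hom (ε n)) ∧
        toPCategory.IsStableUnion ε (𝟙 (bSharp.sh X).obj)

/-! ### Structures on a category of partial maps that extend those of the base category -/

section Extends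

variable {C : Type u} [Category.{v} C] {M : MorphismProperty C} [IsDominion M]

/-- The near product `⊠` on `P(C, M)` is the extension of the product `×` of `C`: the object
`X ⊠ Y` is a product of `X` and `Y` in `C` whose projections `π₀, π₁` give `p₀, p₁`, and
`{m, φ} ⊠ {m', φ'} = {m × m', φ × φ'}`. -/
def ExtendsProduct (P : PCategory (PartialMaps M)) : Prop :=
  ∃ (π₀ : ∀ X Y : PartialMaps M, (P.ob X Y).obj ⟶ X.obj)
    (π₁ : ∀ X Y : PartialMaps M, (P.ob X Y).obj ⟶ Y.obj),
    (∀ X Y, Nonempty (IsLimit (BinaryFan.mk (π₀ X Y) (π₁ X Y)))) ∧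
    (∀ X Y, P.p₀ X Y = (PartialMaps.embedding M).map (π₀ X Y)) ∧
    (∀ X Y, P.p₁ X Y = (PartialMaps.embedding M).map (π₁ X Y)) ∧
    ∀ {U X Y U' X' Y' : PartialMaps M} (m : U.obj ⟶ X.obj) (hm : M m) (φ : U.obj ⟶ Y.obj)
      (m' : U'.obj ⟶ X'.obj) (hm' : M m') (φ' : U'.obj ⟶ Y'.obj),
      ∃ (μ : (P.ob U U').obj ⟶ (P.ob X X').obj) (hμ : M μ)
        (ψ : (P.ob U U').obj ⟶ (P.ob Y Y').obj),
        μ ≫ π₀ X X' = π₀ U U' ≫ m ∧ μ ≫ π₁ X X' = π₁ U U' ≫ m' ∧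
        ψ ≫ π₀ Y Y' = π₀ U U' ≫ φ ∧ ψ ≫ π₁ Y Y' = π₁ U U' ≫ φ' ∧
        P.mp (PartialMaps.Hom.mk m hm φ : X ⟶ Y) (PartialMaps.Hom.mk m' hm' φ' : X' ⟶ Y') =
          PartialMaps.Hom.mk μ hμ ψ

/-- The coproduct on `P(C, M)` is that of `C`: the object `X ∐ Y` is a coproduct of `X` and `Y` in
`C` whose injections `ι₀, ι₁` give `i₀, i₁`. -/
def ExtendsCoproduct (S : CoprodData (PartialMaps M)) : Prop :=
  ∀ X Y : PartialMaps M, ∃ (ι₀ : X.obj ⟶ (S.cob X Y).obj) (ι₁ : Y.obj ⟶ (S.cob X Y).obj),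
    Nonempty (IsColimit (BinaryCofan.mk ι₀ ι₁)) ∧
    S.i₀ X Y = (PartialMaps.embedding M).map ι₀ ∧ S.i₁ X Y = (PartialMaps.embedding M).map ι₁

end Extends

end IterCat

end

/-!
The products of `Set_F` have no concrete description on underlying sets. The structure of `Pfn_F` is
therefore checked not on elements but on germs.

For a coalgebra `T` and `t ∈ T` let `Germ (T, t) X` be the set of germs at `t` of homomorphisms from
subcoalgebras of `T` into `X`, the filtered colimit of the sets `Hom(S, X)` over the subcoalgebras
`S` of `T` with `t ∈ S`. Each functor `Germ (T, t)` preserves binary products, monomorphisms and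
pullbacks because the colimit is filtered. It also preserves all
coproducts: near `t` a homomorphism into `∐ Z k` takes values in a single summand
(`Germ.bijective_of_isSum`). The germ at `t` of the identity of `T` shows that these functors are
jointly faithful and jointly reflect isomorphisms (`Germ.hom_ext`, `Germ.isIso_of_map_bijective`).
A partial morphism `{m, φ}` induces a relation between germs, functorially and faithfully
(`Pfn.rel_comp`, `Pfn.rel_ext`), and the near product and the coproduct become cartesian product
and disjoint union of relations. Every axiom on `⊠` and `∐` is thus an elementary statement about
partial functions between sets. Ranges are images, and a partial monomorphism `{m, φ}` has
a monomorphism `φ` and hence the section `{φ, m}`.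

`Set_F` has binary products because `F` is bounded: a product of `A` and `B` is the quotient by
bisimilarity of the coproduct of a representative set of small spans from `A` to `B`
(`Span.exists_isLimit`). It is terminal among spans since a homomorphism into such a quotient is
unique, so that those defined on small subcoalgebras fit together. An accessible functor is bounded:
a point of a coalgebra is contained in the countable union obtained by repeatedly adding small
supports of the values of the structure map (`isBoundedEndofunctor_of_isAccessible`).

The object `X^#` is the coproduct `∐ X^n` over `n ≥ 1`. Its germs are the nonempty words in the
germs of `X`, since germs preserve products and coproducts. All the equations of a `B^#`-category
become equations between lists; that `[j, j · 1]`, `[1 · j, j]` and the morphism inverse to `wd` are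
invertible says that a nonempty word has a first letter, a last letter, and a unique division into
maximal blocks of letters from either of two alphabets (`BlockWord.flatten₂_injective`,
`BlockWord.exists_flatten₂`). This part only uses a jointly faithful and conservative family of
set-valued functors preserving products and coproducts (`PointModel`). Finally every germ in `X^#`
comes along some `j_n` from a germ in `X^n`, which is why `X^#` is the stable union of the ranges of
the `j_n` (`Pfn.isStableUnion_id`).
-/

/-! ### Coalgebras, elementwise -/

namespace IterCat

open Endofunctor

namespace SetF

variable {F : Type u ⥤ Type u}

lemma hom_ext {A B : SetF F} {f g : A ⟶ B} (h : ∀ a, f.f a = g.f a) : f = g :=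
  Coalgebra.ext (by ext a; exact h a)

lemma comp_apply {A B D : SetF F} (f : A ⟶ B) (g : B ⟶ D) (a : A.V) :
    (f ≫ g).f a = g.f (f.f a) := rfl

lemma id_apply {A : SetF F} (a : A.V) : (𝟙 A : A ⟶ A).f a = a := rfl

lemma apply_eq {A B D : SetF F} {f : A ⟶ B} {g : B ⟶ D} {h : A ⟶ D} (e : f ≫ g = h) (a : A.V) :
    g.f (f.f a) = h.f a := by rw [← e, comp_apply]

lemma str_apply {A B : SetF F} (f : A ⟶ B) (a : A.V) :
    B.str (f.f a) = F.map f.f (A.str a) := by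
  exact (ConcreteCategory.congr_hom f.h a).symm

/-- A function satisfying the homomorphism condition at every element is a homomorphism. -/
def homMk {A B : SetF F} (h : A.V → B.V)
    (w : ∀ a, B.str (h a) = F.map (TypeCat.ofHom h) (A.str a)) : A ⟶ B where
  f := TypeCat.ofHom h
  h := by
    ext a
    simpa using (w a).symm

/-- A function which agrees near every element with a homomorphism is a homomorphism. -/
lemma exists_hom_of_local {T X : SetF F} (h : T.V → X.V)
    (w : ∀ t, ∃ (S : SetF F) (i : S ⟶ T) (s : S.V) (g : S ⟶ X), i.f s = t ∧
      ∀ s', h (i.f s') = g.f s') : ∃ k : T ⟶ X, ∀ t, k.f t = h t := by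
  refine ⟨homMk h fun t => ?_, fun t => rfl⟩
  obtain ⟨S, i, s, g, rfl, hg⟩ := w t
  have e : i.f ≫ TypeCat.ofHom h = g.f := by
    ext s'
    exact hg s'
  rw [hg, str_apply, str_apply, ← e, F.map_comp]
  rfl

lemma isIso_of_bijective {A B : SetF F} (f : A ⟶ B) (hf : Function.Bijective f.f) : IsIso f := by
  have : IsIso f.f := (isIso_iff_bijective f.f).2 hf
  exact Coalgebra.iso_of_iso f

lemma mono_of_injective {A B : SetF F} (f : A ⟶ B) (hf : Function.Injective f.f) : Mono f := by
  have : Mono f.f := (mono_iff_injective f.f).2 hf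
  exact Coalgebra.mono_of_mono f

/-- The image of a homomorphism is a subcoalgebra. -/
lemma exists_image {A B : SetF F} (f : A ⟶ B) :
    ∃ (S : SetF F) (i : S ⟶ B), Mono i ∧ ∀ b, (∃ s, i.f s = b) ↔ ∃ a, f.f a = b := by
  let e : A.V → Set.range f.f := fun a => ⟨f.f a, a, rfl⟩
  choose s hs using fun b : Set.range f.f => b.2
  let S : SetF F := ⟨Set.range f.f, TypeCat.ofHom fun b =>
    F.map (TypeCat.ofHom e) (A.str (s b))⟩
  let i : S ⟶ B := homMk (A := S) (fun b => b.1) fun b => by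
    change _ = F.map _ (F.map (TypeCat.ofHom e) (A.str (s b)))
    rw [← hs b, str_apply]
    change _ = (F.map (TypeCat.ofHom e) ≫ F.map _) _
    rw [← F.map_comp]
    rfl
  exact ⟨S, i, mono_of_injective i Subtype.val_injective, fun b =>
    ⟨fun ⟨t, ht⟩ => ht ▸ t.2, fun h => ⟨⟨b, h⟩, rfl⟩⟩⟩

/-- The coalgebra on the empty set. -/
def empty (F : Type u ⥤ Type u) : SetF F where
  V := PEmpty
  str := TypeCat.ofHom PEmpty.elim

/-- The homomorphism out of the empty coalgebra. -/
def emptyHom (A : SetF F) : empty F ⟶ A := homMk PEmpty.elim fun a => a.elim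

/-- The coproduct of a family of coalgebras, on the disjoint union of the underlying sets. -/
def sigma {ι : Type u} (Z : ι → SetF F) : SetF F where
  V := Σ k, (Z k).V
  str := TypeCat.ofHom fun x => F.map (TypeCat.ofHom fun z => (⟨x.1, z⟩ : Σ k, (Z k).V))
    ((Z x.1).str x.2)

/-- The inclusions into the coproduct of a family. -/
def sigmaInj {ι : Type u} (Z : ι → SetF F) (k : ι) : Z k ⟶ sigma Z :=
  homMk (fun z => (⟨k, z⟩ : Σ k, (Z k).V)) fun _ => rfl

/-- The binary coproduct of coalgebras, on the disjoint union of the underlying sets. -/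
def sum (A B : SetF F) : SetF F where
  V := A.V ⊕ B.V
  str := TypeCat.ofHom (Sum.elim (fun a => F.map (TypeCat.ofHom Sum.inl) (A.str a))
    (fun b => F.map (TypeCat.ofHom Sum.inr) (B.str b)))

/-- The left inclusion into a binary coproduct. -/
def inl (A B : SetF F) : A ⟶ sum A B := homMk (fun a => (Sum.inl a : A.V ⊕ B.V)) fun _ => rfl

/-- The right inclusion into a binary coproduct. -/
def inr (A B : SetF F) : B ⟶ sum A B := homMk (fun b => (Sum.inr b : A.V ⊕ B.V)) fun _ => rfl

/-- A family of homomorphisms into `W` exhibits `W` as the disjoint union of their domains. -/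
def IsSum {ι : Type*} {Z : ι → SetF F} {W : SetF F} (c : ∀ k, Z k ⟶ W) : Prop :=
  Function.Bijective fun x : (Σ k, (Z k).V) => (c x.1).f x.2

namespace IsSum

variable {ι : Type*} {Z : ι → SetF F} {W : SetF F} {c : ∀ k, Z k ⟶ W}

lemma exists_eq (hc : IsSum c) (w : W.V) : ∃ k z, (c k).f z = w := by
  obtain ⟨⟨k, z⟩, h⟩ := hc.2 w
  exact ⟨k, z, h⟩

lemma injective (hc : IsSum c) (k : ι) : Function.Injective (c k).f := by
  intro z z' h
  have := @(hc.1 (a₁ := ⟨k, z⟩) (a₂ := ⟨k, z'⟩) h)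
  simpa using this

lemma index_eq (hc : IsSum c) {k k' : ι} {z : (Z k).V} {z' : (Z k').V}
    (h : (c k).f z = (c k').f z') : k = k' :=
  congrArg Sigma.fst (hc.1 (a₁ := ⟨k, z⟩) (a₂ := ⟨k', z'⟩) h)

lemma exists_desc (hc : IsSum c) {X : SetF F} (f : ∀ k, Z k ⟶ X) :
    ∃ g : W ⟶ X, ∀ k, c k ≫ g = f k := by
  let e := Equiv.ofBijective _ hc
  have he (k : ι) (z : (Z k).V) : e.symm ((c k).f z) = ⟨k, z⟩ :=
    e.symm_apply_eq.2 rfl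
  obtain ⟨g, hg⟩ := exists_hom_of_local (T := W) (X := X)
    (fun w => (f (e.symm w).1).f (e.symm w).2) (fun w => by
      obtain ⟨k, z, rfl⟩ := hc.exists_eq w
      exact ⟨Z k, c k, z, f k, rfl, fun s' => by rw [he]⟩)
  exact ⟨g, fun k => hom_ext fun z => by rw [comp_apply, hg, he]⟩

lemma hom_ext (hc : IsSum c) {X : SetF F} {f g : W ⟶ X} (h : ∀ k, c k ≫ f = c k ≫ g) : f = g :=
  SetF.hom_ext fun w => by
    obtain ⟨k, z, rfl⟩ := hc.exists_eq w
    rw [apply_eq (h k), comp_apply]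

end IsSum

lemma isSum_sigmaInj {ι : Type u} (Z : ι → SetF F) : IsSum (sigmaInj Z) := by
  constructor
  · rintro ⟨k, z⟩ ⟨k', z'⟩ h
    exact h
  · rintro ⟨k, z⟩
    exact ⟨⟨k, z⟩, rfl⟩

/-- The two inclusions into a binary coproduct, as a family. -/
def sumInj (A B : SetF F) : ∀ b : Bool, (cond b B A) ⟶ sum A B
  | false => inl A B
  | true => inr A B

lemma isSum_sumInj (A B : SetF F) : IsSum (sumInj A B) := by
  constructor
  · rintro ⟨_ | _, z⟩ ⟨_ | _, z'⟩ h
    · obtain rfl : z = z' := Sum.inl_injective h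
      rfl
    · exact absurd h Sum.inl_ne_inr
    · exact absurd h Sum.inr_ne_inl
    · obtain rfl : z = z' := Sum.inr_injective h
      rfl
  · rintro (a | b)
    · exact ⟨⟨false, a⟩, rfl⟩
    · exact ⟨⟨true, b⟩, rfl⟩

lemma exists_sumDesc {A B X : SetF F} (f : A ⟶ X) (g : B ⟶ X) :
    ∃ h : sum A B ⟶ X, inl A B ≫ h = f ∧ inr A B ≫ h = g := by
  obtain ⟨h, hh⟩ := (isSum_sumInj A B).exists_desc (X := X)
    (fun b => match b with | false => f | true => g)
  exact ⟨h, hh false, hh true⟩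

/-- The homomorphism out of a binary coproduct with given components. -/
noncomputable def sumDesc {A B X : SetF F} (f : A ⟶ X) (g : B ⟶ X) : sum A B ⟶ X :=
  (exists_sumDesc f g).choose

lemma inl_sumDesc {A B X : SetF F} (f : A ⟶ X) (g : B ⟶ X) : inl A B ≫ sumDesc f g = f :=
  (exists_sumDesc f g).choose_spec.1

lemma inr_sumDesc {A B X : SetF F} (f : A ⟶ X) (g : B ⟶ X) : inr A B ≫ sumDesc f g = g :=
  (exists_sumDesc f g).choose_spec.2

lemma sum_hom_ext {A B X : SetF F} {f g : sum A B ⟶ X} (h₀ : inl A B ≫ f = inl A B ≫ g)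
    (h₁ : inr A B ≫ f = inr A B ≫ g) : f = g :=
  (isSum_sumInj A B).hom_ext (fun b => match b with | false => h₀ | true => h₁)

lemma nonempty_isColimit_sum (A B : SetF F) :
    Nonempty (IsColimit (BinaryCofan.mk (inl A B) (inr A B))) :=
  ⟨BinaryCofan.isColimitMk (fun s => sumDesc s.inl s.inr) (fun _ => inl_sumDesc _ _)
    (fun _ => inr_sumDesc _ _) (fun _ _ h₀ h₁ => sum_hom_ext
      (h₀.trans (inl_sumDesc _ _).symm) (h₁.trans (inr_sumDesc _ _).symm))⟩

variable [WeaklyPreservesPullbacks F]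

lemma injective_of_mono {A B : SetF F} (f : A ⟶ B) [Mono f] : Function.Injective f.f :=
  (mono_iff_injective f.f).1 (mono_f f)

lemma map_injective {X Y : Type u} (m : X ⟶ Y) (hm : Function.Injective m) :
    Function.Injective (F.map m) := by
  have := (mono_iff_injective m).2 hm
  exact (mono_iff_injective _).1 (WeaklyPreservesPullbacks.map_mono (F := F) m)

/-- A homomorphism whose values lie in a subcoalgebra factors through it. -/
lemma exists_lift {S T W : SetF F} (i : S ⟶ T) (hi : Function.Injective i.f) (f : W ⟶ T)
    (h : ∀ w, ∃ s, i.f s = f.f w) : ∃ g : W ⟶ S, g ≫ i = f := by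
  choose g hg using h
  have e : TypeCat.ofHom g ≫ i.f = f.f := by
    ext w
    exact hg w
  refine ⟨homMk g fun w => ?_, hom_ext hg⟩
  apply map_injective i.f hi
  rw [← str_apply, hg, str_apply, ← e, F.map_comp]
  rfl

/-- The set-theoretic pullback of two homomorphisms carries a coalgebra structure. -/
lemma exists_weakPullback {A B D : SetF F} (f : A ⟶ D) (g : B ⟶ D) :
    ∃ (K : SetF F) (p : K ⟶ A) (q : K ⟶ B), p ≫ f = q ≫ g ∧
      (∀ a b, f.f a = g.f b → ∃ k, p.f k = a ∧ q.f k = b) ∧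
      ∀ k k', p.f k = p.f k' → q.f k = q.f k' → k = k' := by
  let P : Type u := {x : A.V × B.V // f.f x.1 = g.f x.2}
  let π₀ : P ⟶ A.V := TypeCat.ofHom fun x => x.1.1
  let π₁ : P ⟶ B.V := TypeCat.ofHom fun x => x.1.2
  have w : π₀ ≫ f.f = π₁ ≫ g.f := by
    ext x
    exact x.2
  have sq : IsPullback π₀ π₁ f.f g.f := by
    refine (Types.isPullback_iff _ _ _ _).2 ⟨w, ?_, ?_⟩
    · rintro ⟨⟨a, b⟩, h⟩ ⟨⟨a', b'⟩, h'⟩ ⟨h₀, h₁⟩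
      exact Subtype.ext (Prod.ext h₀ h₁)
    · intro a b h
      exact ⟨⟨(a, b), h⟩, rfl, rfl⟩
  obtain ⟨κ, h₁, h₂⟩ := (WeaklyPreservesPullbacks.isWeakPullback (F := F) sq).2 _
    (π₀ ≫ A.str) (π₁ ≫ B.str) (by
      simp only [Category.assoc, Coalgebra.Hom.h]
      rw [← Category.assoc, w, Category.assoc])
  refine ⟨⟨P, κ⟩, ⟨π₀, h₁⟩, ⟨π₁, h₂⟩, Coalgebra.ext w, fun a b h => ⟨⟨(a, b), h⟩, rfl, rfl⟩, ?_⟩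
  rintro ⟨⟨a, b⟩, h⟩ ⟨⟨a', b'⟩, h'⟩ h₀ h₁
  exact Subtype.ext (Prod.ext h₀ h₁)

lemma exists_isPullback {A B D : SetF F} (f : A ⟶ D) [Mono f] (g : B ⟶ D) :
    ∃ (K : SetF F) (p : K ⟶ A) (q : K ⟶ B), IsPullback p q f g ∧ Function.Injective q.f ∧
      ∀ a b, f.f a = g.f b → ∃ k, p.f k = a ∧ q.f k = b := by
  obtain ⟨K, p, q, w, h, h'⟩ := exists_weakPullback f g
  have hq : Function.Injective q.f := fun k k' e => h' k k' (injective_of_mono f (by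
    rw [apply_eq w, apply_eq w, comp_apply, comp_apply, e])) e
  have : Mono q := mono_of_injective q hq
  have key (s : PullbackCone f g) : ∃ l, l ≫ p = s.fst ∧ l ≫ q = s.snd := by
    obtain ⟨l, hl⟩ := exists_lift q hq s.snd fun t => by
      obtain ⟨k, -, hk⟩ := h (s.fst.f t) (s.snd.f t) (by rw [apply_eq s.condition, comp_apply])
      exact ⟨k, hk⟩
    refine ⟨l, ?_, hl⟩
    rw [← cancel_mono f, Category.assoc, w, ← Category.assoc, hl, s.condition]
  choose l h₀ h₁ using key
  exact ⟨K, p, q, ⟨⟨w⟩, ⟨PullbackCone.IsLimit.mk w l h₀ h₁ fun s m _ hm => by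
    rw [← cancel_mono q, hm, h₁]⟩⟩, hq, h⟩

end SetF

end IterCat

/-! ### Accessible functors are bounded -/

namespace IterCat

open Endofunctor Cardinal

section Accessible

variable {F : Type u ⥤ Type u}

/-- A set which contains, with every element `a`, a set supporting `A.str a`, is a subcoalgebra. -/
lemma SetF.exists_subcoalgebra (A : SetF F) (C : Set A.V)
    (h : ∀ a ∈ C, ∃ S : Set A.V, S ⊆ C ∧
      A.str a ∈ Set.range (F.map (TypeCat.ofHom (Subtype.val : S → A.V)))) :
    ∃ (B : SetF F) (i : B ⟶ A), Function.Injective i.f ∧ Set.range i.f = C ∧ B.V = C := by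
  have h' (a : C) : ∃ y, F.map (TypeCat.ofHom (Subtype.val : C → A.V)) y = A.str a.1 := by
    obtain ⟨S, hS, y, hy⟩ := h a.1 a.2
    refine ⟨F.map (TypeCat.ofHom (Set.inclusion hS)) y, ?_⟩
    rw [← hy]
    change (F.map (TypeCat.ofHom (Set.inclusion hS)) ≫ F.map _) y = _
    rw [← F.map_comp]
    rfl
  choose σ hσ using h'
  let B : SetF F := ⟨C, TypeCat.ofHom σ⟩
  exact ⟨B, SetF.homMk (A := B) (fun x => x.1) (fun a => (hσ a).symm), Subtype.val_injective,
    Subtype.range_coe, rfl⟩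

/-- An element of `F X` comes from a small subset of `X`, since `X` is the `κ`-filtered colimit of
its subsets of cardinality less than `κ`. -/
lemma exists_small_support (κ : Cardinal.{u}) [Fact κ.IsRegular] [F.IsCardinalAccessible κ]
    {X : Type u} (y : F.obj X) :
    ∃ S : Set X, #S < κ ∧ y ∈ Set.range (F.map (TypeCat.ofHom (Subtype.val : S → X))) := by
  have := F.preservesColimitsOfShape_of_isCardinalAccessible_of_essentiallySmall κ
    (HasCardinalLT.Set X κ)
  obtain ⟨S, z, hz⟩ := Types.jointly_surjective_of_isColimit
    (isColimitOfPreserves F (HasCardinalLT.Set.isColimitCocone X κ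
      (Cardinal.IsRegular.aleph0_le Fact.out))) y
  exact ⟨S.1, (hasCardinalLT_iff_cardinal_mk_lt _ _).1 S.2, z, hz⟩

/-- The closure of a point under small supports of the structure map is a small subcoalgebra. -/
lemma isBoundedEndofunctor_of_isAccessible (hF : F.IsAccessible.{u}) :
    IsBoundedEndofunctor F := by
  obtain ⟨κ, hκ, hF⟩ := hF.exists_cardinal
  have hκ' : ℵ₀ ≤ κ := Cardinal.IsRegular.aleph0_le hκ.out
  refine ⟨κ, fun A a => ?_⟩
  choose S hS hS' using fun x : A.V => exists_small_support κ (A.str x)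
  let C : ℕ → Set A.V := fun n => Nat.rec {a} (fun _ D => ⋃ x : D, S x.1) n
  have hC (n : ℕ) : #(↥(C n)) ≤ κ := by
    induction n with
    | zero => exact (mk_singleton a).trans_le (one_le_aleph0.trans hκ')
    | succ n ih =>
      refine (mk_iUnion_le _).trans ?_
      refine (mul_le_mul' ih (ciSup_le' fun x => (hS _).le)).trans ?_
      rw [mul_eq_self hκ']
  obtain ⟨B, i, hi, hr, hB⟩ := SetF.exists_subcoalgebra A (⋃ n : ℕ, C n) fun x hx => by
    obtain ⟨n, hn⟩ := Set.mem_iUnion.1 hx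
    refine ⟨S x, fun y hy => Set.mem_iUnion.2 ⟨n + 1, ?_⟩, hS' x⟩
    exact Set.mem_iUnion.2 ⟨⟨x, hn⟩, hy⟩
  refine ⟨B, i, hi, hr ▸ Set.mem_iUnion.2 ⟨0, rfl⟩, ?_⟩
  rw [hB, ← lift_uzero #(⋃ n : ℕ, C n)]
  refine (mk_iUnion_le_lift C).trans ?_
  rw [mk_nat, lift_aleph0]
  refine (mul_le_mul' hκ' (ciSup_le' fun n => (lift_uzero _).trans_le (hC n))).trans ?_
  rw [mul_eq_self hκ']

end Accessible

/-! ### Products of coalgebras -/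

section Products

variable {F : Type u ⥤ Type u}

/-- A span from `A` to `B` in `Set_F`. -/
structure Span (A B : SetF F) where
  apex : SetF F
  left : apex ⟶ A
  right : apex ⟶ B

namespace Span

variable {A B : SetF F}

/-- Two elements of spans are bisimilar if they are the images of one element of a third span,
mapped compatibly to both. -/
def Bisim (C D : Span A B) (c : C.apex.V) (d : D.apex.V) : Prop :=
  ∃ (R : SetF F) (p : R ⟶ C.apex) (q : R ⟶ D.apex) (r : R.V), p ≫ C.left = q ≫ D.left ∧
    p ≫ C.right = q ≫ D.right ∧ p.f r = c ∧ q.f r = d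

lemma Bisim.refl (C : Span A B) (c : C.apex.V) : Bisim C C c c :=
  ⟨C.apex, 𝟙 _, 𝟙 _, c, rfl, rfl, rfl, rfl⟩

lemma Bisim.symm {C D : Span A B} {c : C.apex.V} {d : D.apex.V} (h : Bisim C D c d) :
    Bisim D C d c := by
  obtain ⟨R, p, q, r, h₀, h₁, h₂, h₃⟩ := h
  exact ⟨R, q, p, r, h₀.symm, h₁.symm, h₃, h₂⟩

lemma Bisim.trans [WeaklyPreservesPullbacks F] {C D E : Span A B} {c : C.apex.V} {d : D.apex.V}
    {e : E.apex.V} (h : Bisim C D c d) (k : Bisim D E d e) : Bisim C E c e := by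
  obtain ⟨R, p, q, r, h₀, h₁, h₂, h₃⟩ := h
  obtain ⟨S, p', q', s, k₀, k₁, k₂, k₃⟩ := k
  obtain ⟨T, a, b, w, hw, -⟩ := SetF.exists_weakPullback q p'
  obtain ⟨t, rfl, rfl⟩ := hw r s (h₃.trans k₂.symm)
  refine ⟨T, a ≫ p, b ≫ q', t, ?_, ?_, h₂, k₃⟩
  · rw [Category.assoc, h₀, ← Category.assoc, w, Category.assoc, k₀, Category.assoc]
  · rw [Category.assoc, h₁, ← Category.assoc, w, Category.assoc, k₁, Category.assoc]

/-- Bisimilarity of elements of one span, as a setoid. -/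
def bisimSetoid [WeaklyPreservesPullbacks F] (C : Span A B) : Setoid C.apex.V where
  r := Bisim C C
  iseqv := ⟨Bisim.refl C, Bisim.symm, Bisim.trans⟩

variable [WeaklyPreservesPullbacks F]

/-- The quotient of a span by bisimilarity is a span, from which homomorphisms of spans into it
are unique. -/
lemma exists_quotient (C : Span A B) :
    ∃ (Q : Span A B) (q : C.apex ⟶ Q.apex), q ≫ Q.left = C.left ∧ q ≫ Q.right = C.right ∧
      ∀ (D : SetF F) (f g : D ⟶ Q.apex), f ≫ Q.left = g ≫ Q.left → f ≫ Q.right = g ≫ Q.right →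
        f = g := by
  let s := C.bisimSetoid
  let V : Type u := _root_.Quotient s
  let π : C.apex.V ⟶ V := TypeCat.ofHom (fun c => _root_.Quotient.mk s c)
  have hπ {R : SetF F} (p q : R ⟶ C.apex) (h₀ : p ≫ C.left = q ≫ C.left)
      (h₁ : p ≫ C.right = q ≫ C.right) : p.f ≫ π = q.f ≫ π := by
    ext r
    exact _root_.Quotient.sound ⟨R, p, q, r, h₀, h₁, rfl, rfl⟩
  let σ : V → F.obj V := _root_.Quotient.lift (fun c => F.map π (C.apex.str c)) (by
    rintro _ _ ⟨R, p, q, r, h₀, h₁, rfl, rfl⟩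
    change F.map π (C.apex.str (p.f r)) = F.map π (C.apex.str (q.f r))
    rw [SetF.str_apply, SetF.str_apply]
    change (F.map p.f ≫ F.map π) _ = (F.map q.f ≫ F.map π) _
    rw [← F.map_comp, ← F.map_comp, hπ p q h₀ h₁])
  let Q : SetF F := ⟨V, TypeCat.ofHom σ⟩
  let q : C.apex ⟶ Q := SetF.homMk (B := Q) (fun c => _root_.Quotient.mk s c) (fun c => rfl)
  have hq (v : V) : ∃ c, q.f c = v := by
    induction v using _root_.Quotient.ind with
    | _ c => exact ⟨c, rfl⟩
  -- A homomorphism out of `C` compatible with bisimilarity descends to the quotient.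
  have key {X : SetF F} (f : C.apex ⟶ X) (hf : ∀ c c', Bisim C C c c' → f.f c = f.f c') :
      ∃ g : Q ⟶ X, q ≫ g = f := by
    let g₀ : V → X.V := _root_.Quotient.lift f.f (fun c c' h => hf c c' h)
    refine ⟨SetF.homMk (A := Q) g₀ (fun v => ?_), SetF.hom_ext fun c => rfl⟩
    obtain ⟨c, rfl⟩ := hq v
    change X.str (f.f c) = F.map (TypeCat.ofHom g₀) (F.map π (C.apex.str c))
    rw [SetF.str_apply]
    change _ = (F.map π ≫ F.map (TypeCat.ofHom g₀)) (C.apex.str c)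
    rw [← F.map_comp]
    rfl
  obtain ⟨l, hl⟩ := key C.left (by
    rintro _ _ ⟨R, p, p', r, h₀, h₁, rfl, rfl⟩
    rw [SetF.apply_eq h₀, SetF.comp_apply])
  obtain ⟨r, hr⟩ := key C.right (by
    rintro _ _ ⟨R, p, p', r, h₀, h₁, rfl, rfl⟩
    rw [SetF.apply_eq h₁, SetF.comp_apply])
  refine ⟨⟨Q, l, r⟩, q, hl, hr, fun D f g h₀ h₁ => SetF.hom_ext fun d => ?_⟩
  have aux (f : D ⟶ Q) (L : D ⟶ A) (hL : f ≫ l = L) (R : D ⟶ B) (hR : f ≫ r = R) (d : D.V)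
      (c : C.apex.V) (h : f.f d = q.f c) : Bisim ⟨D, L, R⟩ C d c := by
    subst hL hR
    obtain ⟨R, a, b, w, hR, -⟩ := SetF.exists_weakPullback f q
    obtain ⟨t, ht, ht'⟩ := hR d c h
    refine ⟨R, a, b, t, ?_, ?_, ht, ht'⟩
    · change a ≫ f ≫ l = b ≫ C.left
      rw [← hl, ← Category.assoc, w, Category.assoc]
    · change a ≫ f ≫ r = b ≫ C.right
      rw [← hr, ← Category.assoc, w, Category.assoc]
  obtain ⟨c, hc⟩ := hq (f.f d)
  obtain ⟨c', hc'⟩ := hq (g.f d)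
  change f.f d = g.f d
  rw [← hc, ← hc']
  have b₀ := aux f _ h₀ _ h₁ d c hc.symm
  have b₁ := aux g _ rfl _ rfl d c' hc'.symm
  exact _root_.Quotient.sound (b₀.symm.trans b₁)

/-- A product of `A` and `B`: the coproduct of a representative set of small spans from `A` to `B`,
divided by bisimilarity. -/
lemma exists_isLimit (hF : IsBoundedEndofunctor F) (A B : SetF F) :
    ∃ P : Span A B, Nonempty (IsLimit (BinaryFan.mk P.left P.right)) := by
  obtain ⟨κ, hκ⟩ := hF
  let K : Type u := κ.out
  let ι : Type u := Σ (S : Set K) (st : (S : Type u) ⟶ F.obj S),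
    ((⟨S, st⟩ : SetF F) ⟶ A) × ((⟨S, st⟩ : SetF F) ⟶ B)
  let Z : ι → SetF F := fun k => ⟨k.1, k.2.1⟩
  obtain ⟨l, hl⟩ := (SetF.isSum_sigmaInj Z).exists_desc (fun k => k.2.2.1)
  obtain ⟨r, hr⟩ := (SetF.isSum_sigmaInj Z).exists_desc (fun k => k.2.2.2)
  obtain ⟨Q, q, hql, hqr, hQ⟩ := exists_quotient ⟨SetF.sigma Z, l, r⟩
  -- A small span is isomorphic to one of those from which `Q` is made.
  have small (D : Span A B) (hD : #D.apex.V ≤ κ) :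
      ∃ h : D.apex ⟶ Q.apex, h ≫ Q.left = D.left ∧ h ≫ Q.right = D.right := by
    rw [← mk_out κ] at hD
    obtain ⟨⟨φ, hφ⟩⟩ := hD
    let e : D.apex.V ≃ Set.range φ := Equiv.ofInjective φ hφ
    let st : (Set.range φ : Type u) ⟶ F.obj (Set.range φ) :=
      TypeCat.ofHom fun x => F.map (TypeCat.ofHom e) (D.apex.str (e.symm x))
    let D' : SetF F := ⟨Set.range φ, st⟩
    let a : D.apex ⟶ D' := SetF.homMk (B := D') e fun d => by
      change F.map (TypeCat.ofHom e) (D.apex.str (e.symm (e d))) = _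
      rw [e.symm_apply_apply]
    have : IsIso a := SetF.isIso_of_bijective a e.bijective
    let k : ι := ⟨Set.range φ, st, inv a ≫ D.left, inv a ≫ D.right⟩
    refine ⟨a ≫ SetF.sigmaInj Z k ≫ q, ?_, ?_⟩
    · rw [Category.assoc, Category.assoc, hql, hl k]
      exact IsIso.hom_inv_id_assoc a D.left
    · rw [Category.assoc, Category.assoc, hqr, hr k]
      exact IsIso.hom_inv_id_assoc a D.right
  have main (D : SetF F) (f : D ⟶ A) (g : D ⟶ B) :
      ∃ h : D ⟶ Q.apex, h ≫ Q.left = f ∧ h ≫ Q.right = g := by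
    choose S i hi hm hS using fun d => hκ D d
    choose s hs using hm
    choose h h₀ h₁ using fun d => small ⟨S d, i d ≫ f, i d ≫ g⟩ (hS d)
    obtain ⟨k, hk⟩ := SetF.exists_hom_of_local (T := D) (X := Q.apex)
      (fun d => (h d).f (s d)) (fun d => ⟨S d, i d, s d, h d, hs d, fun s' => by
        obtain ⟨R, a, b, w, hR, -⟩ := SetF.exists_weakPullback (i ((i d).f s')) (i d)
        obtain ⟨t, ht, rfl⟩ := hR (s _) s' (hs _)
        have e : a ≫ h _ = b ≫ h d := hQ R _ _
          (by rw [Category.assoc, h₀, Category.assoc, h₀, ← Category.assoc, w, Category.assoc])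
          (by rw [Category.assoc, h₁, Category.assoc, h₁, ← Category.assoc, w, Category.assoc])
        change (h _).f (s _) = _
        rw [← ht, SetF.apply_eq e, SetF.comp_apply]⟩)
    refine ⟨k, SetF.hom_ext fun d => ?_, SetF.hom_ext fun d => ?_⟩
    · rw [SetF.comp_apply, hk, SetF.apply_eq (h₀ d), SetF.comp_apply, hs]
    · rw [SetF.comp_apply, hk, SetF.apply_eq (h₁ d), SetF.comp_apply, hs]
  choose h h₀ h₁ using main
  exact ⟨Q, ⟨BinaryFan.isLimitMk (fun t => h t.pt t.fst t.snd) (fun t => h₀ _ _ _)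
    (fun t => h₁ _ _ _) (fun t m e₀ e₁ => hQ _ _ _ (e₀.trans (h₀ _ _ _).symm)
      (e₁.trans (h₁ _ _ _).symm))⟩⟩

end Span

lemma hasBinaryProducts_setF [WeaklyPreservesPullbacks F] (hF : IsBoundedEndofunctor F) :
    HasBinaryProducts (SetF F) := by
  have (A B : SetF F) : HasLimit (pair A B) := by
    obtain ⟨P, ⟨hP⟩⟩ := Span.exists_isLimit hF A B
    exact ⟨⟨_, hP⟩⟩
  exact hasBinaryProducts_of_hasLimit_pair _

end Products

end IterCat

/-! ### Germs of homomorphisms -/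

namespace IterCat

variable {F : Type u ⥤ Type u}

/-- A coalgebra `T` with a chosen element `t`, at which germs are taken. -/
structure PointedCoalg (F : Type u ⥤ Type u) where
  coalg : SetF F
  pt : coalg.V

/-- A homomorphism into `X` from a subcoalgebra of `T` which contains `t`. -/
structure PreGerm (p : PointedCoalg F) (X : SetF F) where
  dom : SetF F
  incl : dom ⟶ p.coalg
  injective : Function.Injective incl.f
  base : dom.V
  incl_base : incl.f base = p.pt
  map : dom ⟶ X

namespace PreGerm

/-- Two local homomorphisms have the same germ if they agree on a smaller subcoalgebra which
contains `t`. -/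
def Rel {p : PointedCoalg F} {X : SetF F} (x y : PreGerm p X) : Prop :=
  ∃ (R : SetF F) (a : R ⟶ x.dom) (b : R ⟶ y.dom) (r : R.V), Function.Injective a.f ∧
    a ≫ x.incl = b ≫ y.incl ∧ a.f r = x.base ∧ a ≫ x.map = b ≫ y.map

variable {p : PointedCoalg F} {X : SetF F}

lemma injective_id (A : SetF F) : Function.Injective (𝟙 A : A ⟶ A).f := fun _ _ h => h

lemma injective_comp {A B D : SetF F} {f : A ⟶ B} {g : B ⟶ D} (hf : Function.Injective f.f)
    (hg : Function.Injective g.f) : Function.Injective (f ≫ g).f :=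
  hg.comp hf

lemma injective_of_comp {A B D : SetF F} {f : A ⟶ B} {g : B ⟶ D}
    (h : Function.Injective (f ≫ g).f) : Function.Injective f.f :=
  fun _ _ e => h (congrArg g.f e)

lemma Rel.refl (x : PreGerm p X) : x.Rel x :=
  ⟨x.dom, 𝟙 _, 𝟙 _, x.base, injective_id _, rfl, rfl, rfl⟩

lemma Rel.symm {x y : PreGerm p X} (h : x.Rel y) : y.Rel x := by
  obtain ⟨R, a, b, r, ha, h₀, h₁, h₂⟩ := h
  have hb : Function.Injective (b ≫ y.incl).f := h₀ ▸ injective_comp ha x.injective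
  refine ⟨R, b, a, r, injective_of_comp hb, h₀.symm, y.injective ?_, h₂.symm⟩
  rw [← SetF.comp_apply, ← h₀, SetF.comp_apply, h₁, x.incl_base, y.incl_base]

lemma Rel.trans [WeaklyPreservesPullbacks F] {x y z : PreGerm p X} (h : x.Rel y)
    (k : y.Rel z) : x.Rel z := by
  obtain ⟨R, a, b, r, ha, h₀, h₁, h₂⟩ := h
  obtain ⟨S, c, d, s, hc, k₀, k₁, k₂⟩ := k
  have : Mono c := SetF.mono_of_injective c hc
  obtain ⟨P, f, g, sq, hg, hP⟩ := SetF.exists_isPullback c b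
  have hb : b.f r = y.base := y.injective (by
    rw [← SetF.comp_apply, ← h₀, SetF.comp_apply, h₁, x.incl_base, y.incl_base])
  obtain ⟨q, hq, hq'⟩ := hP s r (k₁.trans hb.symm)
  refine ⟨P, g ≫ a, f ≫ d, q, injective_comp hg ha, ?_, ?_, ?_⟩
  · rw [Category.assoc, h₀, Category.assoc, ← k₀, ← Category.assoc, ← sq.w, Category.assoc]
  · rw [SetF.comp_apply, hq', h₁]
  · rw [Category.assoc, h₂, Category.assoc, ← k₂, ← Category.assoc, ← sq.w, Category.assoc]

variable (p X) in
/-- Local homomorphisms with the same germ, as a setoid. -/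
def setoid [WeaklyPreservesPullbacks F] : Setoid (PreGerm p X) where
  r := Rel
  iseqv := ⟨Rel.refl, Rel.symm, Rel.trans⟩

end PreGerm

variable [WeaklyPreservesPullbacks F]

/-- The germs at `t` of homomorphisms from subcoalgebras of `T` into `X`. -/
def Germ (p : PointedCoalg F) (X : SetF F) : Type (u + 1) :=
  _root_.Quotient (PreGerm.setoid p X)

namespace Germ

variable {p : PointedCoalg F}

/-- The germ of a homomorphism defined on a subcoalgebra `S` of `T`, at a point `s` of `S`. -/
def mk {X S : SetF F} (i : S ⟶ p.coalg) (hi : Function.Injective i.f) (s : S.V)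
    (hs : i.f s = p.pt) (f : S ⟶ X) : Germ p X :=
  _root_.Quotient.mk _ ⟨S, i, hi, s, hs, f⟩

lemma exists_rep {X : SetF F} (x : Germ p X) :
    ∃ (S : SetF F) (i : S ⟶ p.coalg) (hi : Function.Injective i.f) (s : S.V) (hs : i.f s = p.pt)
      (f : S ⟶ X), x = mk i hi s hs f := by
  induction x using _root_.Quotient.ind with
  | _ x => exact ⟨x.dom, x.incl, x.injective, x.base, x.incl_base, x.map, rfl⟩

lemma mk_restrict {X S R : SetF F} (i : S ⟶ p.coalg) (hi : Function.Injective i.f) (s : S.V)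
    (hs : i.f s = p.pt) (f : S ⟶ X) (a : R ⟶ S) (ha : Function.Injective a.f) (r : R.V)
    (hr : a.f r = s) :
    mk i hi s hs f = mk (a ≫ i) (PreGerm.injective_comp ha hi) r
      (by rw [SetF.comp_apply, hr, hs]) (a ≫ f) :=
  _root_.Quotient.sound ⟨R, a, 𝟙 _, r, ha, (Category.id_comp _).symm, hr,
    (Category.id_comp _).symm⟩

lemma exists_rep₂ {X Y : SetF F} (x : Germ p X) (y : Germ p Y) :
    ∃ (S : SetF F) (i : S ⟶ p.coalg) (hi : Function.Injective i.f) (s : S.V) (hs : i.f s = p.pt)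
      (f : S ⟶ X) (g : S ⟶ Y), x = mk i hi s hs f ∧ y = mk i hi s hs g := by
  obtain ⟨S, i, hi, s, hs, f, rfl⟩ := x.exists_rep
  obtain ⟨S', i', hi', s', hs', f', rfl⟩ := y.exists_rep
  have : Mono i := SetF.mono_of_injective i hi
  obtain ⟨K, a, b, sq, hb, hK⟩ := SetF.exists_isPullback i i'
  obtain ⟨k, hk, hk'⟩ := hK s s' (hs.trans hs'.symm)
  have ha : Function.Injective a.f := by
    have : Function.Injective (a ≫ i).f := sq.w ▸ PreGerm.injective_comp hb hi'
    exact PreGerm.injective_of_comp this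
  refine ⟨K, a ≫ i, PreGerm.injective_comp ha hi, k, by rw [SetF.comp_apply, hk, hs], a ≫ f,
    b ≫ f', mk_restrict _ _ _ _ _ _ ha _ hk, ?_⟩
  rw [mk_restrict i' hi' s' hs' f' b hb k hk']
  congr 1
  exact sq.w.symm

lemma mk_eq_mk_iff {X S : SetF F} (i : S ⟶ p.coalg) (hi : Function.Injective i.f) (s : S.V)
    (hs : i.f s = p.pt) (f g : S ⟶ X) :
    mk i hi s hs f = mk i hi s hs g ↔ ∃ (R : SetF F) (a : R ⟶ S) (r : R.V),
      Function.Injective a.f ∧ a.f r = s ∧ a ≫ f = a ≫ g := by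
  constructor
  · intro h
    obtain ⟨R, a, b, r, ha, h₀, h₁, h₂⟩ := _root_.Quotient.exact h
    have : Mono i := SetF.mono_of_injective i hi
    obtain rfl : a = b := (cancel_mono i).1 h₀
    exact ⟨R, a, r, ha, h₁, h₂⟩
  · rintro ⟨R, a, r, ha, h₁, h₂⟩
    rw [mk_restrict i hi s hs f a ha r h₁, mk_restrict i hi s hs g a ha r h₁, h₂]

/-- The action of homomorphisms on germs, by composition. -/
def map {X Y : SetF F} (f : X ⟶ Y) : Germ p X → Germ p Y :=
  _root_.Quotient.map (fun x => ⟨x.dom, x.incl, x.injective, x.base, x.incl_base, x.map ≫ f⟩) (by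
    rintro x y ⟨R, a, b, r, ha, h₀, h₁, h₂⟩
    exact ⟨R, a, b, r, ha, h₀, h₁, by
      change a ≫ x.map ≫ f = b ≫ y.map ≫ f
      rw [← Category.assoc, h₂, Category.assoc]⟩)

@[simp]
lemma map_mk {X Y S : SetF F} (i : S ⟶ p.coalg) (hi : Function.Injective i.f) (s : S.V)
    (hs : i.f s = p.pt) (f : S ⟶ X) (g : X ⟶ Y) :
    map g (mk i hi s hs f) = mk i hi s hs (f ≫ g) := rfl

@[simp]
lemma map_id {X : SetF F} (x : Germ p X) : map (𝟙 X) x = x := by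
  obtain ⟨S, i, hi, s, hs, f, rfl⟩ := x.exists_rep
  rw [map_mk, Category.comp_id]

lemma map_comp {X Y Z : SetF F} (f : X ⟶ Y) (g : Y ⟶ Z) (x : Germ p X) :
    map (f ≫ g) x = map g (map f x) := by
  obtain ⟨S, i, hi, s, hs, f, rfl⟩ := x.exists_rep
  rw [map_mk, map_mk, map_mk, Category.assoc]

lemma map_injective_of_mono {X Y : SetF F} (f : X ⟶ Y) [Mono f] :
    Function.Injective (map f : Germ p X → Germ p Y) := by
  intro x y h
  obtain ⟨S, i, hi, s, hs, f, g, rfl, rfl⟩ := exists_rep₂ x y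
  rw [map_mk, map_mk, mk_eq_mk_iff] at h
  obtain ⟨R, a, r, ha, hr, e⟩ := h
  rw [← Category.assoc, ← Category.assoc, cancel_mono] at e
  exact (mk_eq_mk_iff _ _ _ _ _ _).2 ⟨R, a, r, ha, hr, e⟩

/-- Germs preserve pullbacks, as far as existence is concerned. -/
lemma exists_of_isPullback {P X Y Z : SetF F} {a : P ⟶ X} {b : P ⟶ Y} {f : X ⟶ Z} {g : Y ⟶ Z}
    (sq : IsPullback a b f g) (x : Germ p X) (y : Germ p Y) (h : map f x = map g y) :
    ∃ z : Germ p P, map a z = x ∧ map b z = y := by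
  obtain ⟨S, i, hi, s, hs, k, l, rfl, rfl⟩ := exists_rep₂ x y
  rw [map_mk, map_mk, mk_eq_mk_iff] at h
  obtain ⟨R, c, r, hc, hr, e⟩ := h
  rw [← Category.assoc, ← Category.assoc] at e
  refine ⟨mk (c ≫ i) (PreGerm.injective_comp hc hi) r (by rw [SetF.comp_apply, hr, hs])
    (sq.lift _ _ e), ?_, ?_⟩
  · rw [map_mk, sq.lift_fst, ← mk_restrict i hi s hs k c hc r hr]
  · rw [map_mk, sq.lift_snd, ← mk_restrict i hi s hs l c hc r hr]

section Product

variable {X Y P : SetF F} {π₀ : P ⟶ X} {π₁ : P ⟶ Y}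

lemma prod_ext (hP : IsLimit (BinaryFan.mk π₀ π₁)) {z w : Germ p P} (h₀ : map π₀ z = map π₀ w)
    (h₁ : map π₁ z = map π₁ w) : z = w := by
  obtain ⟨S, i, hi, s, hs, k, l, rfl, rfl⟩ := exists_rep₂ z w
  rw [map_mk, map_mk, mk_eq_mk_iff] at h₀
  obtain ⟨R, c, r, hc, hr, e⟩ := h₀
  rw [mk_restrict i hi s hs k c hc r hr, mk_restrict i hi s hs l c hc r hr, map_mk, map_mk,
    mk_eq_mk_iff] at h₁
  obtain ⟨R', c', r', hc', hr', e'⟩ := h₁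
  refine (mk_eq_mk_iff _ _ _ _ _ _).2 ⟨R', c' ≫ c, r', PreGerm.injective_comp hc' hc, by
    rw [SetF.comp_apply, hr', hr], BinaryFan.IsLimit.hom_ext hP ?_ ?_⟩
  · change ((c' ≫ c) ≫ k) ≫ π₀ = ((c' ≫ c) ≫ l) ≫ π₀
    simp only [Category.assoc, e]
  · change ((c' ≫ c) ≫ k) ≫ π₁ = ((c' ≫ c) ≫ l) ≫ π₁
    simpa only [Category.assoc] using e'

lemma exists_pair (hP : IsLimit (BinaryFan.mk π₀ π₁)) (x : Germ p X) (y : Germ p Y) :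
    ∃ z : Germ p P, map π₀ z = x ∧ map π₁ z = y := by
  obtain ⟨S, i, hi, s, hs, k, l, rfl, rfl⟩ := exists_rep₂ x y
  obtain ⟨g, h₀, h₁⟩ := BinaryFan.IsLimit.lift' hP k l
  refine ⟨mk i hi s hs g, ?_, ?_⟩
  · rw [map_mk]
    exact congrArg _ h₀
  · rw [map_mk]
    exact congrArg _ h₁

end Product

/-- Germs preserve coproducts. -/
lemma bijective_of_isSum {ι : Type*} {Z : ι → SetF F} {W : SetF F} {c : ∀ k, Z k ⟶ W}
    (hc : SetF.IsSum c) :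
    Function.Bijective fun x : (Σ k, Germ p (Z k)) => map (c x.1) x.2 := by
  constructor
  · rintro ⟨k, x⟩ ⟨k', y⟩ h
    obtain ⟨S, i, hi, s, hs, f, g, rfl, rfl⟩ := exists_rep₂ x y
    have h' := h
    simp only [map_mk, mk_eq_mk_iff] at h'
    obtain ⟨R, a, r, ha, hr, e⟩ := h'
    obtain rfl : k = k' := hc.index_eq (z := f.f (a.f r)) (z' := g.f (a.f r)) (by
      have := congrArg (fun l => l.f r) e
      exact this)
    have : Mono (c k) := SetF.mono_of_injective _ (hc.injective k)
    exact congrArg (Sigma.mk k) (map_injective_of_mono (c k) h)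
  · intro w
    obtain ⟨S, i, hi, s, hs, f, rfl⟩ := w.exists_rep
    obtain ⟨k, z, hz⟩ := hc.exists_eq (f.f s)
    have : Mono (c k) := SetF.mono_of_injective _ (hc.injective k)
    obtain ⟨K, a, b, sq, hb, hK⟩ := SetF.exists_isPullback (c k) f
    obtain ⟨r, -, hr⟩ := hK z s hz
    refine ⟨⟨k, mk (b ≫ i) (PreGerm.injective_comp hb hi) r (by rw [SetF.comp_apply, hr, hs]) a⟩,
      ?_⟩
    change map (c k) (mk _ _ _ _ _) = _
    rw [map_mk, sq.w, ← mk_restrict i hi s hs f b hb r hr]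

lemma isEmpty_empty : IsEmpty (Germ p (SetF.empty F)) := by
  refine ⟨fun x => ?_⟩
  obtain ⟨S, i, hi, s, hs, f, rfl⟩ := x.exists_rep
  exact PEmpty.elim (f.f s)

variable (p) in
/-- The germ at `t` of the identity of `T`. -/
def self : Germ p p.coalg :=
  mk (𝟙 p.coalg) (PreGerm.injective_id _) p.pt (SetF.id_apply _) (𝟙 p.coalg)

lemma map_self {X : SetF F} (f : p.coalg ⟶ X) :
    map f (self p) = mk (𝟙 p.coalg) (PreGerm.injective_id _) p.pt (SetF.id_apply _) f := by
  rw [self, map_mk, Category.id_comp]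

lemma exists_of_map_self_eq {X Y : SetF F} (f : p.coalg ⟶ X) (g : Y ⟶ X) (y : Germ p Y)
    (h : map f (self p) = map g y) :
    ∃ (R : SetF F) (i : R ⟶ p.coalg) (hi : Function.Injective i.f) (r : R.V) (hr : i.f r = p.pt)
      (k : R ⟶ Y), y = mk i hi r hr k ∧ i ≫ f = k ≫ g := by
  obtain ⟨S, i, hi, s, hs, k, rfl⟩ := y.exists_rep
  rw [map_self, map_mk, mk_restrict (𝟙 _) _ _ _ f i hi s hs] at h
  simp only [Category.comp_id] at h
  obtain ⟨R, a, r, ha, hr, e⟩ := (mk_eq_mk_iff _ _ _ _ _ _).1 h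
  exact ⟨R, a ≫ i, PreGerm.injective_comp ha hi, r, by rw [SetF.comp_apply, hr]; exact hs, a ≫ k,
    mk_restrict _ _ _ _ _ _ ha _ hr, by rw [Category.assoc, e, Category.assoc]⟩

/-- Germs are jointly faithful. -/
lemma hom_ext {X Y : SetF F} {f g : X ⟶ Y}
    (h : ∀ (p : PointedCoalg F) (x : Germ p X), map f x = map g x) : f = g :=
  SetF.hom_ext fun x => by
    obtain ⟨R, a, r, -, hr, e⟩ := (mk_eq_mk_iff _ _ _ _ _ _).1
      (((map_self (p := ⟨X, x⟩) f).symm.trans (h ⟨X, x⟩ (self ⟨X, x⟩))).trans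
        (map_self (p := ⟨X, x⟩) g))
    have := congrArg (fun l => l.f r) e
    change f.f (a.f r) = g.f (a.f r) at this
    rwa [hr] at this

lemma surjective_of_map_surjective {X Y : SetF F} (f : X ⟶ Y)
    (h : ∀ p : PointedCoalg F, Function.Surjective (map f : Germ p X → Germ p Y)) :
    Function.Surjective f.f := fun y => by
  obtain ⟨x, hx⟩ := h ⟨Y, y⟩ (self ⟨Y, y⟩)
  obtain ⟨R, i, -, r, hr, k, -, e⟩ := exists_of_map_self_eq (p := ⟨Y, y⟩) (𝟙 Y) f x
    (by rw [hx, map_id])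
  refine ⟨k.f r, ?_⟩
  rw [← SetF.comp_apply, ← e, Category.comp_id, hr]

/-- Germs jointly reflect isomorphisms. -/
lemma isIso_of_map_bijective {X Y : SetF F} (f : X ⟶ Y)
    (h : ∀ p : PointedCoalg F, Function.Bijective (map f : Germ p X → Germ p Y)) : IsIso f := by
  have : Mono f := ⟨fun k l e => hom_ext fun p x => (h p).1 (by
    rw [← map_comp, ← map_comp, e])⟩
  exact SetF.isIso_of_bijective f ⟨SetF.injective_of_mono f,
    surjective_of_map_surjective f fun p => (h p).2⟩

end Germ

end IterCat

/-! ### Partial morphisms as relations -/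

namespace IterCat

namespace Pfn

variable {F : Type u ⥤ Type u} [WeaklyPreservesPullbacks F]

/-- The total morphism `{1, g}`. -/
def ofHom {X Y : Pfn F} (g : X.obj ⟶ Y.obj) : X ⟶ Y := (PartialMaps.embedding _).map g

/-- The partial morphism `{m, φ}`. -/
def mk {X Y : Pfn F} {U : SetF F} (m : U ⟶ X.obj) [Mono m] (φ : U ⟶ Y.obj) : X ⟶ Y :=
  PartialMaps.Hom.mk m ‹Mono m› φ

lemma exists_rep {X Y : Pfn F} (f : X ⟶ Y) :
    ∃ (U : SetF F) (m : U ⟶ X.obj) (_ : Mono m) (φ : U ⟶ Y.obj), f = mk m φ :=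
  PartialMaps.Hom.exists_rep f

lemma ofHom_eq_mk {X Y : Pfn F} (g : X.obj ⟶ Y.obj) : ofHom g = mk (𝟙 X.obj) g := rfl

lemma ofHom_comp {X Y Z : Pfn F} (f : X.obj ⟶ Y.obj) (g : Y.obj ⟶ Z.obj) :
    (ofHom (f ≫ g) : X ⟶ Z) = ofHom (Y := Y) f ≫ ofHom g :=
  (PartialMaps.embedding _).map_comp f g

lemma ofHom_id (X : Pfn F) : (ofHom (𝟙 X.obj) : X ⟶ X) = 𝟙 X := rfl

instance isIso_ofHom {X Y : Pfn F} (g : X.obj ⟶ Y.obj) [IsIso g] : IsIso (ofHom g : X ⟶ Y) :=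
  inferInstanceAs (IsIso ((PartialMaps.embedding _).map g))

/-- The graph of `{m, φ}`, a relation between the underlying sets. -/
def graph {X Y : Pfn F} (f : X ⟶ Y) : X.obj.V → Y.obj.V → Prop :=
  _root_.Quotient.lift (fun f : PartialMap (MorphismProperty.monomorphisms (SetF F)) X.obj Y.obj =>
    fun x y => ∃ u, f.incl.f u = x ∧ f.map.f u = y) (by
    rintro f g ⟨θ, h₀, h₁⟩
    funext x y
    apply propext
    constructor
    · rintro ⟨u, rfl, rfl⟩
      exact ⟨θ.hom.f u, SetF.apply_eq h₀ u, SetF.apply_eq h₁ u⟩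
    · rintro ⟨u, rfl, rfl⟩
      exact ⟨θ.inv.f u, SetF.apply_eq ((Iso.inv_comp_eq θ).2 h₀.symm) u,
        SetF.apply_eq ((Iso.inv_comp_eq θ).2 h₁.symm) u⟩) f

/-- The relation between the germs in `X` and in `Y` induced by `{m, φ}`. -/
def rel (p : PointedCoalg F) {X Y : Pfn F} (f : X ⟶ Y) : Germ p X.obj → Germ p Y.obj → Prop :=
  _root_.Quotient.lift (fun f : PartialMap (MorphismProperty.monomorphisms (SetF F)) X.obj Y.obj =>
    fun x y => ∃ u, Germ.map f.incl u = x ∧ Germ.map f.map u = y) (by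
    rintro f g ⟨θ, h₀, h₁⟩
    funext x y
    apply propext
    constructor
    · rintro ⟨u, rfl, rfl⟩
      exact ⟨Germ.map θ.hom u, by rw [← Germ.map_comp, h₀], by rw [← Germ.map_comp, h₁]⟩
    · rintro ⟨u, rfl, rfl⟩
      exact ⟨Germ.map θ.inv u, by rw [← Germ.map_comp, (Iso.inv_comp_eq θ).2 h₀.symm],
        by rw [← Germ.map_comp, (Iso.inv_comp_eq θ).2 h₁.symm]⟩) f

section

variable {X Y Z : Pfn F}

lemma graph_mk {U : SetF F} (m : U ⟶ X.obj) [Mono m] (φ : U ⟶ Y.obj) (x : X.obj.V)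
    (y : Y.obj.V) : graph (mk m φ : X ⟶ Y) x y ↔ ∃ u, m.f u = x ∧ φ.f u = y := Iff.rfl

lemma mk_comp_mk {U V W : SetF F} (m : U ⟶ X.obj) [Mono m] (φ : U ⟶ Y.obj) (n : V ⟶ Y.obj)
    [Mono n] (ψ : V ⟶ Z.obj) {a : W ⟶ V} {b : W ⟶ U} (sq : IsPullback a b n φ) [Mono (b ≫ m)] :
    (mk m φ : X ⟶ Y) ≫ (mk n ψ : Y ⟶ Z) = mk (b ≫ m) (a ≫ ψ) :=
  PartialMaps.Hom.mk_comp_mk m _ φ n _ ψ sq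

lemma graph_comp (f : X ⟶ Y) (g : Y ⟶ Z) (x : X.obj.V) (z : Z.obj.V) :
    graph (f ≫ g) x z ↔ ∃ y, graph f x y ∧ graph g y z := by
  obtain ⟨U, m, hm, φ, rfl⟩ := exists_rep f
  obtain ⟨V, n, hn, ψ, rfl⟩ := exists_rep g
  obtain ⟨W, a, b, sq, hb, hW⟩ := SetF.exists_isPullback n φ
  have := SetF.mono_of_injective b hb
  rw [mk_comp_mk m φ n ψ sq, graph_mk]
  simp only [graph_mk]
  constructor
  · rintro ⟨w, rfl, rfl⟩
    exact ⟨φ.f (b.f w), ⟨_, rfl, rfl⟩, a.f w, SetF.apply_eq sq.w w, rfl⟩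
  · rintro ⟨y, ⟨u, rfl, rfl⟩, v, h, rfl⟩
    obtain ⟨w, rfl, rfl⟩ := hW v u h
    exact ⟨w, rfl, rfl⟩

lemma graph_unique {f : X ⟶ Y} {x : X.obj.V} {y y' : Y.obj.V} (h : graph f x y)
    (h' : graph f x y') : y = y' := by
  obtain ⟨U, m, hm, φ, rfl⟩ := exists_rep f
  obtain ⟨u, rfl, rfl⟩ := h
  obtain ⟨u', hu, rfl⟩ := h'
  rw [SetF.injective_of_mono m hu]

/-- A partial morphism is determined by its graph. -/
lemma graph_ext {f g : X ⟶ Y} (h : ∀ x y, graph f x y ↔ graph g x y) : f = g := by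
  obtain ⟨U, m, hm, φ, rfl⟩ := exists_rep f
  obtain ⟨V, n, hn, ψ, rfl⟩ := exists_rep g
  obtain ⟨a, ha⟩ := SetF.exists_lift n (SetF.injective_of_mono n) m fun u => by
    obtain ⟨v, hv, -⟩ := (h (m.f u) (φ.f u)).1 ⟨u, rfl, rfl⟩
    exact ⟨v, hv⟩
  obtain ⟨b, hb⟩ := SetF.exists_lift m (SetF.injective_of_mono m) n fun v => by
    obtain ⟨u, hu, -⟩ := (h (n.f v) (ψ.f v)).2 ⟨v, rfl, rfl⟩
    exact ⟨u, hu⟩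
  refine PartialMaps.Hom.mk_eq_mk ⟨a, b, ?_, ?_⟩ ha (SetF.hom_ext fun u => ?_)
  · rw [← cancel_mono m, Category.assoc, hb, ha, Category.id_comp]
  · rw [← cancel_mono n, Category.assoc, ha, hb, Category.id_comp]
  · refine graph_unique (f := (mk n ψ : X ⟶ Y)) (x := m.f u) ?_ ?_
    · exact ⟨a.f u, SetF.apply_eq ha u, rfl⟩
    · exact (h (m.f u) (φ.f u)).1 ⟨u, rfl, rfl⟩

variable {p : PointedCoalg F}

lemma rel_mk {U : SetF F} (m : U ⟶ X.obj) [Mono m] (φ : U ⟶ Y.obj) (x : Germ p X.obj)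
    (y : Germ p Y.obj) :
    rel p (mk m φ : X ⟶ Y) x y ↔ ∃ u, Germ.map m u = x ∧ Germ.map φ u = y := Iff.rfl

lemma rel_ofHom (g : X.obj ⟶ Y.obj) (x : Germ p X.obj) (y : Germ p Y.obj) :
    rel p (ofHom g : X ⟶ Y) x y ↔ Germ.map g x = y := by
  rw [ofHom_eq_mk, rel_mk]
  simp only [Germ.map_id, exists_eq_left]

lemma rel_id (x y : Germ p X.obj) : rel p (𝟙 X) x y ↔ x = y := by
  rw [← ofHom_id, rel_ofHom, Germ.map_id]

lemma rel_comp (f : X ⟶ Y) (g : Y ⟶ Z) (x : Germ p X.obj) (z : Germ p Z.obj) :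
    rel p (f ≫ g) x z ↔ ∃ y, rel p f x y ∧ rel p g y z := by
  obtain ⟨U, m, hm, φ, rfl⟩ := exists_rep f
  obtain ⟨V, n, hn, ψ, rfl⟩ := exists_rep g
  obtain ⟨W, a, b, sq, hb, -⟩ := SetF.exists_isPullback n φ
  have := SetF.mono_of_injective b hb
  rw [mk_comp_mk m φ n ψ sq, rel_mk]
  simp only [rel_mk]
  constructor
  · rintro ⟨w, rfl, rfl⟩
    refine ⟨Germ.map φ (Germ.map b w), ⟨_, (Germ.map_comp _ _ _).symm, rfl⟩, Germ.map a w, ?_,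
      (Germ.map_comp _ _ _).symm⟩
    rw [← Germ.map_comp, sq.w, Germ.map_comp]
  · rintro ⟨y, ⟨u, rfl, rfl⟩, v, h, rfl⟩
    obtain ⟨w, rfl, rfl⟩ := Germ.exists_of_isPullback sq v u h
    exact ⟨w, Germ.map_comp _ _ _, Germ.map_comp _ _ _⟩

lemma rel_unique {f : X ⟶ Y} {x : Germ p X.obj} {y y' : Germ p Y.obj} (h : rel p f x y)
    (h' : rel p f x y') : y = y' := by
  obtain ⟨U, m, hm, φ, rfl⟩ := exists_rep f
  obtain ⟨u, rfl, rfl⟩ := h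
  obtain ⟨u', hu, rfl⟩ := h'
  rw [Germ.map_injective_of_mono m hu]

/-- An inclusion of relations between germs gives one of graphs: at an element `m u` of the domain,
take the germ of the identity of the domain of `f` at `u`. -/
lemma graph_of_rel {f g : X ⟶ Y} (h : ∀ p x y, rel p f x y → rel p g x y) (x : X.obj.V)
    (y : Y.obj.V) (hf : graph f x y) : graph g x y := by
  obtain ⟨U, m, hm, φ, rfl⟩ := exists_rep f
  obtain ⟨V, n, hn, ψ, rfl⟩ := exists_rep g
  obtain ⟨u, rfl, rfl⟩ := hf
  obtain ⟨v, hv, hv'⟩ := h ⟨U, u⟩ _ _ ⟨Germ.self _, rfl, rfl⟩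
  obtain ⟨R, i, hi, r, hr, k, rfl, e⟩ := Germ.exists_of_map_self_eq m n v hv.symm
  rw [Germ.map_mk, Germ.map_self, Germ.mk_restrict (𝟙 _) _ _ _ φ i hi r hr] at hv'
  simp only [Category.comp_id] at hv'
  obtain ⟨R', a, r', -, hr', e'⟩ := (Germ.mk_eq_mk_iff _ _ _ _ _ _).1 hv'
  change i.f r = u at hr
  refine ⟨k.f r, ?_, ?_⟩
  · change n.f (k.f r) = m.f u
    rw [← SetF.comp_apply, ← e, SetF.comp_apply, hr]
  · have := congrArg (fun l => l.f r') e'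
    change ψ.f (k.f (a.f r')) = φ.f (i.f (a.f r')) at this
    rw [hr', hr] at this
    exact this

/-- A partial morphism is determined by the induced relations between germs. -/
lemma rel_ext {f g : X ⟶ Y} (h : ∀ p x y, rel p f x y ↔ rel p g x y) : f = g :=
  graph_ext fun x y => ⟨graph_of_rel (fun p x y => (h p x y).1) x y,
    graph_of_rel (fun p x y => (h p x y).2) x y⟩

lemma ofHom_injective : Function.Injective (ofHom : (X.obj ⟶ Y.obj) → (X ⟶ Y)) := by
  intro f g h
  refine Germ.hom_ext fun p x => ?_
  have h' := (rel_ofHom f x (Germ.map f x)).2 rfl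
  rw [h, rel_ofHom] at h'
  exact h'.symm

/-- A partial morphism defined on all germs is total. -/
lemma exists_eq_ofHom (f : X ⟶ Y) (h : ∀ p x, ∃ y, rel p f x y) : ∃ g, f = ofHom g := by
  obtain ⟨U, m, hm, φ, rfl⟩ := exists_rep f
  have : IsIso m := Germ.isIso_of_map_bijective m fun p =>
    ⟨Germ.map_injective_of_mono m, fun x => by
      obtain ⟨y, u, hu, -⟩ := h p x
      exact ⟨u, hu⟩⟩
  exact ⟨inv m ≫ φ, PartialMaps.Hom.mk_eq_mk (asIso m) (Category.comp_id _)
    (IsIso.hom_inv_id_assoc _ _)⟩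

end

/-- A partial morphism which induces bijections between germs is invertible. -/
lemma isIso_of_rel {X Y : Pfn F} (f : X ⟶ Y) (h : ∀ p x, ∃ y, rel p f x y)
    (h₀ : ∀ p y, ∃ x, rel p f x y)
    (h₁ : ∀ p x x' y, rel p f x y → rel p f x' y → x = x') : IsIso f := by
  obtain ⟨g, rfl⟩ := exists_eq_ofHom f h
  simp only [rel_ofHom] at h₀ h₁
  have : IsIso g := Germ.isIso_of_map_bijective g fun p =>
    ⟨fun x x' e => h₁ p x x' _ e rfl, h₀ p⟩
  infer_instance

/-! ### The near product -/

section NearProduct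

variable [HasBinaryProducts (SetF F)]

/-- `{m, φ} ⊠ {m', φ'} = {m × m', φ × φ'}` -/
noncomputable def boxMap {X X' Y Y' : Pfn F} (f : X ⟶ X') (g : Y ⟶ Y') :
    (PartialMaps.of (X.obj ⨯ Y.obj) : Pfn F) ⟶ PartialMaps.of (X'.obj ⨯ Y'.obj) :=
  _root_.Quotient.map₂ (fun f g =>
    { dom := f.dom ⨯ g.dom
      incl := Limits.prod.map f.incl g.incl
      incl_mem := by
        have : Mono f.incl := f.incl_mem
        have : Mono g.incl := g.incl_mem
        exact inferInstanceAs (Mono (Limits.prod.map f.incl g.incl))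
      map := Limits.prod.map f.map g.map }) (by
    rintro f f' ⟨θ, h₀, h₁⟩ g g' ⟨η, k₀, k₁⟩
    exact ⟨Limits.prod.mapIso θ η, by simp [h₀, k₀], by simp [h₁, k₁]⟩) f g

lemma rel_boxMap {p : PointedCoalg F} {X X' Y Y' : Pfn F} (f : X ⟶ X') (g : Y ⟶ Y')
    (z : Germ p (X.obj ⨯ Y.obj)) (w : Germ p (X'.obj ⨯ Y'.obj)) :
    rel p (boxMap f g) z w ↔ rel p f (Germ.map Limits.prod.fst z) (Germ.map Limits.prod.fst w) ∧
      rel p g (Germ.map Limits.prod.snd z) (Germ.map Limits.prod.snd w) := by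
  obtain ⟨U, m, hm, φ, rfl⟩ := exists_rep f
  obtain ⟨V, n, hn, ψ, rfl⟩ := exists_rep g
  change (∃ u, Germ.map (Limits.prod.map m n) u = z ∧ Germ.map (Limits.prod.map φ ψ) u = w) ↔ _
  rw [rel_mk, rel_mk]
  constructor
  · rintro ⟨u, rfl, rfl⟩
    refine ⟨⟨Germ.map Limits.prod.fst u, ?_, ?_⟩, Germ.map Limits.prod.snd u, ?_, ?_⟩ <;>
      rw [← Germ.map_comp, ← Germ.map_comp] <;> simp
  · rintro ⟨⟨u, h₀, h₁⟩, v, k₀, k₁⟩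
    obtain ⟨t, rfl, rfl⟩ := Germ.exists_pair (prodIsProd U V) u v
    refine ⟨t, Germ.prod_ext (prodIsProd _ _) ?_ ?_, Germ.prod_ext (prodIsProd _ _) ?_ ?_⟩
    · rw [← h₀, ← Germ.map_comp, ← Germ.map_comp, Limits.prod.map_fst]
    · rw [← k₀, ← Germ.map_comp, ← Germ.map_comp, Limits.prod.map_snd]
    · rw [← h₁, ← Germ.map_comp, ← Germ.map_comp, Limits.prod.map_fst]
    · rw [← k₁, ← Germ.map_comp, ← Germ.map_comp, Limits.prod.map_snd]

lemma boxMap_ofHom {X X' Y Y' : Pfn F} (f : X.obj ⟶ X'.obj) (g : Y.obj ⟶ Y'.obj) :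
    boxMap (ofHom f : X ⟶ X') (ofHom g : Y ⟶ Y') = ofHom (Limits.prod.map f g) := by
  refine rel_ext fun p z w => ?_
  rw [rel_boxMap, rel_ofHom, rel_ofHom, rel_ofHom, ← Germ.map_comp, ← Germ.map_comp]
  constructor
  · rintro ⟨h₀, h₁⟩
    exact Germ.prod_ext (prodIsProd _ _) (by rw [← h₀, ← Germ.map_comp, Limits.prod.map_fst])
      (by rw [← h₁, ← Germ.map_comp, Limits.prod.map_snd])
  · rintro rfl
    rw [← Germ.map_comp, ← Germ.map_comp, Limits.prod.map_fst, Limits.prod.map_snd]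
    exact ⟨rfl, rfl⟩

lemma boxMap_comp {X X' X'' Y Y' Y'' : Pfn F} (f : X ⟶ X') (f' : X' ⟶ X'') (g : Y ⟶ Y')
    (g' : Y' ⟶ Y'') : boxMap (f ≫ f') (g ≫ g') = boxMap f g ≫ boxMap f' g' := by
  refine rel_ext fun p z w => ?_
  simp only [rel_comp, rel_boxMap]
  constructor
  · rintro ⟨⟨a, h₀, h₁⟩, b, k₀, k₁⟩
    obtain ⟨t, rfl, rfl⟩ := Germ.exists_pair (prodIsProd _ _) a b
    exact ⟨t, ⟨h₀, k₀⟩, h₁, k₁⟩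
  · rintro ⟨t, ⟨h₀, k₀⟩, h₁, k₁⟩
    exact ⟨⟨_, h₀, h₁⟩, _, k₀, k₁⟩

lemma boxMap_diag {X Y : Pfn F} (f : X ⟶ Y) :
    f ≫ ofHom (Y := PartialMaps.of (Y.obj ⨯ Y.obj)) (Limits.diag Y.obj) =
      ofHom (Y := PartialMaps.of (X.obj ⨯ X.obj)) (Limits.diag X.obj) ≫ boxMap f f := by
  have key {A : SetF F} {p : PointedCoalg F} (z : Germ p A) :
      Germ.map Limits.prod.fst (Germ.map (Limits.diag A) z) = z ∧
        Germ.map Limits.prod.snd (Germ.map (Limits.diag A) z) = z := by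
    rw [← Germ.map_comp, ← Germ.map_comp, Limits.prod.lift_fst, Limits.prod.lift_snd,
      Germ.map_id]
    exact ⟨rfl, rfl⟩
  refine rel_ext fun p z w => ?_
  simp only [rel_comp, rel_boxMap, rel_ofHom]
  constructor
  · rintro ⟨y, hy, rfl⟩
    refine ⟨_, rfl, ?_⟩
    rw [(key y).1, (key y).2, (key z).1, (key z).2]
    exact ⟨hy, hy⟩
  · rintro ⟨y, rfl, hw⟩
    rw [(key z).1, (key z).2] at hw
    refine ⟨_, hw.1, Germ.prod_ext (prodIsProd _ _) (key _).1 ((key _).2.trans ?_)⟩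
    exact rel_unique hw.1 hw.2

variable (F) in
/-- The near product on `Pfn_F` which extends the product of `Set_F`. -/
noncomputable def boxData : BoxData (Pfn F) where
  box :=
    { obj := fun p => PartialMaps.of (p.1.obj ⨯ p.2.obj)
      map := fun f => boxMap f.1 f.2
      map_id := fun p =>
        (boxMap_ofHom (X := p.1) (X' := p.1) (Y := p.2) (Y' := p.2) (𝟙 _) (𝟙 _)).trans
          (congrArg ofHom Limits.prod.map_id_id)
      map_comp := fun f g => boxMap_comp f.1 g.1 f.2 g.2 }
  diag :=
    { app := fun X => ofHom (Limits.diag X.obj)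
      naturality := fun _ _ f => boxMap_diag f }
  proj₀ := fun _ => ofHom Limits.prod.fst
  proj₁ := fun _ => ofHom Limits.prod.snd

section

variable {p : PointedCoalg F} {X X' Y Y' Z W : Pfn F}

/-- The first component of a germ in `X ⊠ Y`. -/
noncomputable def fst (z : Germ p ((boxData F).ob X Y).obj) : Germ p X.obj :=
  Germ.map (Limits.prod.fst : X.obj ⨯ Y.obj ⟶ X.obj) z

/-- The second component of a germ in `X ⊠ Y`. -/
noncomputable def snd (z : Germ p ((boxData F).ob X Y).obj) : Germ p Y.obj :=
  Germ.map (Limits.prod.snd : X.obj ⨯ Y.obj ⟶ Y.obj) z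

/-- The germ in `X ⊠ Y` with given components. -/
noncomputable def pair (x : Germ p X.obj) (y : Germ p Y.obj) :
    Germ p ((boxData F).ob X Y).obj :=
  (Germ.exists_pair (prodIsProd X.obj Y.obj) x y).choose

@[simp]
lemma fst_pair (x : Germ p X.obj) (y : Germ p Y.obj) : fst (pair x y) = x :=
  (Germ.exists_pair (prodIsProd X.obj Y.obj) x y).choose_spec.1

@[simp]
lemma snd_pair (x : Germ p X.obj) (y : Germ p Y.obj) : snd (pair x y) = y :=
  (Germ.exists_pair (prodIsProd X.obj Y.obj) x y).choose_spec.2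

lemma ext_iff {z w : Germ p ((boxData F).ob X Y).obj} :
    z = w ↔ fst z = fst w ∧ snd z = snd w :=
  ⟨by rintro rfl; exact ⟨rfl, rfl⟩, fun h => Germ.prod_ext (prodIsProd X.obj Y.obj) h.1 h.2⟩

@[simp]
lemma pair_fst_snd (z : Germ p ((boxData F).ob X Y).obj) : pair (fst z) (snd z) = z :=
  ext_iff.2 ⟨fst_pair _ _, snd_pair _ _⟩

lemma exists_prod {Q : Germ p ((boxData F).ob X Y).obj → Prop} :
    (∃ z, Q z) ↔ ∃ x y, Q (pair x y) :=
  ⟨fun ⟨z, h⟩ => ⟨fst z, snd z, by rwa [pair_fst_snd]⟩, fun ⟨x, y, h⟩ => ⟨_, h⟩⟩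

lemma rel_mp (f : X ⟶ X') (g : Y ⟶ Y') (z : Germ p ((boxData F).ob X Y).obj)
    (w : Germ p ((boxData F).ob X' Y').obj) :
    rel p ((boxData F).mp f g) z w ↔ rel p f (fst z) (fst w) ∧ rel p g (snd z) (snd w) :=
  rel_boxMap f g z w

lemma rel_p₀ (z : Germ p ((boxData F).ob X Y).obj) (x : Germ p X.obj) :
    rel p ((boxData F).p₀ X Y) z x ↔ fst z = x := rel_ofHom _ _ _

lemma rel_p₁ (z : Germ p ((boxData F).ob X Y).obj) (y : Germ p Y.obj) :
    rel p ((boxData F).p₁ X Y) z y ↔ snd z = y := rel_ofHom _ _ _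

lemma rel_Δ (x : Germ p X.obj) (z : Germ p ((boxData F).ob X X).obj) :
    rel p ((boxData F).Δ X) x z ↔ x = fst z ∧ x = snd z := by
  refine (rel_ofHom _ _ _).trans (ext_iff.trans ?_)
  refine and_congr (Eq.congr_left ?_) (Eq.congr_left ?_)
  · refine (Germ.map_comp _ _ _).symm.trans ?_
    rw [Limits.prod.lift_fst, Germ.map_id]
  · refine (Germ.map_comp _ _ _).symm.trans ?_
    rw [Limits.prod.lift_snd, Germ.map_id]

lemma rel_lift (f : X ⟶ Y) (g : X ⟶ Z) (x : Germ p X.obj)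
    (w : Germ p ((boxData F).ob Y Z).obj) :
    rel p ((boxData F).lift f g) x w ↔ rel p f x (fst w) ∧ rel p g x (snd w) := by
  rw [BoxData.lift, rel_comp]
  simp only [rel_Δ, rel_mp, exists_prod, fst_pair, snd_pair]
  constructor
  · rintro ⟨_, _, ⟨rfl, rfl⟩, h⟩
    exact h
  · intro h
    exact ⟨x, x, ⟨rfl, rfl⟩, h⟩

lemma rel_ass (z : Germ p ((boxData F).ob ((boxData F).ob X Y) Z).obj)
    (w : Germ p ((boxData F).ob X ((boxData F).ob Y Z)).obj) :
    rel p ((boxData F).ass X Y Z) z w ↔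
      fst (fst z) = fst w ∧ snd (fst z) = fst (snd w) ∧ snd z = snd (snd w) := by
  simp only [BoxData.ass, rel_lift, rel_comp, rel_p₀, rel_p₁, exists_eq_left']

lemma rel_tr (z : Germ p ((boxData F).ob X Y).obj) (w : Germ p ((boxData F).ob Y X).obj) :
    rel p ((boxData F).tr X Y) z w ↔ snd z = fst w ∧ fst z = snd w := by
  simp only [BoxData.tr, rel_lift, rel_p₀, rel_p₁]

end

lemma boxData_isCoherent : (boxData F).IsCoherent where
  diag_p₀ X := rel_ext fun p x y => by
    simp only [rel_comp, rel_Δ, rel_p₀, rel_id, exists_prod, fst_pair, snd_pair]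
    grind
  diag_p₁ X := rel_ext fun p x y => by
    simp only [rel_comp, rel_Δ, rel_p₁, rel_id, exists_prod, fst_pair, snd_pair]
    grind
  diag_mp X Y := rel_ext fun p z w => by
    simp only [rel_comp, rel_Δ, rel_mp, rel_p₀, rel_p₁, rel_id, exists_prod, fst_pair, snd_pair,
      ext_iff]
    grind
  ass_natural f g h := rel_ext fun p z w => by
    simp only [rel_comp, rel_mp, rel_ass, exists_prod, fst_pair, snd_pair]
    grind
  ass_isIso X Y Z := by
    refine isIso_of_rel _ (fun p z => ?_) (fun p w => ?_) (fun p z z' w => ?_)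
    · simp only [rel_ass, exists_prod, fst_pair, snd_pair]
      exact ⟨_, _, _, rfl, rfl, rfl⟩
    · simp only [rel_ass, exists_prod, fst_pair, snd_pair]
      exact ⟨_, _, _, rfl, rfl, rfl⟩
    · simp only [rel_ass, ext_iff]
      grind
  tr_natural f g := rel_ext fun p z w => by
    simp only [rel_comp, rel_mp, rel_tr, exists_prod, fst_pair, snd_pair]
    grind
  tr_tr X Y := rel_ext fun p z w => by
    simp only [rel_comp, rel_tr, rel_id, exists_prod, fst_pair, snd_pair, ext_iff]
    grind
  pentagon W X Y Z := rel_ext fun p z w => by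
    simp only [rel_comp, rel_mp, rel_ass, rel_id, exists_prod, fst_pair, snd_pair,
      ext_iff]
    grind
  hexagon X Y Z := rel_ext fun p z w => by
    simp only [rel_comp, rel_mp, rel_ass, rel_tr, rel_id, exists_prod, fst_pair, snd_pair,
      ext_iff]
    grind

lemma exists_rel_of_projections {X Y : Pfn F} {g : X ⟶ Y} (hg : (boxData F).projections g)
    {p : PointedCoalg F} (x : Germ p X.obj) : ∃ y, rel p g x y := by
  induction hg with
  | id X => exact ⟨x, (rel_id _ _).2 rfl⟩
  | p₀ X Y => exact ⟨_, (rel_p₀ _ _).2 rfl⟩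
  | p₁ X Y => exact ⟨_, (rel_p₁ _ _).2 rfl⟩
  | comp f g _ _ hf hg =>
    obtain ⟨y, hy⟩ := hf x
    obtain ⟨z, hz⟩ := hg y
    exact ⟨z, (rel_comp _ _ _ _).2 ⟨y, hy, hz⟩⟩
  | box f g _ _ hf hg =>
    obtain ⟨y, hy⟩ := hf (fst x)
    obtain ⟨z, hz⟩ := hg (snd x)
    exact ⟨pair y z, (rel_mp _ _ _ _).2 (by rw [fst_pair, snd_pair]; exact ⟨hy, hz⟩)⟩

variable (F) in
/-- The `P`-category structure of `Pfn_F`. -/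
noncomputable def pCategory : PCategory (Pfn F) where
  toBoxData := boxData F
  isCoherent := boxData_isCoherent
  naturalizer_proj₀ {X X' Y Y'} f g hg := by
    change (boxData F).mp f g ≫ (boxData F).p₀ X' Y' = (boxData F).p₀ X Y ≫ f
    refine rel_ext fun p z w => ?_
    simp only [rel_comp, rel_mp, rel_p₀, exists_prod, fst_pair, snd_pair, exists_eq_left']
    constructor
    · rintro ⟨x, y, ⟨h, -⟩, rfl⟩
      exact h
    · intro h
      obtain ⟨y, hy⟩ := exists_rel_of_projections hg (snd z)
      exact ⟨w, y, ⟨h, hy⟩, rfl⟩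
  naturalizer_proj₁ {X X' Y Y'} f g hf := by
    change (boxData F).mp f g ≫ (boxData F).p₁ X' Y' = (boxData F).p₁ X Y ≫ g
    refine rel_ext fun p z w => ?_
    simp only [rel_comp, rel_mp, rel_p₁, exists_prod, fst_pair, snd_pair, exists_eq_left']
    constructor
    · rintro ⟨x, y, ⟨-, h⟩, rfl⟩
      exact h
    · intro h
      obtain ⟨x, hx⟩ := exists_rel_of_projections hf (fst z)
      exact ⟨x, w, ⟨hx, h⟩, rfl⟩

end NearProduct

end Pfn

end IterCat

/-! ### The coproduct -/

namespace IterCat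

namespace SetF

variable {F : Type u ⥤ Type u}

/-- The coproduct of two homomorphisms. -/
noncomputable def sumMap {A A' B B' : SetF F} (f : A ⟶ A') (g : B ⟶ B') :
    sum A B ⟶ sum A' B' :=
  sumDesc (f ≫ inl A' B') (g ≫ inr A' B')

lemma inl_sumMap {A A' B B' : SetF F} (f : A ⟶ A') (g : B ⟶ B') :
    inl A B ≫ sumMap f g = f ≫ inl A' B' := inl_sumDesc _ _

lemma inr_sumMap {A A' B B' : SetF F} (f : A ⟶ A') (g : B ⟶ B') :
    inr A B ≫ sumMap f g = g ≫ inr A' B' := inr_sumDesc _ _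

lemma sumMap_comp {A A' A'' B B' B'' : SetF F} (f : A ⟶ A') (f' : A' ⟶ A'') (g : B ⟶ B')
    (g' : B' ⟶ B'') : sumMap (f ≫ f') (g ≫ g') = sumMap f g ≫ sumMap f' g' :=
  sum_hom_ext (by rw [inl_sumMap, ← Category.assoc, inl_sumMap, Category.assoc, Category.assoc,
      inl_sumMap])
    (by rw [inr_sumMap, ← Category.assoc, inr_sumMap, Category.assoc, Category.assoc,
      inr_sumMap])

lemma sumMap_id (A B : SetF F) : sumMap (𝟙 A) (𝟙 B) = 𝟙 (sum A B) :=
  sum_hom_ext (by rw [inl_sumMap, Category.id_comp, Category.comp_id])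
    (by rw [inr_sumMap, Category.id_comp, Category.comp_id])

end SetF

namespace Germ

variable {F : Type u ⥤ Type u} [WeaklyPreservesPullbacks F] {p : PointedCoalg F} {A B : SetF F}

lemma sum_cases (z : Germ p (A.sum B)) :
    (∃ a, z = map (SetF.inl A B) a) ∨ ∃ b, z = map (SetF.inr A B) b := by
  obtain ⟨⟨_ | _, x⟩, rfl⟩ := (bijective_of_isSum (SetF.isSum_sumInj A B)).2 z
  · exact Or.inl ⟨x, rfl⟩
  · exact Or.inr ⟨x, rfl⟩

lemma inl_injective : Function.Injective (map (SetF.inl A B) : Germ p A → _) := by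
  intro a a' h
  have := @((bijective_of_isSum (p := p) (SetF.isSum_sumInj A B)).1
    (a₁ := ⟨false, a⟩) (a₂ := ⟨false, a'⟩) h)
  simpa using this

lemma inr_injective : Function.Injective (map (SetF.inr A B) : Germ p B → _) := by
  intro b b' h
  have := @((bijective_of_isSum (p := p) (SetF.isSum_sumInj A B)).1
    (a₁ := ⟨true, b⟩) (a₂ := ⟨true, b'⟩) h)
  simpa using this

lemma inl_ne_inr (a : Germ p A) (b : Germ p B) :
    map (SetF.inl A B) a ≠ map (SetF.inr A B) b := by
  intro h
  have := @((bijective_of_isSum (p := p) (SetF.isSum_sumInj A B)).1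
    (a₁ := ⟨false, a⟩) (a₂ := ⟨true, b⟩) h)
  simpa using congrArg Sigma.fst this

lemma map_sumMap_inl {A' B' : SetF F} (f : A ⟶ A') (g : B ⟶ B') (x : Germ p A) :
    map (SetF.sumMap f g) (map (SetF.inl A B) x) = map (SetF.inl A' B') (map f x) := by
  rw [← map_comp, SetF.inl_sumMap, map_comp]

lemma map_sumMap_inr {A' B' : SetF F} (f : A ⟶ A') (g : B ⟶ B') (x : Germ p B) :
    map (SetF.sumMap f g) (map (SetF.inr A B) x) = map (SetF.inr A' B') (map g x) := by
  rw [← map_comp, SetF.inr_sumMap, map_comp]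

lemma map_sumDesc_inl {X : SetF F} (f : A ⟶ X) (g : B ⟶ X) (x : Germ p A) :
    map (SetF.sumDesc f g) (map (SetF.inl A B) x) = map f x := by
  rw [← map_comp, SetF.inl_sumDesc]

lemma map_sumDesc_inr {X : SetF F} (f : A ⟶ X) (g : B ⟶ X) (x : Germ p B) :
    map (SetF.sumDesc f g) (map (SetF.inr A B) x) = map g x := by
  rw [← map_comp, SetF.inr_sumDesc]

end Germ

namespace SetF

variable {F : Type u ⥤ Type u} [WeaklyPreservesPullbacks F]

lemma mono_sumMap {A A' B B' : SetF F} (f : A ⟶ A') (g : B ⟶ B') [Mono f] [Mono g] :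
    Mono (sumMap f g) := by
  refine mono_of_injective _ ?_
  have h₀ (a : A.V) : (sumMap f g).f (Sum.inl a) = (Sum.inl (f.f a) : A'.V ⊕ B'.V) :=
    apply_eq (inl_sumMap f g) a
  have h₁ (b : B.V) : (sumMap f g).f (Sum.inr b) = (Sum.inr (g.f b) : A'.V ⊕ B'.V) :=
    apply_eq (inr_sumMap f g) b
  rintro (a | b) (a' | b') h
  · rw [h₀, h₀] at h
    exact congrArg Sum.inl (injective_of_mono f (Sum.inl_injective h))
  · rw [h₀, h₁] at h
    exact absurd h Sum.inl_ne_inr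
  · rw [h₁, h₀] at h
    exact absurd h Sum.inr_ne_inl
  · rw [h₁, h₁] at h
    exact congrArg Sum.inr (injective_of_mono g (Sum.inr_injective h))

end SetF

namespace Pfn

variable {F : Type u ⥤ Type u} [WeaklyPreservesPullbacks F]

/-- `{m, φ} ∐ {m', φ'} = {m ∐ m', φ ∐ φ'}` -/
noncomputable def sumMap {X X' Y Y' : Pfn F} (f : X ⟶ X') (g : Y ⟶ Y') :
    (PartialMaps.of (X.obj.sum Y.obj) : Pfn F) ⟶ PartialMaps.of (X'.obj.sum Y'.obj) :=
  _root_.Quotient.map₂ (fun f g =>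
    { dom := f.dom.sum g.dom
      incl := SetF.sumMap f.incl g.incl
      incl_mem := by
        have : Mono f.incl := f.incl_mem
        have : Mono g.incl := g.incl_mem
        exact SetF.mono_sumMap f.incl g.incl
      map := SetF.sumMap f.map g.map }) (by
    rintro f f' ⟨θ, h₀, h₁⟩ g g' ⟨η, k₀, k₁⟩
    refine ⟨⟨SetF.sumMap θ.hom η.hom, SetF.sumMap θ.inv η.inv, ?_, ?_⟩, ?_, ?_⟩
    · rw [← SetF.sumMap_comp, θ.hom_inv_id, η.hom_inv_id, SetF.sumMap_id]
    · rw [← SetF.sumMap_comp, θ.inv_hom_id, η.inv_hom_id, SetF.sumMap_id]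
    · rw [← SetF.sumMap_comp, h₀, k₀]
    · rw [← SetF.sumMap_comp, h₁, k₁]) f g

section

variable {p : PointedCoalg F} {X X' Y Y' : Pfn F}

lemma rel_sumMap_inl (f : X ⟶ X') (g : Y ⟶ Y') (x : Germ p X.obj)
    (w : Germ p (X'.obj.sum Y'.obj)) :
    rel p (sumMap f g) (Germ.map (SetF.inl X.obj Y.obj) x) w ↔
      ∃ x', rel p f x x' ∧ Germ.map (SetF.inl X'.obj Y'.obj) x' = w := by
  obtain ⟨U, m, hm, φ, rfl⟩ := exists_rep f
  obtain ⟨V, n, hn, ψ, rfl⟩ := exists_rep g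
  change (∃ u, Germ.map (SetF.sumMap m n) u = _ ∧ Germ.map (SetF.sumMap φ ψ) u = w) ↔ _
  simp only [rel_mk]
  constructor
  · rintro ⟨z, h₀, h₁⟩
    rcases z.sum_cases with ⟨u, rfl⟩ | ⟨v, rfl⟩
    · rw [← Germ.map_comp, SetF.inl_sumMap, Germ.map_comp] at h₀ h₁
      exact ⟨_, ⟨u, Germ.inl_injective h₀, rfl⟩, h₁⟩
    · rw [← Germ.map_comp, SetF.inr_sumMap, Germ.map_comp] at h₀
      exact absurd h₀.symm (Germ.inl_ne_inr _ _)
  · rintro ⟨_, ⟨u, rfl, rfl⟩, rfl⟩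
    refine ⟨Germ.map (SetF.inl U V) u, ?_, ?_⟩ <;>
      rw [← Germ.map_comp, SetF.inl_sumMap, Germ.map_comp]

lemma rel_sumMap_inr (f : X ⟶ X') (g : Y ⟶ Y') (y : Germ p Y.obj)
    (w : Germ p (X'.obj.sum Y'.obj)) :
    rel p (sumMap f g) (Germ.map (SetF.inr X.obj Y.obj) y) w ↔
      ∃ y', rel p g y y' ∧ Germ.map (SetF.inr X'.obj Y'.obj) y' = w := by
  obtain ⟨U, m, hm, φ, rfl⟩ := exists_rep f
  obtain ⟨V, n, hn, ψ, rfl⟩ := exists_rep g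
  change (∃ u, Germ.map (SetF.sumMap m n) u = _ ∧ Germ.map (SetF.sumMap φ ψ) u = w) ↔ _
  simp only [rel_mk]
  constructor
  · rintro ⟨z, h₀, h₁⟩
    rcases z.sum_cases with ⟨u, rfl⟩ | ⟨v, rfl⟩
    · rw [← Germ.map_comp, SetF.inl_sumMap, Germ.map_comp] at h₀
      exact absurd h₀ (Germ.inl_ne_inr _ _)
    · rw [← Germ.map_comp, SetF.inr_sumMap, Germ.map_comp] at h₀ h₁
      exact ⟨_, ⟨v, Germ.inr_injective h₀, rfl⟩, h₁⟩
  · rintro ⟨_, ⟨u, rfl, rfl⟩, rfl⟩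
    refine ⟨Germ.map (SetF.inr U V) u, ?_, ?_⟩ <;>
      rw [← Germ.map_comp, SetF.inr_sumMap, Germ.map_comp]

/-- Partial morphisms out of a coproduct agree if their relations do on both summands. -/
lemma rel_sum_ext {Z : Pfn F} {f g : (PartialMaps.of (X.obj.sum Y.obj) : Pfn F) ⟶ Z}
    (h₀ : ∀ p x z, rel p f (Germ.map (SetF.inl X.obj Y.obj) x) z ↔
      rel p g (Germ.map (SetF.inl X.obj Y.obj) x) z)
    (h₁ : ∀ p y z, rel p f (Germ.map (SetF.inr X.obj Y.obj) y) z ↔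
      rel p g (Germ.map (SetF.inr X.obj Y.obj) y) z) : f = g := by
  refine rel_ext fun p w z => ?_
  rcases Germ.sum_cases (A := X.obj) (B := Y.obj) w with ⟨x, rfl⟩ | ⟨y, rfl⟩
  · exact h₀ p x z
  · exact h₁ p y z

end

lemma sumMap_ofHom {X X' Y Y' : Pfn F} (f : X.obj ⟶ X'.obj) (g : Y.obj ⟶ Y'.obj) :
    sumMap (ofHom f : X ⟶ X') (ofHom g : Y ⟶ Y') = ofHom (SetF.sumMap f g) := by
  refine rel_sum_ext (fun p x w => ?_) (fun p x w => ?_)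
  · refine (rel_sumMap_inl _ _ _ _).trans (Iff.trans ?_ (rel_ofHom _ _ _).symm)
    simp only [rel_ofHom, exists_eq_left']
    exact Eq.congr_left (Germ.map_sumMap_inl f g x).symm
  · refine (rel_sumMap_inr _ _ _ _).trans (Iff.trans ?_ (rel_ofHom _ _ _).symm)
    simp only [rel_ofHom, exists_eq_left']
    exact Eq.congr_left (Germ.map_sumMap_inr f g x).symm

lemma sumMap_comp {X X' X'' Y Y' Y'' : Pfn F} (f : X ⟶ X') (f' : X' ⟶ X'') (g : Y ⟶ Y')
    (g' : Y' ⟶ Y'') : sumMap (f ≫ f') (g ≫ g') = sumMap f g ≫ sumMap f' g' := by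
  refine rel_sum_ext (fun p x w => ?_) (fun p x w => ?_)
  · simp only [rel_comp, rel_sumMap_inl]
    constructor
    · rintro ⟨z, ⟨y, h₀, h₁⟩, rfl⟩
      exact ⟨_, ⟨y, h₀, rfl⟩, (rel_sumMap_inl _ _ _ _).2 ⟨z, h₁, rfl⟩⟩
    · rintro ⟨_, ⟨y, h₀, rfl⟩, h⟩
      obtain ⟨z, h₁, rfl⟩ := (rel_sumMap_inl _ _ _ _).1 h
      exact ⟨z, ⟨y, h₀, h₁⟩, rfl⟩
  · simp only [rel_comp, rel_sumMap_inr]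
    constructor
    · rintro ⟨z, ⟨y, h₀, h₁⟩, rfl⟩
      exact ⟨_, ⟨y, h₀, rfl⟩, (rel_sumMap_inr _ _ _ _).2 ⟨z, h₁, rfl⟩⟩
    · rintro ⟨_, ⟨y, h₀, rfl⟩, h⟩
      obtain ⟨z, h₁, rfl⟩ := (rel_sumMap_inr _ _ _ _).1 h
      exact ⟨z, ⟨y, h₀, h₁⟩, rfl⟩

lemma sumMap_codiag {X Y : Pfn F} (f : X ⟶ Y) :
    sumMap f f ≫ ofHom (Y := Y) (SetF.sumDesc (𝟙 Y.obj) (𝟙 Y.obj)) =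
      ofHom (X := PartialMaps.of (X.obj.sum X.obj)) (Y := X)
        (SetF.sumDesc (𝟙 X.obj) (𝟙 X.obj)) ≫ f := by
  refine rel_sum_ext (fun p x w => ?_) (fun p x w => ?_)
  · simp only [rel_comp, rel_sumMap_inl, rel_ofHom, exists_eq_left']
    rw [← Germ.map_comp, SetF.inl_sumDesc, Germ.map_id]
    constructor
    · rintro ⟨_, ⟨y, h, rfl⟩, rfl⟩
      rwa [← Germ.map_comp, SetF.inl_sumDesc, Germ.map_id]
    · exact fun h => ⟨_, ⟨w, h, rfl⟩, by rw [← Germ.map_comp, SetF.inl_sumDesc, Germ.map_id]⟩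
  · simp only [rel_comp, rel_sumMap_inr, rel_ofHom, exists_eq_left']
    rw [← Germ.map_comp, SetF.inr_sumDesc, Germ.map_id]
    constructor
    · rintro ⟨_, ⟨y, h, rfl⟩, rfl⟩
      rwa [← Germ.map_comp, SetF.inr_sumDesc, Germ.map_id]
    · exact fun h => ⟨_, ⟨w, h, rfl⟩, by rw [← Germ.map_comp, SetF.inr_sumDesc, Germ.map_id]⟩

variable (F) in
/-- The coproduct on `Pfn_F`, that of `Set_F`. -/
noncomputable def coprodData : CoprodData (Pfn F) where
  cop :=
    { obj := fun p => PartialMaps.of (p.1.obj.sum p.2.obj)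
      map := fun f => sumMap f.1 f.2
      map_id := fun p =>
        (sumMap_ofHom (X := p.1) (X' := p.1) (Y := p.2) (Y' := p.2) (𝟙 _) (𝟙 _)).trans
          (congrArg ofHom (SetF.sumMap_id _ _))
      map_comp := fun f g => sumMap_comp f.1 g.1 f.2 g.2 }
  codiag :=
    { app := fun X => ofHom (SetF.sumDesc (𝟙 X.obj) (𝟙 X.obj))
      naturality := fun _ _ f => sumMap_codiag f }
  inj₀ :=
    { app := fun p => ofHom (SetF.inl p.1.obj p.2.obj)
      naturality := fun X Y f => rel_ext fun p x w => (rel_comp _ _ _ _).trans <| by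
        rw [rel_comp]
        simp only [rel_ofHom, exists_eq_left']
        exact (rel_sumMap_inl _ _ _ _).symm }
  inj₁ :=
    { app := fun p => ofHom (SetF.inr p.1.obj p.2.obj)
      naturality := fun X Y f => rel_ext fun p x w => (rel_comp _ _ _ _).trans <| by
        rw [rel_comp]
        simp only [rel_ofHom, exists_eq_left']
        exact (rel_sumMap_inr _ _ _ _).symm }

section

variable {p : PointedCoalg F} {X X' Y Y' Z W : Pfn F}

/-- The germ in `X ∐ Y` of a germ in `X`. -/
noncomputable def inl (x : Germ p X.obj) : Germ p ((coprodData F).cob X Y).obj :=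
  Germ.map (SetF.inl X.obj Y.obj) x

/-- The germ in `X ∐ Y` of a germ in `Y`. -/
noncomputable def inr (y : Germ p Y.obj) : Germ p ((coprodData F).cob X Y).obj :=
  Germ.map (SetF.inr X.obj Y.obj) y

lemma inl_inj {x x' : Germ p X.obj} :
    (inl x : Germ p ((coprodData F).cob X Y).obj) = inl x' ↔ x = x' := Germ.inl_injective.eq_iff

lemma inr_inj {y y' : Germ p Y.obj} :
    (inr y : Germ p ((coprodData F).cob X Y).obj) = inr y' ↔ y = y' := Germ.inr_injective.eq_iff

lemma inl_eq_inr {x : Germ p X.obj} {y : Germ p Y.obj} :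
    (inl x : Germ p ((coprodData F).cob X Y).obj) = inr y ↔ False :=
  iff_false_intro (Germ.inl_ne_inr x y)

lemma inr_eq_inl {x : Germ p X.obj} {y : Germ p Y.obj} :
    (inr y : Germ p ((coprodData F).cob X Y).obj) = inl x ↔ False :=
  iff_false_intro (Germ.inl_ne_inr x y).symm

lemma exists_cob {Q : Germ p ((coprodData F).cob X Y).obj → Prop} :
    (∃ z, Q z) ↔ (∃ x, Q (inl x)) ∨ ∃ y, Q (inr y) := by
  constructor
  · rintro ⟨z, h⟩
    rcases Germ.sum_cases (A := X.obj) (B := Y.obj) z with ⟨x, rfl⟩ | ⟨y, rfl⟩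
    · exact Or.inl ⟨x, h⟩
    · exact Or.inr ⟨y, h⟩
  · rintro (⟨x, h⟩ | ⟨y, h⟩)
    · exact ⟨_, h⟩
    · exact ⟨_, h⟩

lemma forall_cob {Q : Germ p ((coprodData F).cob X Y).obj → Prop} :
    (∀ z, Q z) ↔ (∀ x, Q (inl x)) ∧ ∀ y, Q (inr y) := by
  refine ⟨fun h => ⟨fun _ => h _, fun _ => h _⟩, fun h z => ?_⟩
  rcases Germ.sum_cases (A := X.obj) (B := Y.obj) z with ⟨x, rfl⟩ | ⟨y, rfl⟩
  · exact h.1 x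
  · exact h.2 y

lemma cob_ext {f g : (coprodData F).cob X Y ⟶ Z}
    (h₀ : ∀ p (x : Germ p X.obj) z, rel p f (inl x) z ↔ rel p g (inl x) z)
    (h₁ : ∀ p (y : Germ p Y.obj) z, rel p f (inr y) z ↔ rel p g (inr y) z) : f = g :=
  rel_sum_ext h₀ h₁

lemma rel_cmp_inl (f : X ⟶ X') (g : Y ⟶ Y') (x : Germ p X.obj)
    (w : Germ p ((coprodData F).cob X' Y').obj) :
    rel p ((coprodData F).cmp f g) (inl x) w ↔ ∃ x', rel p f x x' ∧ inl x' = w :=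
  rel_sumMap_inl f g x w

lemma rel_cmp_inr (f : X ⟶ X') (g : Y ⟶ Y') (y : Germ p Y.obj)
    (w : Germ p ((coprodData F).cob X' Y').obj) :
    rel p ((coprodData F).cmp f g) (inr y) w ↔ ∃ y', rel p g y y' ∧ inr y' = w :=
  rel_sumMap_inr f g y w

lemma rel_i₀ (x : Germ p X.obj) (w : Germ p ((coprodData F).cob X Y).obj) :
    rel p ((coprodData F).i₀ X Y) x w ↔ inl x = w := rel_ofHom _ _ _

lemma rel_i₁ (y : Germ p Y.obj) (w : Germ p ((coprodData F).cob X Y).obj) :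
    rel p ((coprodData F).i₁ X Y) y w ↔ inr y = w := rel_ofHom _ _ _

lemma rel_nabla_inl (x y : Germ p X.obj) :
    rel p ((coprodData F).nabla X) (inl x) y ↔ x = y := by
  refine (rel_ofHom _ _ _).trans (Eq.congr_left ?_)
  exact (Germ.map_sumDesc_inl _ _ _).trans (Germ.map_id x)

lemma rel_nabla_inr (x y : Germ p X.obj) :
    rel p ((coprodData F).nabla X) (inr x) y ↔ x = y := by
  refine (rel_ofHom _ _ _).trans (Eq.congr_left ?_)
  exact (Germ.map_sumDesc_inr _ _ _).trans (Germ.map_id x)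

lemma rel_desc_inl (f : X ⟶ Z) (g : Y ⟶ Z) (x : Germ p X.obj) (z : Germ p Z.obj) :
    rel p ((coprodData F).desc f g) (inl x) z ↔ rel p f x z := by
  rw [CoprodData.desc, rel_comp]
  simp only [rel_cmp_inl]
  constructor
  · rintro ⟨_, ⟨x', h, rfl⟩, h'⟩
    rwa [← (rel_nabla_inl _ _).1 h']
  · exact fun h => ⟨_, ⟨z, h, rfl⟩, (rel_nabla_inl _ _).2 rfl⟩

lemma rel_desc_inr (f : X ⟶ Z) (g : Y ⟶ Z) (y : Germ p Y.obj) (z : Germ p Z.obj) :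
    rel p ((coprodData F).desc f g) (inr y) z ↔ rel p g y z := by
  rw [CoprodData.desc, rel_comp]
  simp only [rel_cmp_inr]
  constructor
  · rintro ⟨_, ⟨x', h, rfl⟩, h'⟩
    rwa [← (rel_nabla_inr _ _).1 h']
  · exact fun h => ⟨_, ⟨z, h, rfl⟩, (rel_nabla_inr _ _).2 rfl⟩

lemma rel_cass_inl (x : Germ p X.obj)
    (w : Germ p ((coprodData F).cob ((coprodData F).cob X Y) Z).obj) :
    rel p ((coprodData F).cass X Y Z) (inl x) w ↔ inl (inl x) = w := by
  simp only [CoprodData.cass, rel_desc_inl, rel_comp, rel_i₀, exists_eq_left']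

lemma rel_cass_inr_inl (y : Germ p Y.obj)
    (w : Germ p ((coprodData F).cob ((coprodData F).cob X Y) Z).obj) :
    rel p ((coprodData F).cass X Y Z) (inr (inl y)) w ↔ inl (inr y) = w := by
  simp only [CoprodData.cass, rel_desc_inr, rel_desc_inl, rel_comp, rel_i₀, rel_i₁,
    exists_eq_left']

lemma rel_cass_inr_inr (z : Germ p Z.obj)
    (w : Germ p ((coprodData F).cob ((coprodData F).cob X Y) Z).obj) :
    rel p ((coprodData F).cass X Y Z) (inr (inr z)) w ↔ inr z = w := by
  simp only [CoprodData.cass, rel_desc_inr, rel_i₁]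

lemma rel_ctr_inl (x : Germ p X.obj) (w : Germ p ((coprodData F).cob Y X).obj) :
    rel p ((coprodData F).ctr X Y) (inl x) w ↔ inr x = w := by
  simp only [CoprodData.ctr, rel_desc_inl, rel_i₁]

lemma rel_ctr_inr (y : Germ p Y.obj) (w : Germ p ((coprodData F).cob Y X).obj) :
    rel p ((coprodData F).ctr X Y) (inr y) w ↔ inl y = w := by
  simp only [CoprodData.ctr, rel_desc_inr, rel_i₀]

end

lemma coprodData_isCoherent : (coprodData F).IsCoherent where
  i₀_nabla X := rel_ext fun p x y => by
    simp only [rel_comp, rel_i₀, exists_eq_left', rel_nabla_inl, rel_id]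
  i₁_nabla X := rel_ext fun p x y => by
    simp only [rel_comp, rel_i₁, exists_eq_left', rel_nabla_inr, rel_id]
  cmp_nabla X Y := cob_ext
    (fun p x w => (rel_desc_inl _ _ _ _).trans (by rw [rel_i₀, rel_id]))
    (fun p x w => (rel_desc_inr _ _ _ _).trans (by rw [rel_i₁, rel_id]))
  cass_natural f g h := by
    refine rel_ext fun p z w => ?_
    revert z
    simp only [forall_cob]
    simp only [rel_comp, rel_cmp_inl, rel_cmp_inr, rel_cass_inl, rel_cass_inr_inl,
      rel_cass_inr_inr, exists_cob, inl_inj, inr_inj, inl_eq_inr, inr_eq_inl, and_false, false_and,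
      exists_false, or_false, false_or, exists_eq_right, exists_eq_left']
    simp
  cass_isIso X Y Z := by
    refine isIso_of_rel _ (fun p => ?_) (fun p => ?_) (fun p => ?_)
    all_goals
      simp only [forall_cob, rel_cass_inl, rel_cass_inr_inl, rel_cass_inr_inr, exists_cob, inl_inj,
        inr_inj, inl_eq_inr, inr_eq_inl]
      simp
  ctr_natural f g := by
    refine rel_ext fun p z w => ?_
    revert z
    simp only [forall_cob]
    simp only [rel_comp, rel_cmp_inl, rel_cmp_inr, rel_ctr_inl, rel_ctr_inr, exists_cob, inl_inj,
      inr_inj, inl_eq_inr, inr_eq_inl, and_false, false_and,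
      exists_false, or_false, false_or, exists_eq_right, exists_eq_left']
    simp
  ctr_ctr X Y := by
    refine rel_ext fun p z w => ?_
    revert z
    simp only [forall_cob, rel_comp, rel_ctr_inl, rel_ctr_inr, exists_eq_left', rel_id]
    simp
  pentagon W X Y Z := by
    refine rel_ext fun p z w => ?_
    revert z
    simp only [forall_cob]
    simp only [rel_comp, rel_cmp_inl, rel_cmp_inr, rel_cass_inl, rel_cass_inr_inl,
      rel_cass_inr_inr, exists_eq_left', rel_id]
    simp
  hexagon X Y Z := by
    refine rel_ext fun p z w => ?_
    revert z
    simp only [forall_cob]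
    simp only [rel_comp, rel_cmp_inl, rel_cmp_inr, rel_cass_inl, rel_cass_inr_inl, rel_ctr_inl,
      rel_ctr_inr, rel_cass_inr_inr, exists_eq_left', rel_id]
    simp

lemma extendsCoproduct_coprodData : ExtendsCoproduct (coprodData F) := fun X Y =>
  ⟨SetF.inl X.obj Y.obj, SetF.inr X.obj Y.obj, SetF.nonempty_isColimit_sum _ _, rfl, rfl⟩

section PPlus

variable [HasBinaryProducts (SetF F)]

lemma isIso_undist (X Y Z : Pfn F) : IsIso (undist (boxData F) (coprodData F) X Y Z) := by
  have h₀ {p : PointedCoalg F} (z : Germ p ((boxData F).ob X Y).obj)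
      (w : Germ p ((boxData F).ob X ((coprodData F).cob Y Z)).obj) :
      rel p (undist (boxData F) (coprodData F) X Y Z) (inl z) w ↔
        fst z = fst w ∧ inl (snd z) = snd w := by
    rw [undist, rel_desc_inl, rel_mp, rel_id, rel_i₀]
  have h₁ {p : PointedCoalg F} (z : Germ p ((boxData F).ob X Z).obj)
      (w : Germ p ((boxData F).ob X ((coprodData F).cob Y Z)).obj) :
      rel p (undist (boxData F) (coprodData F) X Y Z) (inr z) w ↔
        fst z = fst w ∧ inr (snd z) = snd w := by
    rw [undist, rel_desc_inr, rel_mp, rel_id, rel_i₁]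
  refine isIso_of_rel _ (fun p => ?_) (fun p w => ?_) (fun p => ?_)
  · simp only [forall_cob]
    refine ⟨fun x => ⟨pair (fst x) (inl (snd x)), (h₀ _ _).2 ?_⟩,
      fun x => ⟨pair (fst x) (inr (snd x)), (h₁ _ _).2 ?_⟩⟩ <;> simp
  · have key (x) (y : Germ p ((coprodData F).cob Y Z).obj) :
        ∃ z, rel p (undist (boxData F) (coprodData F) X Y Z) z (pair x y) := by
      revert y
      rw [forall_cob]
      refine ⟨fun y => ⟨inl (pair x y), (h₀ _ _).2 ?_⟩,
        fun y => ⟨inr (pair x y), (h₁ _ _).2 ?_⟩⟩ <;> simp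
    rw [← pair_fst_snd w]
    exact key _ _
  · simp only [forall_cob]
    refine ⟨fun x => ⟨fun y w h h' => ?_, fun y w h h' => ?_⟩,
      fun x => ⟨fun y w h h' => ?_, fun y w h h' => ?_⟩⟩
    · rw [h₀] at h h'
      rw [inl_inj, ext_iff]
      exact ⟨h.1.trans h'.1.symm, inl_inj.1 (h.2.trans h'.2.symm)⟩
    · rw [h₀] at h
      rw [h₁] at h'
      exact (inl_eq_inr.1 (h.2.trans h'.2.symm)).elim
    · rw [h₁] at h
      rw [h₀] at h'
      exact (inl_eq_inr.1 (h'.2.trans h.2.symm)).elim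
    · rw [h₁] at h h'
      rw [inr_inj, ext_iff]
      exact ⟨h.1.trans h'.1.symm, inr_inj.1 (h.2.trans h'.2.symm)⟩

variable (F) in
/-- The `P⁺`-category structure of `Pfn_F`. -/
noncomputable def pPlusCategory : PPlusCategory (Pfn F) where
  toPCategory := pCategory F
  toCoprodData := coprodData F
  isCoherentCoprod := coprodData_isCoherent
  dist_isIso := isIso_undist

/-! ### Domains, ranges and choice -/

instance (A : SetF F) : Mono (SetF.emptyHom A) :=
  SetF.mono_of_injective _ fun x => x.elim

lemma isProdominical_pCategory : (pCategory F).IsProdominical := by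
  have h (X Y : Pfn F) (p : PointedCoalg F) (x : Germ p X.obj) (y : Germ p Y.obj) :
      rel p (mk (SetF.emptyHom X.obj) (SetF.emptyHom Y.obj) : X ⟶ Y) x y ↔ False := by
    rw [rel_mk, iff_false]
    rintro ⟨u, -⟩
    exact Germ.isEmpty_empty.false u
  refine ⟨fun X Y => mk (SetF.emptyHom X.obj) (SetF.emptyHom Y.obj), fun f g => ?_,
    fun φ D E => ?_⟩
  · refine rel_ext fun p x z => ?_
    simp only [rel_comp, h, false_and, exists_false, and_false]
  · refine rel_ext fun p x z => (rel_mp _ _ _ _).trans ?_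
    simp only [h, and_false]

lemma rel_dom {X Y : Pfn F} (φ : X ⟶ Y) (p : PointedCoalg F) (x x' : Germ p X.obj) :
    rel p ((pCategory F).dom φ) x x' ↔ x = x' ∧ ∃ y, rel p φ x y := by
  refine (rel_comp _ _ _ _).trans (Iff.trans (exists_congr fun w =>
    and_congr (rel_lift (𝟙 X) φ x w) (rel_p₀ w x')) ?_)
  constructor
  · rintro ⟨w, ⟨h₀, h₁⟩, rfl⟩
    exact ⟨(rel_id _ _).1 h₀, _, h₁⟩
  · rintro ⟨rfl, y, hy⟩
    refine ⟨pair x y, ⟨?_, ?_⟩, fst_pair _ _⟩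
    · rw [rel_id, fst_pair]
    · rwa [snd_pair]

lemma dom_mk {X Y : Pfn F} {U : SetF F} (m : U ⟶ X.obj) [Mono m] (φ : U ⟶ Y.obj) :
    (pCategory F).dom (mk m φ : X ⟶ Y) = mk m m := by
  refine rel_ext fun p x x' => ?_
  rw [rel_dom, rel_mk]
  simp only [rel_mk]
  constructor
  · rintro ⟨rfl, _, u, rfl, rfl⟩
    exact ⟨u, rfl, rfl⟩
  · rintro ⟨u, rfl, rfl⟩
    exact ⟨rfl, _, u, rfl, rfl⟩

lemma total_iff_exists {X Y : Pfn F} (f : X ⟶ Y) :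
    (pCategory F).total f ↔ ∃ g : X.obj ⟶ Y.obj, f = ofHom g := by
  constructor
  · intro h
    refine exists_eq_ofHom f fun p x => ?_
    have := (rel_dom f p x x).1 (by
      rw [show (pCategory F).dom f = 𝟙 X from h, rel_id])
    exact this.2
  · rintro ⟨g, rfl⟩
    refine rel_ext fun p x x' => ?_
    rw [rel_dom, rel_id]
    simp only [rel_ofHom, exists_eq', and_true]

/-- The image of the second component of a partial morphism, as a domain, is its range. -/
lemma exists_isRange {X Y : Pfn F} (φ : X ⟶ Y) :
    ∃ ε, (pCategory F).IsRange φ ε := by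
  obtain ⟨U, m, hm, φ, rfl⟩ := exists_rep φ
  obtain ⟨S, i, hi, h⟩ := SetF.exists_image φ
  have hε (y y' : Y.obj.V) : graph (mk i i : Y ⟶ Y) y y' ↔ y = y' ∧
      ∃ x, graph (mk m φ : X ⟶ Y) x y := by
    simp only [graph_mk]
    constructor
    · rintro ⟨s, rfl, rfl⟩
      obtain ⟨u, hu⟩ := (h (i.f s)).1 ⟨s, rfl⟩
      exact ⟨rfl, _, u, rfl, hu⟩
    · rintro ⟨rfl, _, u, rfl, rfl⟩
      obtain ⟨s, hs⟩ := (h (φ.f u)).2 ⟨u, rfl⟩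
      exact ⟨s, hs, hs⟩
  refine ⟨mk i i, ⟨Y, mk i i, (dom_mk i i).symm⟩, graph_ext fun x y => ?_,
    fun Z ψ ψ' e => graph_ext fun y z => ?_⟩
  · rw [graph_comp]
    constructor
    · rintro ⟨z, hz, hz'⟩
      rwa [((hε _ _).1 hz').1] at hz
    · exact fun hy => ⟨y, hy, (hε _ _).2 ⟨rfl, x, hy⟩⟩
  · have aux {ψ ψ' : Y ⟶ Z} (e : (mk m φ : X ⟶ Y) ≫ ψ = mk m φ ≫ ψ')
        (H : graph ((mk i i : Y ⟶ Y) ≫ ψ) y z) : graph ((mk i i : Y ⟶ Y) ≫ ψ') y z := by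
      obtain ⟨y', hy, hz⟩ := (graph_comp _ _ _ _).1 H
      obtain ⟨rfl, x, hx⟩ := (hε _ _).1 hy
      have := (graph_comp _ _ _ _).2 ⟨y, hx, hz⟩
      rw [e] at this
      obtain ⟨y', hx', hz'⟩ := (graph_comp _ _ _ _).1 this
      rw [graph_unique hx' hx] at hz'
      exact (graph_comp _ _ _ _).2 ⟨y, hy, hz'⟩
    exact ⟨aux e, aux e.symm⟩

/-- A partial monomorphism `{m, φ}` has a monomorphism `φ`, and its section is `{φ, m}`. -/
lemma weakChoice_pCategory : (pCategory F).WeakChoice := by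
  intro X Y φ hφ
  obtain ⟨U, m, hm, φ, rfl⟩ := exists_rep φ
  have : Mono φ := by
    refine ⟨fun {W} h k e => ?_⟩
    have aux (h : W ⟶ U) : (ofHom (h ≫ m) : PartialMaps.of W ⟶ X) ≫ (mk m φ : X ⟶ Y) =
        ofHom (h ≫ φ) := by
      refine rel_ext fun p x y => ?_
      simp only [rel_comp, rel_ofHom, exists_eq_left', rel_mk]
      rw [Germ.map_comp, Germ.map_comp]
      constructor
      · rintro ⟨u, hu, rfl⟩
        rw [Germ.map_injective_of_mono m hu]
      · rintro rfl
        exact ⟨_, rfl, rfl⟩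
    have aux' (h : W ⟶ U) : (ofHom (h ≫ m) : PartialMaps.of W ⟶ X) ≫
        (pCategory F).dom (mk m φ : X ⟶ Y) = ofHom (h ≫ m) := by
      rw [dom_mk]
      refine rel_ext fun p x y => ?_
      simp only [rel_comp, rel_ofHom, exists_eq_left', rel_mk]
      rw [Germ.map_comp]
      constructor
      · rintro ⟨u, hu, rfl⟩
        rw [hu]
      · rintro rfl
        exact ⟨_, rfl, rfl⟩
    have := hφ (ofHom (h ≫ m) : PartialMaps.of W ⟶ X) (ofHom (k ≫ m)) (by rw [aux, aux, e])
    rw [aux', aux'] at this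
    exact (cancel_mono m).1 (ofHom_injective this)
  refine ⟨mk φ m, ?_, ?_⟩
  · rw [dom_mk]
    refine rel_ext fun p y y' => ?_
    simp only [rel_comp, rel_mk]
    constructor
    · rintro ⟨_, ⟨u, rfl, rfl⟩, u', hu, rfl⟩
      exact ⟨u, rfl, by rw [Germ.map_injective_of_mono m hu]⟩
    · rintro ⟨u, rfl, rfl⟩
      exact ⟨_, ⟨u, rfl, rfl⟩, u, rfl, rfl⟩
  · refine rel_ext fun p x y => ?_
    simp only [rel_comp, rel_mk]
    constructor
    · rintro ⟨_, ⟨u, rfl, rfl⟩, _, ⟨v, hv, rfl⟩, w, hw, rfl⟩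
      exact ⟨u, rfl, by
        rw [← hv, Germ.map_injective_of_mono m hw]⟩
    · rintro ⟨u, rfl, rfl⟩
      exact ⟨_, ⟨u, rfl, rfl⟩, _, ⟨u, rfl, rfl⟩, u, rfl, rfl⟩

end PPlus

end Pfn

end IterCat

/-! ### Decomposition of words over two alphabets -/

namespace IterCat

/-- Nonempty lists, as pairs of a head and a tail. -/
abbrev NEList (α : Type*) := α × List α

/-- Nonempty words over the disjoint union of `α` and `β` that begin with a letter from `α`, divided
into maximal blocks: one block, or an even number, or an odd number of at least three blocks. -/
inductive BlockWord (α β : Type*)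
  | all (a : NEList α)
  | even (l : NEList (NEList α × NEList β))
  | odd (a : NEList α) (l : NEList (NEList β × NEList α))

namespace BlockWord

variable {α β γ : Type*}

/-- The image of a nonempty list. -/
def neMap (L : α → γ) (a : NEList α) : List γ := L a.1 :: a.2.map L

/-- The concatenation of pairs of blocks. -/
def blocks (L : α → γ) (R : β → γ) (l : NEList (NEList α × NEList β)) : List γ :=
  (l.1 :: l.2).flatMap fun q => neMap L q.1 ++ neMap R q.2

/-- The word with a given division into blocks. -/
def flatten (L : α → γ) (R : β → γ) : BlockWord α β → List γ
  | all a => neMap L a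
  | even l => blocks L R l
  | odd a l => neMap L a ++ blocks R L l

/-- The word with a given division into blocks, with first letter from either alphabet. -/
def flatten₂ (L : α → γ) (R : β → γ) : BlockWord α β ⊕ BlockWord β α → List γ :=
  Sum.elim (flatten L R) (flatten R L)

/-- Prefixing a letter from `α`. -/
def consLeft (x : α) : BlockWord α β ⊕ BlockWord β α → BlockWord α β
  | .inl (all a) => all (x, a.1 :: a.2)
  | .inl (even l) => even (((x, l.1.1.1 :: l.1.1.2), l.1.2), l.2)
  | .inl (odd a l) => odd (x, a.1 :: a.2) l
  | .inr (all b) => even (((x, []), b), [])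
  | .inr (even l) => odd (x, []) l
  | .inr (odd b l) => even (((x, []), b), l.1 :: l.2)

lemma flatten_consLeft (L : α → γ) (R : β → γ) (x : α) (w : BlockWord α β ⊕ BlockWord β α) :
    flatten L R (consLeft x w) = L x :: flatten₂ L R w := by
  rcases w with (⟨a⟩ | ⟨l⟩ | ⟨a, l⟩) | (⟨b⟩ | ⟨l⟩ | ⟨b, l⟩) <;>
    simp [consLeft, flatten, flatten₂, neMap, blocks]

lemma eq_all_or_eq_consLeft (w : BlockWord α β) :
    (∃ x, w = all (x, [])) ∨ ∃ x v, w = consLeft x v := by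
  rcases w with ⟨x, _ | ⟨y, xs⟩⟩ | ⟨⟨⟨x, _ | ⟨y, xs⟩⟩, b⟩, _ | ⟨q, t⟩⟩ | ⟨⟨x, _ | ⟨y, xs⟩⟩, l⟩
  · exact Or.inl ⟨x, rfl⟩
  · exact Or.inr ⟨x, .inl (all (y, xs)), rfl⟩
  · exact Or.inr ⟨x, .inr (all b), rfl⟩
  · exact Or.inr ⟨x, .inr (odd b (q, t)), rfl⟩
  · exact Or.inr ⟨x, .inl (even (((y, xs), b), [])), rfl⟩
  · exact Or.inr ⟨x, .inl (even (((y, xs), b), q :: t)), rfl⟩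
  · exact Or.inr ⟨x, .inr (even l), rfl⟩
  · exact Or.inr ⟨x, .inl (odd (y, xs) l), rfl⟩

lemma flatten_ne_nil (L : α → γ) (R : β → γ) (w : BlockWord α β) : flatten L R w ≠ [] := by
  rcases w with a | l | ⟨a, l⟩ <;> simp [flatten, neMap, blocks]

lemma flatten₂_ne_nil (L : α → γ) (R : β → γ) (w : BlockWord α β ⊕ BlockWord β α) :
    flatten₂ L R w ≠ [] := by
  rcases w with w | w
  · exact flatten_ne_nil L R w
  · exact flatten_ne_nil R L w

lemma flatten₂_swap (L : α → γ) (R : β → γ) (w : BlockWord α β ⊕ BlockWord β α) :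
    flatten₂ R L w.swap = flatten₂ L R w := by
  rcases w with w | w <;> rfl

/-- The first step of reading a word, with either alphabet first. -/
lemma flatten_eq_cons (L : α → γ) (R : β → γ) (w : BlockWord α β) :
    (∃ x, w = all (x, []) ∧ flatten L R w = [L x]) ∨
      ∃ x v, w = consLeft x v ∧ flatten L R w = L x :: flatten₂ L R v := by
  rcases eq_all_or_eq_consLeft w with ⟨x, rfl⟩ | ⟨x, v, rfl⟩
  · exact Or.inl ⟨x, rfl, rfl⟩
  · exact Or.inr ⟨x, v, rfl, flatten_consLeft L R x v⟩

lemma flatten_injective_of_lt {L : α → γ} {R : β → γ} (hL : Function.Injective L) (n : ℕ)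
    (ih : ∀ v v', (flatten₂ L R v).length < n → flatten₂ L R v = flatten₂ L R v' → v = v')
    (w w' : BlockWord α β) (hn : (flatten L R w).length < n + 1)
    (e : flatten L R w = flatten L R w') : w = w' := by
  rcases flatten_eq_cons L R w with ⟨x, rfl, hw⟩ | ⟨x, v, rfl, hw⟩ <;>
    rcases flatten_eq_cons L R w' with ⟨x', rfl, hw'⟩ | ⟨x', v', rfl, hw'⟩ <;>
    rw [hw] at hn <;> rw [hw, hw'] at e <;> rw [List.cons.injEq] at e
  · rw [hL e.1]
  · exact absurd e.2.symm (flatten₂_ne_nil L R v')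
  · exact absurd e.2 (flatten₂_ne_nil L R v)
  · rw [hL e.1, ih v v' (by simpa using hn) e.2]

/-- The division of a word into maximal blocks is unique. -/
lemma flatten₂_injective {L : α → γ} {R : β → γ} (hL : Function.Injective L)
    (hR : Function.Injective R) (h : ∀ a b, L a ≠ R b) :
    Function.Injective (flatten₂ L R) := by
  have main (n : ℕ) : ∀ v v', (flatten₂ L R v).length < n → flatten₂ L R v = flatten₂ L R v' →
      v = v' := by
    induction n with
    | zero => exact fun _ _ hn => absurd hn (Nat.not_lt_zero _)
    | succ n ih =>
      have ne (w : BlockWord α β) (w' : BlockWord β α) : flatten L R w ≠ flatten R L w' := by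
        intro e
        rcases flatten_eq_cons L R w with ⟨x, -, hw⟩ | ⟨x, v, -, hw⟩ <;>
          rcases flatten_eq_cons R L w' with ⟨x', -, hw'⟩ | ⟨x', v', -, hw'⟩ <;>
          rw [hw, hw', List.cons.injEq] at e <;> exact h _ _ e.1
      rintro (w | w) (w' | w') hn e
      · rw [flatten_injective_of_lt hL n ih w w' hn e]
      · exact absurd e (ne w w')
      · exact absurd e.symm (ne w' w)
      · refine congrArg Sum.inr (flatten_injective_of_lt hR n (fun v v' hv e => ?_) w w' hn e)
        rw [← flatten₂_swap] at hv
        rw [← flatten₂_swap, ← flatten₂_swap R L v'] at e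
        have := congrArg Sum.swap (ih _ _ hv e)
        simpa using this
  exact fun v v' e => main _ v v' (Nat.lt_succ_self _) e

/-- Every nonempty word can be divided into blocks. -/
lemma exists_flatten₂ (L : α → γ) (R : β → γ) (h : ∀ c, (∃ a, L a = c) ∨ ∃ b, R b = c)
    (l : List γ) (hl : l ≠ []) : ∃ w, flatten₂ L R w = l := by
  induction l with
  | nil => exact absurd rfl hl
  | cons c l ih =>
    by_cases hl' : l = []
    · subst hl'
      rcases h c with ⟨a, rfl⟩ | ⟨b, rfl⟩
      · exact ⟨.inl (all (a, [])), rfl⟩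
      · exact ⟨.inr (all (b, [])), rfl⟩
    · obtain ⟨w, rfl⟩ := ih hl'
      rcases h c with ⟨a, rfl⟩ | ⟨b, rfl⟩
      · exact ⟨.inl (consLeft a w), flatten_consLeft L R a w⟩
      · refine ⟨.inr (consLeft b w.swap), (flatten_consLeft R L b w.swap).trans ?_⟩
        rw [flatten₂_swap]

end BlockWord

end IterCat

/-! ### Free semigroups in a category with enough points -/

namespace IterCat

/-- A `B⁺`-category with countable coproducts and enough points: a family of set-valued functors
which preserve `×`, `∐` and the countable coproducts, are jointly faithful, and jointly reflect
isomorphisms. -/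
structure PointModel {D : Type u} [Category.{v} D] (B : BPlusCategory D) where
  /-- the points -/
  Pt : Type u'
  /-- the elements of an object at a point -/
  el : Pt → D → Type u'
  map : ∀ {i : Pt} {X Y : D}, (X ⟶ Y) → el i X → el i Y
  map_id : ∀ {i : Pt} {X : D} (x : el i X), map (𝟙 X) x = x
  map_comp : ∀ {i : Pt} {X Y Z : D} (f : X ⟶ Y) (g : Y ⟶ Z) (x : el i X),
    map (f ≫ g) x = map g (map f x)
  hom_ext : ∀ {X Y : D} {f g : X ⟶ Y}, (∀ i (x : el i X), map f x = map g x) → f = g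
  isIso : ∀ {X Y : D} (f : X ⟶ Y), (∀ i, Function.Bijective (map f : el i X → el i Y)) → IsIso f
  prod_bijective : ∀ (i : Pt) (X Y : D), Function.Bijective
    fun z : el i (B.ob X Y) => (map (B.p₀ X Y) z, map (B.p₁ X Y) z)
  cob_bijective : ∀ (i : Pt) (X Y : D), Function.Bijective
    (Sum.elim (map (B.i₀ X Y)) (map (B.i₁ X Y)) : el i X ⊕ el i Y → el i (B.cob X Y))
  sigma : (ℕ → D) → D
  inj : ∀ (Z : ℕ → D) (n : ℕ), Z n ⟶ sigma Z
  desc : ∀ {Z : ℕ → D} {W : D}, (∀ n, Z n ⟶ W) → (sigma Z ⟶ W)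
  inj_desc : ∀ {Z : ℕ → D} {W : D} (f : ∀ n, Z n ⟶ W) (n : ℕ), inj Z n ≫ desc f = f n
  sigma_bijective : ∀ (i : Pt) (Z : ℕ → D), Function.Bijective
    fun x : (Σ n, el i (Z n)) => map (inj Z x.1) x.2

namespace PointModel

variable {D : Type u} [Category.{v} D] {B : BPlusCategory D} (M : PointModel.{v, u, u'} B)

section Elements

variable {M} {i : M.Pt} {X X' Y Y' Z : D}

/-- The first component of an element of a product. -/
def fst (z : M.el i (B.ob X Y)) : M.el i X := M.map (B.p₀ X Y) z

/-- The second component of an element of a product. -/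
def snd (z : M.el i (B.ob X Y)) : M.el i Y := M.map (B.p₁ X Y) z

/-- The element of a product with given components. -/
noncomputable def pair (x : M.el i X) (y : M.el i Y) : M.el i (B.ob X Y) :=
  ((M.prod_bijective i X Y).2 (x, y)).choose

@[simp]
lemma fst_pair (x : M.el i X) (y : M.el i Y) : fst (pair x y) = x :=
  congrArg Prod.fst ((M.prod_bijective i X Y).2 (x, y)).choose_spec

@[simp]
lemma snd_pair (x : M.el i X) (y : M.el i Y) : snd (pair x y) = y :=
  congrArg Prod.snd ((M.prod_bijective i X Y).2 (x, y)).choose_spec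

lemma prod_ext {z w : M.el i (B.ob X Y)} (h₀ : fst z = fst w) (h₁ : snd z = snd w) : z = w :=
  (M.prod_bijective i X Y).1 (Prod.ext h₀ h₁)

@[simp]
lemma pair_fst_snd (z : M.el i (B.ob X Y)) : pair (fst z) (snd z) = z :=
  prod_ext (fst_pair _ _) (snd_pair _ _)

lemma exists_eq_pair (z : M.el i (B.ob X Y)) : ∃ x y, z = pair x y :=
  ⟨fst z, snd z, (pair_fst_snd z).symm⟩

lemma map_mp_pair (f : X ⟶ X') (g : Y ⟶ Y') (x : M.el i X) (y : M.el i Y) :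
    M.map (B.mp f g) (pair x y) = pair (M.map f x) (M.map g y) := by
  refine prod_ext ?_ ?_
  · rw [fst_pair, fst, ← M.map_comp, B.p₀_natural, M.map_comp]
    exact congrArg _ (fst_pair x y)
  · rw [snd_pair, snd, ← M.map_comp, B.p₁_natural, M.map_comp]
    exact congrArg _ (snd_pair x y)

lemma map_p₀_pair (x : M.el i X) (y : M.el i Y) : M.map (B.p₀ X Y) (pair x y) = x :=
  fst_pair x y

lemma map_p₁_pair (x : M.el i X) (y : M.el i Y) : M.map (B.p₁ X Y) (pair x y) = y :=
  snd_pair x y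

lemma map_Δ (x : M.el i X) : M.map (B.Δ X) x = pair x x := by
  refine prod_ext ?_ ?_
  · rw [fst_pair, fst, ← M.map_comp, B.isCoherent.diag_p₀, M.map_id]
  · rw [snd_pair, snd, ← M.map_comp, B.isCoherent.diag_p₁, M.map_id]

lemma map_lift (f : X ⟶ Y) (g : X ⟶ Z) (x : M.el i X) :
    M.map (B.lift f g) x = pair (M.map f x) (M.map g x) := by
  rw [BoxData.lift, M.map_comp, map_Δ, map_mp_pair]

lemma map_ass (x : M.el i X) (y : M.el i Y) (z : M.el i Z) :
    M.map (B.ass X Y Z) (pair (pair x y) z) = pair x (pair y z) := by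
  simp only [BoxData.ass, map_lift, M.map_comp, map_p₀_pair, map_p₁_pair]

/-- The element of a coproduct given by an element of the left summand. -/
def inl (x : M.el i X) : M.el i (B.cob X Y) := M.map (B.i₀ X Y) x

/-- The element of a coproduct given by an element of the right summand. -/
def inr (y : M.el i Y) : M.el i (B.cob X Y) := M.map (B.i₁ X Y) y

lemma inl_injective : Function.Injective (inl : M.el i X → M.el i (B.cob X Y)) :=
  fun x x' h => Sum.inl_injective
    ((M.cob_bijective i X Y).1 (a₁ := Sum.inl x) (a₂ := Sum.inl x') h)

lemma inr_injective : Function.Injective (inr : M.el i Y → M.el i (B.cob X Y)) :=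
  fun y y' h => Sum.inr_injective
    ((M.cob_bijective i X Y).1 (a₁ := Sum.inr y) (a₂ := Sum.inr y') h)

lemma inl_ne_inr (x : M.el i X) (y : M.el i Y) :
    (inl x : M.el i (B.cob X Y)) ≠ inr y := fun h =>
  Sum.inl_ne_inr ((M.cob_bijective i X Y).1 (a₁ := Sum.inl x) (a₂ := Sum.inr y) h)

lemma cob_cases (z : M.el i (B.cob X Y)) : (∃ x, inl x = z) ∨ ∃ y, inr y = z := by
  obtain ⟨x | y, h⟩ := (M.cob_bijective i X Y).2 z
  · exact Or.inl ⟨x, h⟩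
  · exact Or.inr ⟨y, h⟩

@[simp]
lemma map_desc_inl (f : X ⟶ Z) (g : Y ⟶ Z) (x : M.el i X) :
    M.map (B.desc f g) (inl x) = M.map f x := by
  rw [inl, ← M.map_comp, CoprodData.i₀_desc B.isCoherentCoprod]

@[simp]
lemma map_desc_inr (f : X ⟶ Z) (g : Y ⟶ Z) (y : M.el i Y) :
    M.map (B.desc f g) (inr y) = M.map g y := by
  rw [inr, ← M.map_comp, CoprodData.i₁_desc B.isCoherentCoprod]

lemma map_desc_inj {Z : ℕ → D} {W : D} (f : ∀ n, Z n ⟶ W) (n : ℕ) (x : M.el i (Z n)) :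
    M.map (M.desc f) (M.map (M.inj Z n) x) = M.map (f n) x := by
  rw [← M.map_comp, M.inj_desc]

lemma exists_eq_inj {Z : ℕ → D} (w : M.el i (M.sigma Z)) :
    ∃ (n : ℕ) (x : M.el i (Z n)), w = M.map (M.inj Z n) x := by
  obtain ⟨⟨n, x⟩, rfl⟩ := (M.sigma_bijective i Z).2 w
  exact ⟨n, x, rfl⟩

end Elements

/-! ### The underlying object of the free semigroup -/

section Words

variable {M} {i : M.Pt} {X Y : D}

/-- The list of the components of an element of a power. -/
def toList {X : D} : (n : ℕ) → M.el i (B.pow X n) → List (M.el i X)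
  | 0, x => [x]
  | n + 1, x => fst (X := X) (Y := B.pow X n) x :: toList n (snd (X := X) (Y := B.pow X n) x)

/-- The element of `X^{n+2}` with given first component in `X` and given rest in `X^{n+1}`. -/
noncomputable def consEl {n : ℕ} (x : M.el i X) (y : M.el i (B.pow X n)) :
    M.el i (B.pow X (n + 1)) :=
  (pair x y : M.el i (B.ob X (B.pow X n)))

lemma toList_consEl {n : ℕ} (x : M.el i X) (y : M.el i (B.pow X n)) :
    toList (n + 1) (consEl x y) = x :: toList n y :=
  congrArg₂ (fun a b => a :: toList n b) (fst_pair x y) (snd_pair x y)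

lemma exists_eq_consEl {n : ℕ} (z : M.el i (B.pow X (n + 1))) :
    ∃ (x : M.el i X) (y : M.el i (B.pow X n)), z = consEl x y :=
  exists_eq_pair (X := X) (Y := B.pow X n) z

lemma length_toList (n : ℕ) (x : M.el i (B.pow X n)) : (toList n x).length = n + 1 := by
  induction n with
  | zero => rfl
  | succ n ih => exact congrArg (· + 1) (ih _)

lemma toList_injective (n : ℕ) : Function.Injective (toList n : M.el i (B.pow X n) → _) := by
  induction n with
  | zero => exact fun x y h => List.singleton_injective h
  | succ n ih =>
    intro x y h
    obtain ⟨h₀, h₁⟩ := List.cons.inj h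
    exact prod_ext (X := X) (Y := B.pow X n) h₀ (ih h₁)

lemma exists_toList (x : M.el i X) (l : List (M.el i X)) :
    ∃ y : M.el i (B.pow X l.length), toList l.length y = x :: l := by
  induction l generalizing x with
  | nil => exact ⟨x, rfl⟩
  | cons y l ih =>
    obtain ⟨z, hz⟩ := ih y
    exact ⟨consEl x z, (toList_consEl x z).trans (by rw [hz])⟩

variable (M) in
/-- The object `X^#`, the coproduct of the powers `X^n` for `n ≥ 1`. -/
abbrev sh (X : D) : D := M.sigma (B.pow X)

/-- The nonempty word over the elements of `X` that corresponds to an element of `X^#`. -/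
noncomputable def word (w : M.el i (M.sh X)) : List (M.el i X) :=
  toList _ ((M.sigma_bijective i (B.pow X)).2 w).choose.2

lemma word_inj (n : ℕ) (x : M.el i (B.pow X n)) :
    word (M.map (M.inj (B.pow X) n) x : M.el i (M.sh X)) = toList n x := by
  have h := ((M.sigma_bijective i (B.pow X)).2 (M.map (M.inj (B.pow X) n) x)).choose_spec
  have h' := (M.sigma_bijective i (B.pow X)).1 (a₂ := ⟨n, x⟩) h
  rw [word]
  exact congrArg (fun y : (Σ n, M.el i (B.pow X n)) => toList y.1 y.2) h'

lemma word_injective : Function.Injective (word : M.el i (M.sh X) → _) := by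
  intro v w h
  obtain ⟨n, x, rfl⟩ := exists_eq_inj v
  obtain ⟨m, y, rfl⟩ := exists_eq_inj w
  have h' := (word_inj n x).symm.trans (h.trans (word_inj m y))
  obtain rfl : n = m := by
    have := congrArg List.length h'
    rw [length_toList, length_toList] at this
    exact Nat.succ.inj this
  rw [toList_injective n h']

lemma word_ne_nil (w : M.el i (M.sh X)) : word w ≠ [] := by
  obtain ⟨n, x, rfl⟩ := exists_eq_inj w
  intro h
  have := congrArg List.length ((word_inj n x).symm.trans h)
  rw [length_toList] at this
  exact Nat.succ_ne_zero n this

lemma exists_word (l : List (M.el i X)) (hl : l ≠ []) : ∃ w : M.el i (M.sh X), word w = l := by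
  obtain ⟨x, l, rfl⟩ := List.exists_cons_of_ne_nil hl
  obtain ⟨y, hy⟩ := exists_toList x l
  exact ⟨_, (word_inj _ y).trans hy⟩

lemma sh_hom_ext {A : D} {f g : A ⟶ M.sh X}
    (h : ∀ i (a : M.el i A), word (M.map f a) = word (M.map g a)) : f = g :=
  M.hom_ext fun i a => word_injective (h i a)

/-- A morphism into `X^#` is invertible if its values are all nonempty words, each once. -/
lemma isIso_of_word {A : D} (f : A ⟶ M.sh X)
    (h₀ : ∀ i (a a' : M.el i A), word (M.map f a) = word (M.map f a') → a = a')
    (h₁ : ∀ i (l : List (M.el i X)), l ≠ [] → ∃ a, word (M.map f a) = l) : IsIso f :=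
  M.isIso f fun i => ⟨fun a a' h => h₀ i a a' (congrArg word h), fun w => by
    obtain ⟨a, ha⟩ := h₁ i (word w) (word_ne_nil w)
    exact ⟨a, word_injective ha⟩⟩

end Words

/-! ### The operations of the free semigroup -/

/-- The `n`-th power of a morphism. -/
def powMap {X Y : D} (f : X ⟶ Y) : (n : ℕ) → (B.pow X n ⟶ B.pow Y n)
  | 0 => f
  | n + 1 => B.mp f (powMap f n)

/-- `f^#` -/
def shMap {X Y : D} (f : X ⟶ Y) : M.sh X ⟶ M.sh Y :=
  M.desc fun n => powMap f n ≫ M.inj (B.pow Y) n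

/-- `j : X ⟶ X^#` -/
def unit (X : D) : X ⟶ M.sh X := M.inj (B.pow X) 0

/-- The distributivity morphism `∐ (X × Z n) ⟶ X × ∐ Z n`. -/
def undistLeft (X : D) (Z : ℕ → D) : M.sigma (fun n => B.ob X (Z n)) ⟶ B.ob X (M.sigma Z) :=
  M.desc fun n => B.mp (𝟙 X) (M.inj Z n)

/-- The distributivity morphism `∐ (Z n × X) ⟶ ∐ Z n × X`. -/
def undistRight (X : D) (Z : ℕ → D) : M.sigma (fun n => B.ob (Z n) X) ⟶ B.ob (M.sigma Z) X :=
  M.desc fun n => B.mp (M.inj Z n) (𝟙 X)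

variable {M} in
lemma map_undistLeft {i : M.Pt} {X : D} {Z : ℕ → D} (n : ℕ) (x : M.el i X) (z : M.el i (Z n)) :
    M.map (M.undistLeft X Z) (M.map (M.inj (fun n => B.ob X (Z n)) n) (pair x z)) =
      pair x (M.map (M.inj Z n) z) := by
  rw [undistLeft, map_desc_inj, map_mp_pair, M.map_id]

variable {M} in
lemma map_undistRight {i : M.Pt} {X : D} {Z : ℕ → D} (n : ℕ) (x : M.el i X) (z : M.el i (Z n)) :
    M.map (M.undistRight X Z) (M.map (M.inj (fun n => B.ob (Z n) X) n) (pair z x)) =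
      pair (M.map (M.inj Z n) z) x := by
  rw [undistRight, map_desc_inj, map_mp_pair, M.map_id]

lemma index_eq_of_inj {i : M.Pt} {Z : ℕ → D} {n m : ℕ} {x : M.el i (Z n)} {y : M.el i (Z m)}
    (h : M.map (M.inj Z n) x = M.map (M.inj Z m) y) : (⟨n, x⟩ : Σ n, M.el i (Z n)) = ⟨m, y⟩ :=
  (M.sigma_bijective i Z).1 (a₁ := ⟨n, x⟩) (a₂ := ⟨m, y⟩) h

instance isIso_undistLeft (X : D) (Z : ℕ → D) : IsIso (M.undistLeft X Z) := by
  refine M.isIso _ fun i => ⟨fun v w h => ?_, fun w => ?_⟩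
  · obtain ⟨n, v, rfl⟩ := exists_eq_inj v
    obtain ⟨m, w, rfl⟩ := exists_eq_inj w
    obtain ⟨x, y, rfl⟩ := exists_eq_pair v
    obtain ⟨x', y', rfl⟩ := exists_eq_pair w
    rw [map_undistLeft, map_undistLeft] at h
    obtain rfl : x = x' := by simpa using congrArg fst h
    have h₁ := M.index_eq_of_inj (by simpa using congrArg snd h)
    obtain rfl : n = m := congrArg Sigma.fst h₁
    rw [eq_of_heq (Sigma.mk.inj h₁).2]
  · obtain ⟨x, y, rfl⟩ := exists_eq_pair w
    obtain ⟨n, z, rfl⟩ := exists_eq_inj y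
    exact ⟨_, map_undistLeft n x z⟩

instance isIso_undistRight (X : D) (Z : ℕ → D) : IsIso (M.undistRight X Z) := by
  refine M.isIso _ fun i => ⟨fun v w h => ?_, fun w => ?_⟩
  · obtain ⟨n, v, rfl⟩ := exists_eq_inj v
    obtain ⟨m, w, rfl⟩ := exists_eq_inj w
    obtain ⟨x, y, rfl⟩ := exists_eq_pair v
    obtain ⟨x', y', rfl⟩ := exists_eq_pair w
    rw [map_undistRight, map_undistRight] at h
    obtain rfl : y = y' := by simpa using congrArg snd h
    have h₁ := M.index_eq_of_inj (by simpa using congrArg fst h)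
    obtain rfl : n = m := congrArg Sigma.fst h₁
    rw [eq_of_heq (Sigma.mk.inj h₁).2]
  · obtain ⟨x, y, rfl⟩ := exists_eq_pair w
    obtain ⟨n, z, rfl⟩ := exists_eq_inj x
    exact ⟨_, map_undistRight n y z⟩

/-- The morphism out of `X × ∐ Z n` with given components. -/
noncomputable def descLeft {X W : D} {Z : ℕ → D} (f : ∀ n, B.ob X (Z n) ⟶ W) :
    B.ob X (M.sigma Z) ⟶ W :=
  inv (M.undistLeft X Z) ≫ M.desc f

/-- The morphism out of `∐ Z n × X` with given components. -/
noncomputable def descRight {X W : D} {Z : ℕ → D} (f : ∀ n, B.ob (Z n) X ⟶ W) :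
    B.ob (M.sigma Z) X ⟶ W :=
  inv (M.undistRight X Z) ≫ M.desc f

section

variable {M} {i : M.Pt} {X Y W : D}

lemma map_descLeft {Z : ℕ → D} (f : ∀ n, B.ob X (Z n) ⟶ W) (n : ℕ) (x : M.el i X)
    (z : M.el i (Z n)) :
    M.map (M.descLeft f) (pair x (M.map (M.inj Z n) z)) = M.map (f n) (pair x z) := by
  rw [← map_undistLeft, descLeft, ← M.map_comp, IsIso.hom_inv_id_assoc, map_desc_inj]

lemma map_descRight {Z : ℕ → D} (f : ∀ n, B.ob (Z n) X ⟶ W) (n : ℕ) (x : M.el i X)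
    (z : M.el i (Z n)) :
    M.map (M.descRight f) (pair (M.map (M.inj Z n) z) x) = M.map (f n) (pair z x) := by
  rw [← map_undistRight, descRight, ← M.map_comp, IsIso.hom_inv_id_assoc, map_desc_inj]

end

/-- Prefixing a letter to a word. -/
noncomputable def cons (X : D) : B.ob X (M.sh X) ⟶ M.sh X :=
  M.descLeft fun n => M.inj (B.pow X) (n + 1)

/-- Prefixing `n + 1` letters to a word. -/
noncomputable def prepend (X : D) : (n : ℕ) → (B.ob (B.pow X n) (M.sh X) ⟶ M.sh X)
  | 0 => M.cons X
  | n + 1 => B.ass X (B.pow X n) (M.sh X) ≫ B.mp (𝟙 X) (prepend X n) ≫ M.cons X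

/-- The multiplication `m : X^# × X^# ⟶ X^#`, concatenation of words. -/
noncomputable def mul (X : D) : B.ob (M.sh X) (M.sh X) ⟶ M.sh X :=
  M.descRight (M.prepend X)

/-- The product of `n + 1` words. -/
noncomputable def mulPow (X : D) : (n : ℕ) → (B.pow (M.sh X) n ⟶ M.sh X)
  | 0 => 𝟙 (M.sh X)
  | n + 1 => B.mp (𝟙 (M.sh X)) (mulPow X n) ≫ M.mul X

/-- The multiplication `e : X^{##} ⟶ X^#` of the monad, flattening of words of words. -/
noncomputable def join (X : D) : M.sh (M.sh X) ⟶ M.sh X := M.desc (M.mulPow X)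

/-- Pairing an element of `X` with each component of an element of a power of `Y`. -/
def parPow (X Y : D) : (n : ℕ) → (B.ob X (B.pow Y n) ⟶ B.pow (B.ob X Y) n)
  | 0 => 𝟙 (B.ob X Y)
  | n + 1 => B.lift (B.mp (𝟙 X) (B.p₀ Y (B.pow Y n)))
      (B.mp (𝟙 X) (B.p₁ Y (B.pow Y n)) ≫ parPow X Y n)

/-- `par : X × Y^# ⟶ (X × Y)^#` -/
noncomputable def par (X Y : D) : B.ob X (M.sh Y) ⟶ M.sh (B.ob X Y) :=
  M.descLeft fun n => parPow X Y n ≫ M.inj (B.pow (B.ob X Y)) n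

section

variable {M} {i : M.Pt} {X Y : D}

lemma map_mp_comp {X Y Z W : D} (f : Y ⟶ Z) (g : B.ob X Z ⟶ W) (x : M.el i X) (y : M.el i Y) :
    M.map (B.mp (𝟙 X) f ≫ g) (pair x y) = M.map g (pair x (M.map f y)) := by
  rw [M.map_comp, map_mp_pair, M.map_id]

lemma map_lift_mp_comp {X Y Z W : D} (f : B.ob X Z ⟶ W) (x : M.el i X) (y : M.el i Y)
    (z : M.el i Z) :
    M.map (B.lift (B.mp (𝟙 X) (B.p₀ Y Z)) (B.mp (𝟙 X) (B.p₁ Y Z) ≫ f)) (pair x (pair y z)) =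
      pair (pair x y) (M.map f (pair x z)) := by
  rw [map_lift, map_mp_comp, map_mp_pair, map_p₀_pair, map_p₁_pair, M.map_id]

lemma map_powMap_succ (f : X ⟶ Y) (n : ℕ) (x : M.el i X) (y : M.el i (B.pow X n)) :
    M.map (powMap f (n + 1)) (consEl x y) = consEl (M.map f x) (M.map (powMap f n) y) :=
  map_mp_pair f (powMap f n) x y

lemma map_prepend_succ (n : ℕ) (x : M.el i X) (y : M.el i (B.pow X n)) (w : M.el i (M.sh X)) :
    M.map (M.prepend X (n + 1)) (pair (consEl x y) w) =
      M.map (M.cons X) (pair x (M.map (M.prepend X n) (pair y w))) :=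
  (M.map_comp (B.ass X (B.pow X n) (M.sh X)) (B.mp (𝟙 X) (M.prepend X n) ≫ M.cons X) _).trans
    ((congrArg _ (map_ass x y w)).trans (map_mp_comp _ _ _ _))

lemma map_mulPow_succ (n : ℕ) (x : M.el i (M.sh X)) (y : M.el i (B.pow (M.sh X) n)) :
    M.map (M.mulPow X (n + 1)) (consEl x y) = M.map (M.mul X) (pair x (M.map (M.mulPow X n) y)) :=
  map_mp_comp _ _ _ _

lemma map_parPow_succ (n : ℕ) (x : M.el i X) (y : M.el i Y) (z : M.el i (B.pow Y n)) :
    M.map (parPow X Y (n + 1)) (pair x (consEl y z)) =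
      consEl (pair x y) (M.map (parPow X Y n) (pair x z)) :=
  map_lift_mp_comp _ x y z

lemma toList_powMap (f : X ⟶ Y) (n : ℕ) (x : M.el i (B.pow X n)) :
    toList n (M.map (powMap f n) x) = (toList n x).map (M.map f) := by
  induction n with
  | zero => rfl
  | succ n ih =>
    obtain ⟨y, z, rfl⟩ := exists_eq_consEl x
    rw [map_powMap_succ, toList_consEl, toList_consEl, ih, List.map_cons]

lemma word_shMap (f : X ⟶ Y) (w : M.el i (M.sh X)) :
    word (M.map (M.shMap f) w) = (word w).map (M.map f) := by
  obtain ⟨n, x, rfl⟩ := exists_eq_inj w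
  rw [shMap, map_desc_inj, M.map_comp, word_inj, word_inj, toList_powMap]

lemma word_unit (x : M.el i X) : word (M.map (M.unit X) x) = [x] := word_inj 0 x

lemma word_cons (x : M.el i X) (w : M.el i (M.sh X)) :
    word (M.map (M.cons X) (pair x w)) = x :: word w := by
  obtain ⟨n, y, rfl⟩ := exists_eq_inj w
  rw [cons, word_inj]
  refine (congrArg word (map_descLeft (Z := B.pow X) _ n x y)).trans ?_
  exact (word_inj (n + 1) _).trans (toList_consEl x y)

lemma word_prepend (n : ℕ) (x : M.el i (B.pow X n)) (w : M.el i (M.sh X)) :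
    word (M.map (M.prepend X n) (pair x w)) = toList n x ++ word w := by
  induction n with
  | zero => exact word_cons x w
  | succ n ih =>
    obtain ⟨y, z, rfl⟩ := exists_eq_consEl x
    rw [map_prepend_succ, word_cons, ih, toList_consEl, List.cons_append]

lemma word_mul (v w : M.el i (M.sh X)) :
    word (M.map (M.mul X) (pair v w)) = word v ++ word w := by
  obtain ⟨n, x, rfl⟩ := exists_eq_inj v
  rw [mul, map_descRight, word_prepend, word_inj]

lemma word_mulPow (n : ℕ) (x : M.el i (B.pow (M.sh X) n)) :
    word (M.map (M.mulPow X n) x) = (toList n x).flatMap word := by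
  induction n with
  | zero => exact (congrArg word (M.map_id x)).trans (List.append_nil _).symm
  | succ n ih =>
    obtain ⟨y, z, rfl⟩ := exists_eq_consEl x
    rw [map_mulPow_succ, word_mul, ih, toList_consEl, List.flatMap_cons]

lemma word_join (w : M.el i (M.sh (M.sh X))) :
    word (M.map (M.join X) w) = (word w).flatMap word := by
  obtain ⟨n, x, rfl⟩ := exists_eq_inj w
  rw [join, map_desc_inj, word_mulPow, word_inj]

lemma toList_parPow (n : ℕ) (x : M.el i X) (y : M.el i (B.pow Y n)) :
    toList n (M.map (parPow X Y n) (pair x y)) = (toList n y).map (pair x) := by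
  induction n with
  | zero => exact congrArg (fun t => [t]) (M.map_id _)
  | succ n ih =>
    obtain ⟨y, z, rfl⟩ := exists_eq_consEl y
    rw [map_parPow_succ, toList_consEl, toList_consEl, ih, List.map_cons]

lemma word_par (x : M.el i X) (w : M.el i (M.sh Y)) :
    word (M.map (M.par X Y) (pair x w)) = (word w).map (pair x) := by
  obtain ⟨n, y, rfl⟩ := exists_eq_inj w
  rw [par, map_descLeft, M.map_comp, word_inj, word_inj, toList_parPow]

end

end PointModel

end IterCat

/-! ### The formally free semigroup -/

namespace IterCat

namespace PointModel

variable {D : Type u} [Category.{v} D] {B : BPlusCategory D} (M : PointModel.{v, u, u'} B)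

section

variable {M} {i : M.Pt} {X Y Z W : D}

lemma shMap_id (X : D) : M.shMap (𝟙 X) = 𝟙 (M.sh X) := by
  refine sh_hom_ext fun i w => ?_
  rw [word_shMap, M.map_id, funext (M.map_id (X := X)), List.map_id']

lemma shMap_comp (f : X ⟶ Y) (g : Y ⟶ Z) : M.shMap (f ≫ g) = M.shMap f ≫ M.shMap g := by
  refine sh_hom_ext fun i w => ?_
  rw [M.map_comp, word_shMap, word_shMap, word_shMap, List.map_map, funext (M.map_comp f g)]
  rfl

lemma unit_natural (f : X ⟶ Y) : f ≫ M.unit Y = M.unit X ≫ M.shMap f := by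
  refine sh_hom_ext fun i x => ?_
  rw [M.map_comp, M.map_comp, word_unit, word_shMap, word_unit, List.map_singleton]

lemma join_natural (f : X ⟶ Y) :
    M.shMap (M.shMap f) ≫ M.join Y = M.join X ≫ M.shMap f := by
  refine sh_hom_ext fun i w => ?_
  rw [M.map_comp, M.map_comp, word_join, word_shMap, word_shMap, word_join, List.flatMap_map,
    List.map_flatMap, funext (word_shMap (M := M) f)]

lemma shMap_unit_join (X : D) : M.shMap (M.unit X) ≫ M.join X = 𝟙 (M.sh X) := by
  refine sh_hom_ext fun i w => ?_
  rw [M.map_comp, word_join, word_shMap, List.flatMap_map, funext (word_unit (M := M) (X := X)),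
    List.flatMap_singleton', M.map_id]

lemma unit_join (X : D) : M.unit (M.sh X) ≫ M.join X = 𝟙 (M.sh X) := by
  refine sh_hom_ext fun i w => ?_
  rw [M.map_comp, word_join, word_unit, List.flatMap_singleton, M.map_id]

lemma join_join (X : D) : M.shMap (M.join X) ≫ M.join X = M.join (M.sh X) ≫ M.join X := by
  refine sh_hom_ext fun i w => ?_
  rw [M.map_comp, M.map_comp, word_join, word_join, word_shMap, word_join, List.flatMap_map,
    List.flatMap_assoc, funext (word_join (M := M) (X := X))]

end

/-- The free semigroup monad. -/
noncomputable abbrev sharpMonad : CategoryTheory.Monad D where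
  obj := M.sh
  map := M.shMap
  map_id := shMap_id
  map_comp := shMap_comp
  η := { app := M.unit, naturality := fun _ _ f => unit_natural f }
  μ := { app := M.join, naturality := fun _ _ f => join_natural f }
  assoc := join_join
  left_unit := unit_join
  right_unit := shMap_unit_join

/-- The free semigroup monad with the multiplication of the free semigroups. -/
noncomputable abbrev sharpData : SharpData B where
  sharp := M.sharpMonad
  m := M.mul

section

variable {M} {i : M.Pt} {X Y X' Y' A A' : D}

lemma word_dot (f : A ⟶ M.sh X) (g : A' ⟶ M.sh X) (a : M.el i A) (a' : M.el i A') :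
    word (M.map (M.sharpData.dot f g) (pair a a')) = word (M.map f a) ++ word (M.map g a') := by
  rw [SharpData.dot, M.map_comp, map_mp_pair]
  exact word_mul _ _

lemma dot_natural (f : A ⟶ M.sh X) (g : A' ⟶ M.sh X) (h : X ⟶ Y) :
    M.sharpData.dot f g ≫ M.shMap h = M.sharpData.dot (f ≫ M.shMap h) (g ≫ M.shMap h) := by
  refine sh_hom_ext fun i z => ?_
  obtain ⟨a, a', rfl⟩ := exists_eq_pair z
  rw [M.map_comp, word_shMap, word_dot, word_dot, List.map_append, M.map_comp, M.map_comp,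
    word_shMap, word_shMap]

lemma word_jn (n : ℕ) (x : M.el i (B.pow X n)) :
    word (M.map (M.sharpData.jn X n) x) = toList n x := by
  induction n with
  | zero => exact word_unit x
  | succ n ih =>
    obtain ⟨y, z, rfl⟩ := exists_eq_consEl x
    rw [toList_consEl, ← ih]
    refine (word_dot (M.unit X) (M.sharpData.jn X n) y z).trans ?_
    rw [word_unit]
    rfl

/-- Every element of `X^#` comes from a power of `X`. -/
lemma exists_map_jn (w : M.el i (M.sh X)) :
    ∃ (n : ℕ) (x : M.el i (B.pow X n)), M.map (M.sharpData.jn X n) x = w := by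
  obtain ⟨n, x, rfl⟩ := exists_eq_inj w
  exact ⟨n, x, word_injective ((word_jn n x).trans (word_inj n x).symm)⟩

lemma mul_natural (f : X ⟶ Y) : B.mp (M.shMap f) (M.shMap f) ≫ M.mul Y = M.mul X ≫ M.shMap f := by
  refine sh_hom_ext fun i z => ?_
  obtain ⟨v, w, rfl⟩ := exists_eq_pair z
  rw [M.map_comp, M.map_comp, map_mp_pair, word_mul, word_shMap, word_shMap, word_shMap, word_mul,
    List.map_append]

lemma mul_assoc (X : D) :
    B.mp (M.mul X) (𝟙 (M.sh X)) ≫ M.mul X =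
      B.ass (M.sh X) (M.sh X) (M.sh X) ≫ B.mp (𝟙 (M.sh X)) (M.mul X) ≫ M.mul X := by
  refine sh_hom_ext fun i z => ?_
  obtain ⟨v, w, rfl⟩ := exists_eq_pair z
  obtain ⟨v, v', rfl⟩ := exists_eq_pair v
  rw [M.map_comp, M.map_comp, map_ass, map_mp_comp, map_mp_pair, M.map_id]
  rw [word_mul, word_mul, word_mul, word_mul, List.append_assoc]

lemma join_mul (X : D) :
    B.mp (M.join X) (M.join X) ≫ M.mul X = M.mul (M.sh X) ≫ M.join X := by
  refine sh_hom_ext fun i z => ?_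
  obtain ⟨v, w, rfl⟩ := exists_eq_pair z
  rw [M.map_comp, M.map_comp, map_mp_pair, word_mul, word_join, word_join, word_join, word_mul,
    List.flatMap_append]

lemma par_natural (f : X ⟶ X') (g : Y ⟶ Y') :
    B.mp f (M.shMap g) ≫ M.par X' Y' = M.par X Y ≫ M.shMap (B.mp f g) := by
  refine sh_hom_ext fun i z => ?_
  obtain ⟨x, w, rfl⟩ := exists_eq_pair z
  rw [M.map_comp, M.map_comp, map_mp_pair, word_par, word_shMap, word_shMap, word_par,
    List.map_map, List.map_map]
  exact List.map_congr_left fun y _ => (map_mp_pair f g x y).symm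

lemma par_p₁ (X Y : D) : M.par X Y ≫ M.shMap (B.p₁ X Y) = B.p₁ X (M.sh Y) := by
  refine sh_hom_ext fun i z => ?_
  obtain ⟨x, w, rfl⟩ := exists_eq_pair z
  rw [M.map_comp, word_shMap, word_par, List.map_map, map_p₁_pair]
  exact (List.map_congr_left fun y _ => map_p₁_pair x y).trans (List.map_id _)

/-- Invertibility says that a word has a first letter and a possibly empty rest. -/
instance isIso_consMap (X : D) : IsIso (M.sharpData.consMap X) := by
  have h₀ {i : M.Pt} (x : M.el i X) : word (M.map (M.sharpData.consMap X) (inl x)) = [x] :=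
    (congrArg word (map_desc_inl _ _ x)).trans (word_unit x)
  have h₁ {i : M.Pt} (x : M.el i X) (w : M.el i (M.sh X)) :
      word (M.map (M.sharpData.consMap X) (inr (pair x w))) = x :: word w :=
    (congrArg word (map_desc_inr _ _ _)).trans <| (word_dot (M.unit X) (𝟙 (M.sh X)) x w).trans <| by
      rw [word_unit, M.map_id]
      rfl
  refine isIso_of_word _ (fun i a a' e => ?_) fun i l hl => ?_
  · rcases cob_cases a with ⟨x, rfl⟩ | ⟨z, rfl⟩ <;> rcases cob_cases a' with ⟨y, rfl⟩ | ⟨z', rfl⟩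
    · rw [h₀, h₀] at e
      rw [List.singleton_injective e]
    · obtain ⟨y, w, rfl⟩ := exists_eq_pair z'
      rw [h₀, h₁] at e
      exact absurd (List.cons.inj e).2.symm (word_ne_nil w)
    · obtain ⟨x, w, rfl⟩ := exists_eq_pair z
      rw [h₀, h₁] at e
      exact absurd (List.cons.inj e).2 (word_ne_nil w)
    · obtain ⟨x, w, rfl⟩ := exists_eq_pair z
      obtain ⟨y, w', rfl⟩ := exists_eq_pair z'
      rw [h₁, h₁] at e
      rw [(List.cons.inj e).1, word_injective (List.cons.inj e).2]
  · obtain ⟨x, l, rfl⟩ := List.exists_cons_of_ne_nil hl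
    by_cases hl' : l = []
    · subst hl'
      exact ⟨_, h₀ x⟩
    · obtain ⟨w, rfl⟩ := exists_word l hl'
      exact ⟨_, h₁ x w⟩

/-- Invertibility says that a word has a last letter and a possibly empty rest. -/
instance isIso_snocMap (X : D) : IsIso (M.sharpData.snocMap X) := by
  have h₀ {i : M.Pt} (x : M.el i X) : word (M.map (M.sharpData.snocMap X) (inr x)) = [x] :=
    (congrArg word (map_desc_inr _ _ x)).trans (word_unit x)
  have h₁ {i : M.Pt} (x : M.el i X) (w : M.el i (M.sh X)) :
      word (M.map (M.sharpData.snocMap X) (inl (pair w x))) = word w ++ [x] :=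
    (congrArg word (map_desc_inl _ _ _)).trans <| (word_dot (𝟙 (M.sh X)) (M.unit X) w x).trans <| by
      rw [word_unit, M.map_id]
  refine isIso_of_word _ (fun i a a' e => ?_) fun i l hl => ?_
  · rcases cob_cases a with ⟨z, rfl⟩ | ⟨x, rfl⟩ <;> rcases cob_cases a' with ⟨z', rfl⟩ | ⟨y, rfl⟩
    · obtain ⟨w, x, rfl⟩ := exists_eq_pair z
      obtain ⟨w', y, rfl⟩ := exists_eq_pair z'
      rw [h₁, h₁] at e
      obtain ⟨e₀, e₁⟩ := List.append_inj' e rfl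
      rw [word_injective e₀, List.singleton_injective e₁]
    · obtain ⟨w, x, rfl⟩ := exists_eq_pair z
      rw [h₀, h₁, ← List.nil_append [y]] at e
      exact absurd (List.append_inj' e rfl).1 (word_ne_nil w)
    · obtain ⟨w, y, rfl⟩ := exists_eq_pair z'
      rw [h₀, h₁, ← List.nil_append [x]] at e
      exact absurd (List.append_inj' e rfl).1.symm (word_ne_nil w)
    · rw [h₀, h₀] at e
      rw [List.singleton_injective e]
  · rcases List.eq_nil_or_concat l with rfl | ⟨l, x, rfl⟩
    · exact absurd rfl hl
    · by_cases hl' : l = []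
      · subst hl'
        exact ⟨_, h₀ x⟩
      · obtain ⟨w, rfl⟩ := exists_word l hl'
        exact ⟨_, (h₁ x w).trans (List.concat_eq_append ..).symm⟩

lemma word_a₀ (v : M.el i (M.sh X)) :
    word (M.map (M.sharpData.a₀ X Y) v) = (word v).map inl := word_shMap _ v

lemma word_a₁ (v : M.el i (M.sh Y)) :
    word (M.map (M.sharpData.a₁ X Y) v) = (word v).map inr := word_shMap _ v

lemma word_a₀₁ (w : M.el i (M.sh (B.ob (M.sh X) (M.sh Y)))) :
    word (M.map (M.sharpData.a₀₁ X Y) w) =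
      (word w).flatMap fun q => (word (fst q)).map inl ++ (word (snd q)).map inr := by
  refine (congrArg word (M.map_comp _ _ w)).trans ((word_join _).trans ?_)
  refine (congrArg (List.flatMap word) (word_shMap _ w)).trans ?_
  rw [List.flatMap_map]
  congr 1
  funext q
  obtain ⟨v, v', rfl⟩ := exists_eq_pair q
  rw [word_dot, word_a₀, word_a₁, fst_pair, snd_pair]

lemma word_a₁₀ (w : M.el i (M.sh (B.ob (M.sh Y) (M.sh X)))) :
    word (M.map (M.sharpData.a₁₀ X Y) w) =
      (word w).flatMap fun q => (word (fst q)).map inr ++ (word (snd q)).map inl := by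
  refine (congrArg word (M.map_comp _ _ w)).trans ((word_join _).trans ?_)
  refine (congrArg (List.flatMap word) (word_shMap _ w)).trans ?_
  rw [List.flatMap_map]
  congr 1
  funext q
  obtain ⟨v, v', rfl⟩ := exists_eq_pair q
  rw [word_dot, word_a₀, word_a₁, fst_pair, snd_pair]

/-- The element of `X^#` that corresponds to a nonempty word. -/
noncomputable def ofNE (a : NEList (M.el i X)) : M.el i (M.sh X) :=
  (exists_word (a.1 :: a.2) (List.cons_ne_nil _ _)).choose

lemma word_ofNE (a : NEList (M.el i X)) : word (ofNE a : M.el i (M.sh X)) = a.1 :: a.2 :=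
  (exists_word (a.1 :: a.2) (List.cons_ne_nil _ _)).choose_spec

lemma ofNE_surjective : Function.Surjective (ofNE : NEList (M.el i X) → M.el i (M.sh X)) := by
  intro w
  obtain ⟨x, l, h⟩ := List.exists_cons_of_ne_nil (word_ne_nil w)
  exact ⟨(x, l), word_injective ((word_ofNE _).trans h.symm)⟩

/-- The element of `X^# × Y^#` that corresponds to a pair of nonempty words. -/
noncomputable def ofBlock (q : NEList (M.el i X) × NEList (M.el i Y)) :
    M.el i (B.ob (M.sh X) (M.sh Y)) :=
  pair (ofNE q.1) (ofNE q.2)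

lemma ofBlock_surjective : Function.Surjective
    (ofBlock : _ → M.el i (B.ob (M.sh X) (M.sh Y))) := by
  intro z
  obtain ⟨v, w, rfl⟩ := exists_eq_pair z
  obtain ⟨a, rfl⟩ := ofNE_surjective v
  obtain ⟨b, rfl⟩ := ofNE_surjective w
  exact ⟨(a, b), rfl⟩

/-- The element of `(X^# × Y^#)^#` that corresponds to a list of pairs of nonempty words. -/
noncomputable def ofBlocks (l : NEList (NEList (M.el i X) × NEList (M.el i Y))) :
    M.el i (M.sh (B.ob (M.sh X) (M.sh Y))) :=
  ofNE (ofBlock l.1, l.2.map ofBlock)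

lemma ofBlocks_surjective : Function.Surjective
    (ofBlocks : _ → M.el i (M.sh (B.ob (M.sh X) (M.sh Y)))) := by
  intro z
  obtain ⟨⟨q, l⟩, rfl⟩ := ofNE_surjective z
  obtain ⟨q, rfl⟩ := ofBlock_surjective q
  obtain ⟨l, rfl⟩ := List.map_surjective_iff.2 ofBlock_surjective l
  exact ⟨(q, l), rfl⟩

lemma word_a₀₁_ofBlocks (l : NEList (NEList (M.el i X) × NEList (M.el i Y))) :
    word (M.map (M.sharpData.a₀₁ X Y) (ofBlocks l)) = BlockWord.blocks inl inr l := by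
  rw [word_a₀₁, ofBlocks, word_ofNE]
  change List.flatMap _ ((l.1 :: l.2).map ofBlock) = _
  rw [List.flatMap_map, BlockWord.blocks]
  congr 1
  funext q
  rw [ofBlock, fst_pair, snd_pair, word_ofNE, word_ofNE]
  rfl

lemma word_a₁₀_ofBlocks (l : NEList (NEList (M.el i Y) × NEList (M.el i X))) :
    word (M.map (M.sharpData.a₁₀ X Y) (ofBlocks l)) = BlockWord.blocks inr inl l := by
  rw [word_a₁₀, ofBlocks, word_ofNE]
  change List.flatMap _ ((l.1 :: l.2).map ofBlock) = _
  rw [List.flatMap_map, BlockWord.blocks]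
  congr 1
  funext q
  rw [ofBlock, fst_pair, snd_pair, word_ofNE, word_ofNE]
  rfl

/-- The element of the domain of `unwd` that corresponds to a word divided into blocks: the six
summands are the six constructors of the two types of block words. -/
noncomputable def ofBlockWord :
    BlockWord (M.el i X) (M.el i Y) ⊕ BlockWord (M.el i Y) (M.el i X) →
      M.el i (M.sharpData.wdOb X Y)
  | .inl (.all a) => inl (inl (inl (inl (inl (ofNE a)))))
  | .inr (.all b) => inl (inl (inl (inl (inr (ofNE b)))))
  | .inl (.even l) => inl (inl (inl (inr (ofBlocks l))))
  | .inr (.even l) => inl (inl (inr (ofBlocks l)))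
  | .inr (.odd b l) => inl (inr (pair (ofNE b) (ofBlocks l)))
  | .inl (.odd a l) => inr (pair (ofNE a) (ofBlocks l))

lemma ofBlockWord_surjective :
    Function.Surjective (ofBlockWord : _ → M.el i (M.sharpData.wdOb X Y)) := by
  intro z
  obtain ⟨z, rfl⟩ | ⟨z, rfl⟩ := cob_cases z
  · obtain ⟨z, rfl⟩ | ⟨z, rfl⟩ := cob_cases z
    · obtain ⟨z, rfl⟩ | ⟨z, rfl⟩ := cob_cases z
      · obtain ⟨z, rfl⟩ | ⟨z, rfl⟩ := cob_cases z
        · obtain ⟨z, rfl⟩ | ⟨z, rfl⟩ := cob_cases z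
          · obtain ⟨a, rfl⟩ := ofNE_surjective (M := M) z
            exact ⟨.inl (.all a), rfl⟩
          · obtain ⟨a, rfl⟩ := ofNE_surjective (M := M) z
            exact ⟨.inr (.all a), rfl⟩
        · obtain ⟨l, rfl⟩ := ofBlocks_surjective (M := M) z
          exact ⟨.inl (.even l), rfl⟩
      · obtain ⟨l, rfl⟩ := ofBlocks_surjective (M := M) z
        exact ⟨.inr (.even l), rfl⟩
    · obtain ⟨v, w, rfl⟩ := exists_eq_pair z
      obtain ⟨b, rfl⟩ := ofNE_surjective (M := M) v
      obtain ⟨l, rfl⟩ := ofBlocks_surjective (M := M) w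
      exact ⟨.inr (.odd b l), rfl⟩
  · obtain ⟨v, w, rfl⟩ := exists_eq_pair z
    obtain ⟨a, rfl⟩ := ofNE_surjective (M := M) v
    obtain ⟨l, rfl⟩ := ofBlocks_surjective (M := M) w
    exact ⟨.inl (.odd a l), rfl⟩

lemma word_unwd (w : BlockWord (M.el i X) (M.el i Y) ⊕ BlockWord (M.el i Y) (M.el i X)) :
    word (M.map (M.sharpData.unwd X Y) (ofBlockWord w)) = BlockWord.flatten₂ inl inr w := by
  rcases w with (a | l | ⟨a, l⟩) | (b | l | ⟨b, l⟩) <;>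
    simp only [ofBlockWord, SharpData.unwd, map_desc_inl, map_desc_inr]
  · rw [word_a₀, word_ofNE]
    rfl
  · exact word_a₀₁_ofBlocks l
  · rw [word_dot, word_a₀, word_ofNE, word_a₁₀_ofBlocks]
    rfl
  · rw [word_a₁, word_ofNE]
    rfl
  · exact word_a₁₀_ofBlocks l
  · rw [word_dot, word_a₁, word_ofNE, word_a₀₁_ofBlocks]
    rfl

/-- Invertibility is the unique division of a word into maximal blocks. -/
instance isIso_unwd (X Y : D) : IsIso (M.sharpData.unwd X Y) := by
  refine isIso_of_word _ (fun i a a' e => ?_) fun i l hl => ?_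
  · obtain ⟨w, rfl⟩ := ofBlockWord_surjective a
    obtain ⟨w', rfl⟩ := ofBlockWord_surjective a'
    rw [word_unwd, word_unwd] at e
    rw [BlockWord.flatten₂_injective inl_injective inr_injective inl_ne_inr e]
  · obtain ⟨w, rfl⟩ := BlockWord.exists_flatten₂ inl inr cob_cases l hl
    exact ⟨_, word_unwd w⟩

end

section

variable {X X' Y Y' Z W A A' E E' : D}

lemma cmp_desc (f : X ⟶ X') (g : Y ⟶ Y') (h : X' ⟶ Z) (k : Y' ⟶ Z) :
    B.cmp f g ≫ B.desc h k = B.desc (f ≫ h) (g ≫ k) := by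
  rw [CoprodData.desc, CoprodData.desc, ← Category.assoc, ← B.cmp_comp]

lemma desc_comp (h : X ⟶ Z) (k : Y ⟶ Z) (c : Z ⟶ W) :
    B.desc h k ≫ c = B.desc (h ≫ c) (k ≫ c) := by
  rw [CoprodData.desc, CoprodData.desc, Category.assoc, ← B.nabla_natural, ← Category.assoc,
    ← B.cmp_comp]

lemma cmp_desc_eq {f : X ⟶ X'} {g : Y ⟶ Y'} {h : X ⟶ Z} {k : Y ⟶ Z} {h' : X' ⟶ W} {k' : Y' ⟶ W}
    {c : Z ⟶ W} (h₀ : f ≫ h' = h ≫ c) (h₁ : g ≫ k' = k ≫ c) :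
    B.cmp f g ≫ B.desc h' k' = B.desc h k ≫ c := by
  rw [cmp_desc, desc_comp, h₀, h₁]

lemma mp_dot (S : SharpData B) (f : A ⟶ E) (g : A' ⟶ E') (h : E ⟶ S.sh X) (k : E' ⟶ S.sh X) :
    B.mp f g ≫ S.dot h k = S.dot (f ≫ h) (g ≫ k) := by
  rw [SharpData.dot, SharpData.dot, ← Category.assoc, ← B.mp_comp]

variable {M}

lemma mp_dot_eq {f : A ⟶ E} {g : A' ⟶ E'} {h : A ⟶ M.sh X} {k : A' ⟶ M.sh X} {h' : E ⟶ M.sh Y}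
    {k' : E' ⟶ M.sh Y} {c : X ⟶ Y} (h₀ : f ≫ h' = h ≫ M.shMap c) (h₁ : g ≫ k' = k ≫ M.shMap c) :
    B.mp f g ≫ M.sharpData.dot h' k' = M.sharpData.dot h k ≫ M.shMap c := by
  rw [mp_dot, dot_natural, h₀, h₁]

lemma consMap_natural (f : X ⟶ Y) :
    B.cmp f (B.mp f (M.shMap f)) ≫ M.sharpData.consMap Y = M.sharpData.consMap X ≫ M.shMap f :=
  cmp_desc_eq (unit_natural f) (mp_dot_eq (unit_natural f)
    ((Category.comp_id _).trans (Category.id_comp _).symm))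

lemma snocMap_natural (f : X ⟶ Y) :
    B.cmp (B.mp (M.shMap f) f) f ≫ M.sharpData.snocMap Y = M.sharpData.snocMap X ≫ M.shMap f :=
  cmp_desc_eq (mp_dot_eq ((Category.comp_id _).trans (Category.id_comp _).symm)
    (unit_natural f)) (unit_natural f)

lemma a₀_natural (f : X ⟶ X') (g : Y ⟶ Y') :
    M.shMap f ≫ M.sharpData.a₀ X' Y' = M.sharpData.a₀ X Y ≫ M.shMap (B.cmp f g) :=
  (shMap_comp _ _).symm.trans ((congrArg _ (B.i₀_natural f g)).trans (shMap_comp _ _))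

lemma a₁_natural (f : X ⟶ X') (g : Y ⟶ Y') :
    M.shMap g ≫ M.sharpData.a₁ X' Y' = M.sharpData.a₁ X Y ≫ M.shMap (B.cmp f g) :=
  (shMap_comp _ _).symm.trans ((congrArg _ (B.i₁_natural f g)).trans (shMap_comp _ _))

lemma shMap_join_eq {f : A ⟶ E} {h : A ⟶ M.sh X} {h' : E ⟶ M.sh Y} {c : X ⟶ Y}
    (e : f ≫ h' = h ≫ M.shMap c) :
    M.shMap f ≫ M.shMap h' ≫ M.join Y = (M.shMap h ≫ M.join X) ≫ M.shMap c := by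
  rw [← Category.assoc, ← shMap_comp, e, shMap_comp, Category.assoc, join_natural, Category.assoc]

lemma a₀₁_natural (f : X ⟶ X') (g : Y ⟶ Y') :
    M.shMap (B.mp (M.shMap f) (M.shMap g)) ≫ M.sharpData.a₀₁ X' Y' =
      M.sharpData.a₀₁ X Y ≫ M.shMap (B.cmp f g) :=
  shMap_join_eq (mp_dot_eq (a₀_natural f g) (a₁_natural f g))

lemma a₁₀_natural (f : X ⟶ X') (g : Y ⟶ Y') :
    M.shMap (B.mp (M.shMap g) (M.shMap f)) ≫ M.sharpData.a₁₀ X' Y' =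
      M.sharpData.a₁₀ X Y ≫ M.shMap (B.cmp f g) :=
  shMap_join_eq (mp_dot_eq (a₁_natural f g) (a₀_natural f g))

/-- The components of `unwd` are natural, summand by summand. -/
lemma unwd_natural (f : X ⟶ X') (g : Y ⟶ Y') :
    M.sharpData.wdObMap f g ≫ M.sharpData.unwd X' Y' =
      M.sharpData.unwd X Y ≫ M.shMap (B.cmp f g) :=
  cmp_desc_eq (cmp_desc_eq (cmp_desc_eq (cmp_desc_eq (cmp_desc_eq (a₀_natural f g)
    (a₁_natural f g)) (a₀₁_natural f g)) (a₁₀_natural f g))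
    (mp_dot_eq (a₁_natural f g) (a₀₁_natural f g))) (mp_dot_eq (a₀_natural f g) (a₁₀_natural f g))

/-- The inverses of natural isomorphisms are natural. -/
lemma comp_inv_eq_inv_comp {f : A ⟶ E} [IsIso f] {f' : A' ⟶ E'} [IsIso f'] {h : A ⟶ A'}
    {k : E ⟶ E'} (e : h ≫ f' = f ≫ k) : k ≫ inv f' = inv f ≫ h := by
  rw [IsIso.comp_inv_eq, Category.assoc, e, IsIso.inv_hom_id_assoc]

end

/-- The `B^#`-category structure given by the free semigroups. -/
noncomputable def bSharp : BSharp B where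
  toSharpData := M.sharpData
  m_natural := mul_natural
  m_assoc := mul_assoc
  e_hom := join_mul
  l X := inv (M.sharpData.consMap X)
  l_natural f := comp_inv_eq_inv_comp (consMap_natural f)
  l_consMap _ := IsIso.inv_hom_id _
  consMap_l _ := IsIso.hom_inv_id _
  r X := inv (M.sharpData.snocMap X)
  r_natural f := comp_inv_eq_inv_comp (snocMap_natural f)
  r_snocMap _ := IsIso.inv_hom_id _
  snocMap_r _ := IsIso.hom_inv_id _
  par := M.par
  par_natural := par_natural
  par_p₁ := par_p₁
  wd X Y := inv (M.sharpData.unwd X Y)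
  wd_natural f g := comp_inv_eq_inv_comp (unwd_natural f g)
  wd_unwd _ _ := IsIso.inv_hom_id _
  unwd_wd _ _ := IsIso.hom_inv_id _

end PointModel

end IterCat

/-! ### Partial morphisms as an iteration category -/

namespace IterCat

namespace Pfn

variable {F : Type u ⥤ Type u} [WeaklyPreservesPullbacks F] [HasBinaryProducts (SetF F)]

section Total

variable {X Y Z : (pCategory F).Total}

/-- The homomorphism of coalgebras that corresponds to a total partial morphism. -/
noncomputable def homOf (f : X ⟶ Y) : X.obj.obj ⟶ Y.obj.obj :=
  ((total_iff_exists f.hom).1 f.property).choose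

lemma hom_eq_ofHom (f : X ⟶ Y) : f.hom = ofHom (homOf f) :=
  ((total_iff_exists f.hom).1 f.property).choose_spec

lemma homOf_eq {f : X ⟶ Y} {g : X.obj.obj ⟶ Y.obj.obj} (h : f.hom = ofHom g) : homOf f = g :=
  ofHom_injective ((hom_eq_ofHom f).symm.trans h)

lemma homOf_id (X : (pCategory F).Total) : homOf (𝟙 X) = 𝟙 X.obj.obj := homOf_eq rfl

lemma homOf_comp (f : X ⟶ Y) (g : Y ⟶ Z) : homOf (f ≫ g) = homOf f ≫ homOf g := by
  refine homOf_eq (Eq.trans ?_ (ofHom_comp (homOf f) (homOf g)).symm)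
  rw [← hom_eq_ofHom, ← hom_eq_ofHom]
  rfl

/-- The total partial morphism that corresponds to a homomorphism of coalgebras. -/
def totalOfHom (g : X.obj.obj ⟶ Y.obj.obj) : X ⟶ Y :=
  ⟨ofHom g, (total_iff_exists _).2 ⟨g, rfl⟩⟩

lemma homOf_totalOfHom (g : X.obj.obj ⟶ Y.obj.obj) : homOf (totalOfHom g : X ⟶ Y) = g :=
  homOf_eq rfl

lemma total_hom_ext {f g : X ⟶ Y} (h : homOf f = homOf g) : f = g :=
  WideSubcategory.hom_ext _ (by rw [hom_eq_ofHom f, hom_eq_ofHom g, h])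

end Total

variable (F) in
/-- The `B⁺`-category structure on the homomorphisms of coalgebras. -/
noncomputable abbrev totalBPlus : BPlusCategory (pCategory F).Total :=
  (pPlusCategory F).totalBPlus isProdominical_pCategory

/-- The coproduct of a sequence of coalgebras. -/
def totalSigma (Z : ℕ → (pCategory F).Total) : (pCategory F).Total :=
  ⟨PartialMaps.of (SetF.sigma fun k : ULift.{u} ℕ => (Z k.down).obj.obj)⟩

/-- The inclusions of the members of a sequence of coalgebras into the coproduct. -/
def totalSigmaInj (Z : ℕ → (pCategory F).Total) (n : ℕ) : Z n ⟶ totalSigma Z :=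
  totalOfHom (SetF.sigmaInj (fun k : ULift.{u} ℕ => (Z k.down).obj.obj) ⟨n⟩)

lemma exists_totalSigmaDesc {Z : ℕ → (pCategory F).Total} {W : (pCategory F).Total}
    (f : ∀ n, Z n ⟶ W) : ∃ g : totalSigma Z ⟶ W, ∀ n, totalSigmaInj Z n ≫ g = f n := by
  obtain ⟨g, hg⟩ := (SetF.isSum_sigmaInj fun k : ULift.{u} ℕ => (Z k.down).obj.obj).exists_desc
    (X := W.obj.obj) fun k => homOf (f k.down)
  refine ⟨totalOfHom g, fun n => total_hom_ext ?_⟩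
  rw [homOf_comp]
  refine (congrArg₂ (fun a b => a ≫ b) (homOf_totalOfHom _)
    (homOf_totalOfHom (X := totalSigma Z) (Y := W) g)).trans (hg ⟨n⟩)

variable (F) in
/-- The germ functors, as points of the category of coalgebras. -/
noncomputable def pointModel : PointModel (totalBPlus F) where
  Pt := PointedCoalg F
  el p X := Germ p X.obj.obj
  map f := Germ.map (homOf f)
  map_id x := by rw [homOf_id, Germ.map_id]
  map_comp f g x := by rw [homOf_comp, Germ.map_comp]
  hom_ext h := total_hom_ext (Germ.hom_ext h)
  isIso f hf := by
    have := Germ.isIso_of_map_bijective (homOf f) hf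
    exact (pCategory F).isIso_total f (by rw [hom_eq_ofHom]; infer_instance)
  prod_bijective p X Y := by
    have h₀ : homOf ((totalBPlus F).p₀ X Y) = Limits.prod.fst := homOf_eq rfl
    have h₁ : homOf ((totalBPlus F).p₁ X Y) = Limits.prod.snd := homOf_eq rfl
    rw [h₀, h₁]
    refine ⟨fun z w h => Germ.prod_ext (prodIsProd _ _) (congrArg Prod.fst h)
      (congrArg Prod.snd h), fun q => ?_⟩
    obtain ⟨z, hz, hz'⟩ := Germ.exists_pair (prodIsProd X.obj.obj Y.obj.obj) q.1 q.2
    exact ⟨z, Prod.ext hz hz'⟩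
  cob_bijective p X Y := by
    have h₀ : homOf ((totalBPlus F).i₀ X Y) = SetF.inl _ _ := homOf_eq rfl
    have h₁ : homOf ((totalBPlus F).i₁ X Y) = SetF.inr _ _ := homOf_eq rfl
    rw [h₀, h₁]
    refine ⟨Function.Injective.sumElim Germ.inl_injective Germ.inr_injective Germ.inl_ne_inr,
      fun z => ?_⟩
    rcases Germ.sum_cases (A := X.obj.obj) (B := Y.obj.obj) z with ⟨x, rfl⟩ | ⟨y, rfl⟩
    · exact ⟨Sum.inl x, rfl⟩
    · exact ⟨Sum.inr y, rfl⟩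
  sigma := totalSigma
  inj := totalSigmaInj
  desc f := (exists_totalSigmaDesc f).choose
  inj_desc f := (exists_totalSigmaDesc f).choose_spec
  sigma_bijective p Z := by
    -- The index set of a coproduct of coalgebras lives in the universe of `F`, hence `ULift ℕ`.
    have h := Germ.bijective_of_isSum (p := p)
      (SetF.isSum_sigmaInj fun k : ULift.{u} ℕ => (Z k.down).obj.obj)
    have e : (fun x : (Σ n, Germ p (Z n).obj.obj) => Germ.map (homOf (totalSigmaInj Z x.1)) x.2) =
        (fun x : (Σ k : ULift.{u} ℕ, Germ p (Z k.down).obj.obj) =>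
          Germ.map (SetF.sigmaInj (fun k : ULift.{u} ℕ => (Z k.down).obj.obj) x.1) x.2) ∘
        Equiv.sigmaCongrLeft' Equiv.ulift.symm := by
      funext x
      exact congrArg (fun g => Germ.map g x.2) (homOf_totalOfHom _)
    rw [e]
    exact h.comp (Equiv.bijective _)

/-! ### Ranges of the powers -/

lemma mp_dom {Y X Z : Pfn F} (φ : X ⟶ Z) :
    (pCategory F).mp (𝟙 Y) ((pCategory F).dom φ) =
      (pCategory F).dom ((pCategory F).mp (𝟙 Y) φ) := by
  refine rel_ext fun p z w => (rel_mp _ _ _ _).trans (Iff.trans ?_ (rel_dom _ _ _ _).symm)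
  rw [rel_id, rel_dom, ← and_assoc]
  refine and_congr ext_iff.symm (Iff.trans ?_ (exists_congr fun v => (rel_mp _ _ z v).symm))
  constructor
  · rintro ⟨y, hy⟩
    exact ⟨pair (fst z) y, (rel_id _ _).2 (fst_pair _ _).symm, by rwa [snd_pair]⟩
  · rintro ⟨v, -, hv⟩
    exact ⟨_, hv⟩

/-- Domains that receive a family of partial morphisms which jointly cover all germs have the
identity as their union. -/
lemma isUnion_id {X : Pfn F} {A : ℕ → Pfn F} (j : ∀ n, A n ⟶ X) {ε : ℕ → (X ⟶ X)}
    (hε : ∀ n, ε n ∈ (pCategory F).Dom X) (hj : ∀ n, j n ≫ ε n = j n)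
    (h : ∀ p (x : Germ p X.obj), ∃ n a, rel p (j n) a x) : (pCategory F).IsUnion ε (𝟙 X) := by
  refine ⟨⟨X, 𝟙 X, ((pCategory F).total.id_mem X).symm⟩, hε, fun n => Category.comp_id _,
    fun Z φ φ' e => ?_⟩
  have aux {φ φ' : X ⟶ Z} (e : ∀ n, ε n ≫ φ = ε n ≫ φ') (p : PointedCoalg F) (x : Germ p X.obj)
      (z : Germ p Z.obj) (hz : rel p φ x z) : rel p φ' x z := by
    obtain ⟨n, a, ha⟩ := h p x
    have e' : j n ≫ φ = j n ≫ φ' := by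
      rw [← hj, Category.assoc, Category.assoc, e]
    have hz' := (rel_comp _ _ _ _).2 ⟨x, ha, hz⟩
    rw [e', rel_comp] at hz'
    obtain ⟨x', hx', hz'⟩ := hz'
    rwa [rel_unique ha hx']
  rw [Category.id_comp, Category.id_comp]
  exact rel_ext fun p x z => ⟨aux e p x z, aux (fun n => (e n).symm) p x z⟩

/-- The union is stable because a germ in `Y ⊠ X` is a pair of germs. -/
lemma isStableUnion_id {X : Pfn F} {A : ℕ → Pfn F} (j : ∀ n, A n ⟶ X) {ε : ℕ → (X ⟶ X)}
    (hε : ∀ n, ε n ∈ (pCategory F).Dom X) (hj : ∀ n, j n ≫ ε n = j n)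
    (h : ∀ p (x : Germ p X.obj), ∃ n a, rel p (j n) a x) :
    (pCategory F).IsStableUnion ε (𝟙 X) := by
  refine ⟨isUnion_id j hε hj h, fun Y => ?_⟩
  rw [BoxData.mp_id]
  refine isUnion_id (fun n => (pCategory F).mp (𝟙 Y) (j n)) (fun n => ?_) (fun n => ?_)
    fun p w => ?_
  · obtain ⟨Z, φ, hφ⟩ := hε n
    exact ⟨_, (pCategory F).mp (𝟙 Y) φ, by rw [hφ, mp_dom]⟩
  · rw [← BoxData.mp_comp, Category.comp_id, hj]
  · obtain ⟨n, a, ha⟩ := h p (snd w)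
    exact ⟨n, pair (fst w) a, (rel_mp _ _ _ _).2
      ⟨(rel_id _ _).2 (fst_pair _ _), by rwa [snd_pair]⟩⟩

variable (F) in
/-- The iteration category structure of `Pfn_F`. -/
noncomputable def iterationCategory : IterationCategory (Pfn F) where
  toPPlusCategory := pPlusCategory F
  isProdominical := isProdominical_pCategory
  hasRanges _ _ φ := exists_isRange φ
  weakChoice := weakChoice_pCategory
  bSharp := (pointModel F).bSharp
  stable_union X := by
    choose ε hε using fun n => exists_isRange ((pointModel F).bSharp.jn X n).hom
    refine ⟨ε, hε, isStableUnion_id (fun n => ((pointModel F).bSharp.jn X n).hom)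
      (fun n => (hε n).1) (fun n => (hε n).2.1) fun p x => ?_⟩
    obtain ⟨n, a, ha⟩ := PointModel.exists_map_jn (M := pointModel F) (i := p) (X := X) x
    refine ⟨n, a, ?_⟩
    rw [hom_eq_ofHom]
    exact (rel_ofHom _ _ _).2 ha

lemma extendsProduct_pCategory : ExtendsProduct (pCategory F) :=
  ⟨fun _ _ => Limits.prod.fst, fun _ _ => Limits.prod.snd, fun _ _ => ⟨prodIsProd _ _⟩,
    fun _ _ => rfl, fun _ _ => rfl, fun m hm φ m' hm' φ' => by
      have : Mono m := hm
      have : Mono m' := hm'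
      exact ⟨Limits.prod.map m m', inferInstanceAs (Mono (Limits.prod.map m m')),
        Limits.prod.map φ φ', Limits.prod.map_fst _ _, Limits.prod.map_snd _ _,
        Limits.prod.map_fst _ _, Limits.prod.map_snd _ _, rfl⟩⟩

end Pfn

end IterCat

theorem mainTheorem3 (F : Type u ⥤ Type u) [IterCat.WeaklyPreservesPullbacks F]
    (hF : IterCat.IsNontrivialEndofunctor F)
    (hF' : IterCat.IsBoundedEndofunctor F ∨ F.IsAccessible.{u}) :
    ∃ I : IterCat.IterationCategory (IterCat.Pfn F),
      IterCat.ExtendsProduct I.toPCategory ∧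
      IterCat.ExtendsCoproduct I.toCoprodData ∧
      ∀ (X Y : IterCat.Pfn F) (f : X ⟶ Y), I.total f ↔
        ∃ g : X.obj ⟶ Y.obj, f = (IterCat.PartialMaps.embedding _).map g := by
  have := IterCat.hasBinaryProducts_setF
    (hF'.elim id IterCat.isBoundedEndofunctor_of_isAccessible)
  exact ⟨IterCat.Pfn.iterationCategory F, IterCat.Pfn.extendsProduct_pCategory,
    IterCat.Pfn.extendsCoproduct_coprodData, fun _ _ => IterCat.Pfn.total_iff_exists⟩
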